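/- **Theorem (universality at the origin, symplectic chiral elliptic Ginibre ensemble).** Let $\nu>-1$ and $0<\tau<1$. For $z\in\mathbb C\setminus\{0\}$ let $$w_\tau(z)=|z|^{\nu}K_\nu\Big(\frac{2|z|}{1-\tau^2}\Big)\exp\Big(\frac{2\tau\,\mathrm{Re}\,z}{1-\tau^2}\Big),$$ where $K_\nu$, $I_\nu$ are the modified Bessel functions. With the generalised Laguerre polynomials $L^{(\nu)}_n$ (and $(-1)!!=1$) let $$\sigma_{\tau,N}(z,u)=-\sum_{k=0}^{N-1}\frac{\sqrt\pi\,\Gamma(\nu+2)(2k)!!\,\tau^{2k+1}}{2^{k+\nu+1}\Gamma(k+\frac\nu2+\frac32)}\sum_{l=0}^{k}\frac{(2l-1)!!\,\tau^{2l}}{2^l\,\Gamma(l+\frac\nu2+1)}\Big[L^{(\nu)}_{2k+1}(\tfrac z\tau)L^{(\nu)}_{2l}(\tfrac u\tau)-L^{(\nu)}_{2l}(\tfrac z\tau)L^{(\nu)}_{2k+1}(\tfrac u\tau)\Big].$$ For a function $f$ of two complex variables put $$\mathbf B[f](z,u)=\begin{pmatrix} f(z,u)& f(z,\bar u)\\ f(\bar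 z,u)& f(\bar z,\bar u)\end{pmatrix},\qquad \mathcal K_{\tau,N}(z,u)=\sqrt{w_\tau(z)w_\tau(u)}\;\mathbf B[\sigma_{\tau,N}](z,u).$$ Further let $$\mathcal G_s(z,u)=\frac1\pi\sqrt{K_\nu(2|z|)K_\nu(2|u|)}\int_0^{\pi/2}\sinh\big((z-u)\cos\alpha\big)\,I_\nu\big(2s\sin\alpha\big)\,d\alpha ,$$ where $s$ is a square root of $zu$; all roots and powers are principal. The limiting symplectic chiral Ginibre kernel is $K^{\mathrm{ch}}(z,u)=\mathcal G_{\sqrt z\sqrt u}(z,u)$; let also $$\Lambda(z,u)=\frac{|zu|^{\nu/2}}{(zu)^{\nu/2}}\;\mathcal G_{\sqrt{zu}}(z,u).$$ 1. (Matrix elements.) For all $z,u\in\mathbb C\setminus\{0\}$, $$\lim_{N\to\infty}\frac{(1-\tau^2)^3}{\pi\Gamma(\nu+2)(1-\tau^2)^2}\,\mathcal K_{\tau,N}\big((1-\tau^2)z,(1-\tau^2)u\big)=\mathbf B\Big[(a,b)\mapsto e^{-i\tau\,\mathrm{Im}(a+b)}\Lambda(a,b)\Big](z,u).$$ 2. (Equivalence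 up to cocycles.) For $z,u\neq0$, $$e^{-i\tau\,\mathrm{Im}(z+u)}\Lambda(z,u)=h(z)h(u)\,p(z)p(u)\,K^{\mathrm{ch}}(z,u),\qquad h(z)=e^{-i\tau\,\mathrm{Im}z},\quad p(z)=e^{-i\nu\arg(z)/2}.$$ Here $h$ is continuous and unimodular on $\mathbb C$ with $h(\bar z)=1/h(z)$, and $p$ has the same properties on $\mathbb C\setminus(-\infty,0]$ (with $\arg$ the principal argument). 3. (Universality of the correlations.) Let $R^{(\tau)}_{N,k}$ be the $k$-point correlation functions, with respect to Lebesgue measure $d^2z$, of the $N$-point process with joint density $$\frac1{Z_N}\prod_{k>l}|z_k-z_l|^2|z_k-\bar z_l|^2\prod_j|z_j-\bar z_j|^2\prod_i w_\tau(z_i),$$ that is, $\frac{N!}{(N-k)!}$ times the integral of this density over $z_{k+1},\dots,z_N\in\mathbb C$. Then for every $k$ and all $z_1,\dots,z_k\in\mathbb C\setminus\{0\}$, $$\lim_{N\to\infty}(1-\tau^2)^{2k}R^{(\tau)}_{N,k}\big((1-\tau^2)z_1,\dots,(1-\tau^2)z_k\big)=\operatorname*{Pf}_{1\le i,j\le k}\Big[\mathbf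 B[K^{\mathrm{ch}}](z_i,z_j)\Big]\prod_{i=1}^k(\bar z_i-z_i),$$ which does not depend on $\tau$. -/

import Mathlib

open Filter Topology MeasureTheory
open scoped Nat ComplexConjugate

noncomputable section

namespace ChiralGinibre

/-- Generalised Laguerre polynomial `L_n^{(ν)}(x) = ∑ᵢ (-1)^i binom(n+ν, n-i) x^i / i!`. -/
def laguerre (ν : ℝ) (n : ℕ) (x : ℂ) : ℂ :=
  ∑ i ∈ Finset.range (n + 1),
    (-1) ^ i *
      ((Real.Gamma (n + ν + 1) / ((n - i)! * Real.Gamma (i + ν + 1)) / i ! : ℝ) : ℂ) * x ^ i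

/-- Modified Bessel function of the first kind, with the principal branch of `(z/2)^ν`. -/
def besselI (ν : ℝ) (z : ℂ) : ℂ :=
  (z / 2) ^ (ν : ℂ) *
    ∑' n : ℕ, (z / 2) ^ (2 * n) / ((n ! : ℂ) * ((Real.Gamma (n + ν + 1) : ℝ) : ℂ))

/-- Modified Bessel function of the second kind on the positive half-line:
`K_ν(x) = ∫₀^∞ exp(-x cosh t) cosh(ν t) dt` for `x > 0`. -/
def besselK (ν x : ℝ) : ℝ :=
  ∫ t in Set.Ioi (0 : ℝ), Real.exp (-x * Real.cosh t) * Real.cosh (ν * t)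

/-- The chiral elliptic weight
`w(z) = |z|^ν K_ν(2|z|/(1-τ²)) exp(2 τ Re z/(1-τ²))`, for `z ≠ 0`. -/
def weight (ν τ : ℝ) (z : ℂ) : ℝ :=
  ‖z‖ ^ ν * besselK ν (2 / (1 - τ ^ 2) * ‖z‖) * Real.exp (2 * τ / (1 - τ ^ 2) * z.re)

/-! ### The point process -/

/-- The unnormalised joint density of `n` points with respect to Lebesgue measure on `ℂⁿ`. -/
def jointWeight (ν τ : ℝ) {n : ℕ} (z : Fin n → ℂ) : ℝ :=
  (∏ k, ∏ l ∈ Finset.Iio k, ‖z k - z l‖ ^ 2 * ‖z k - conj (z l)‖ ^ 2) *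
    (∏ j, ‖z j - conj (z j)‖ ^ 2) * ∏ i, weight ν τ (z i)

/-- The partition function `Z_N`. -/
def partitionFunction (ν τ : ℝ) (N : ℕ) : ℝ :=
  ∫ z : Fin N → ℂ, jointWeight ν τ z

/-- The `k`-point correlation function of the `N`-point process (its density with respect to
Lebesgue measure on `ℂᵏ`), for `k ≤ N`:
`N!/(N-k)! · Z_N⁻¹ ∫ jointWeight(z₁,…,z_N) d²z_{k+1} ⋯ d²z_N`. -/
def corr (ν τ : ℝ) (N k : ℕ) (z : Fin k → ℂ) : ℝ :=
  (N.descFactorial k : ℝ) *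
    ((partitionFunction ν τ N)⁻¹ *
      ∫ y : Fin (N - k) → ℂ, jointWeight ν τ (Fin.append z y))

/-! ### Matrix kernels and Pfaffians -/

/-- The `2 × 2` matrix with entries `f(z,u)`, `f(z,ū)`, `f(z̄,u)`, `f(z̄,ū)`. -/
def block (f : ℂ → ℂ → ℂ) (z u : ℂ) : Matrix (Fin 2) (Fin 2) ℂ :=
  !![f z u, f z (conj u); f (conj z) u, f (conj z) (conj u)]

/-- The Pfaffian of a skew-symmetric `2k × 2k` matrix made of `k × k` blocks of size `2 × 2`
(index order `(0,0), (0,1), (1,0), (1,1), …`):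
`(2^k k!)⁻¹ ∑_σ sgn(σ) ∏ᵢ A_{σ(i,0), σ(i,1)}`. -/
def pfaffian {k : ℕ} (A : Matrix (Fin k × Fin 2) (Fin k × Fin 2) ℂ) : ℂ :=
  ((2 : ℂ) ^ k * (k ! : ℂ))⁻¹ *
    ∑ σ : Equiv.Perm (Fin k × Fin 2),
      ((Equiv.Perm.sign σ : ℤ) : ℂ) * ∏ i : Fin k, A (σ (i, 0)) (σ (i, 1))

/-- The `2k × 2k` matrix whose `(i,j)` block is `K(zᵢ, zⱼ)`. -/
def blockMatrix {k : ℕ} (K : ℂ → ℂ → Matrix (Fin 2) (Fin 2) ℂ) (z : Fin k → ℂ) :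
    Matrix (Fin k × Fin 2) (Fin k × Fin 2) ℂ :=
  fun p q => K (z p.1) (z q.1) p.2 q.2

/-- The pre-kernel of the skew-orthogonal Laguerre polynomials.
For `l = 0` truncated subtraction gives `(2 l - 1)‼ = 0‼ = 1`, which is `(-1)!! = 1`. -/
def preKernel (ν τ : ℝ) (N : ℕ) (z u : ℂ) : ℂ :=
  -∑ k ∈ Finset.range N,
    ((√Real.pi * Real.Gamma (ν + 2) * ((2 * k)‼ : ℕ) * τ ^ (2 * k + 1) /
        ((2 : ℝ) ^ ((k : ℝ) + ν + 1) * Real.Gamma (k + ν / 2 + 3 / 2)) : ℝ) : ℂ) *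
      ∑ l ∈ Finset.range (k + 1),
        ((((2 * l - 1)‼ : ℕ) * τ ^ (2 * l) / ((2 : ℝ) ^ l * Real.Gamma (l + ν / 2 + 1)) : ℝ) : ℂ) *
          (laguerre ν (2 * k + 1) (z / τ) * laguerre ν (2 * l) (u / τ) -
            laguerre ν (2 * l) (z / τ) * laguerre ν (2 * k + 1) (u / τ))

/-- The matrix kernel `√(w(z) w(u)) · (σ_N(z,u), σ_N(z,ū); σ_N(z̄,u), σ_N(z̄,ū))`. -/
def kernel (ν τ : ℝ) (N : ℕ) (z u : ℂ) : Matrix (Fin 2) (Fin 2) ℂ :=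
  ((√(weight ν τ z * weight ν τ u) : ℝ) : ℂ) • block (preKernel ν τ N) z u

/-- The integral expression
`π⁻¹ √(K_ν(2|z|) K_ν(2|u|)) ∫₀^{π/2} sinh((z-u) cos α) I_ν(2 s sin α) dα`,
where `s` is a chosen square root of `z u`. -/
def ginibreIntegral (ν : ℝ) (s z u : ℂ) : ℂ :=
  ((1 / Real.pi * √(besselK ν (2 * ‖z‖) * besselK ν (2 * ‖u‖)) : ℝ) : ℂ) *
    ∫ α in (0 : ℝ)..(Real.pi / 2),
      Complex.sinh ((z - u) * ((Real.cos α : ℝ) : ℂ)) *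
        besselI ν (2 * s * ((Real.sin α : ℝ) : ℂ))

/-- Principal square root. -/
def csqrt (z : ℂ) : ℂ := z ^ (1 / 2 : ℂ)

/-- The limiting symplectic chiral Ginibre kernel including its phase `(|zu|/(zu))^{ν/2}`
(the product of phase and integral does not depend on the branch of `√(zu)`, as long as the
two occurrences agree; both are principal here). -/
def ginibreLimit (ν : ℝ) (z u : ℂ) : ℂ :=
  ((‖z * u‖ ^ (ν / 2) : ℝ) : ℂ) / (z * u) ^ ((ν / 2 : ℝ) : ℂ) *
    ginibreIntegral ν (csqrt (z * u)) z u

/-- The limiting symplectic chiral Ginibre kernel without phase, with `√(zu) = √z √u`. -/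
def ginibreKernel (ν : ℝ) (z u : ℂ) : ℂ :=
  ginibreIntegral ν (csqrt z * csqrt u) z u

/-- `g` is continuous and unimodular on `s` with `g(z̄) = 1/g(z)`; multiplying a pre-kernel by
`g(z) g(u)` then changes no Pfaffian of its block matrices at points of `s`. -/
def IsCocycleOn (s : Set ℂ) (g : ℂ → ℂ) : Prop :=
  ContinuousOn g s ∧ (∀ z ∈ s, ‖g z‖ = 1) ∧ ∀ z ∈ s, g (conj z) = (g z)⁻¹

/-- `exp(-i τ Im z)`. -/
def tauCocycle (τ : ℝ) (z : ℂ) : ℂ := Complex.exp (-Complex.I * τ * z.im)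

/-- `|z|^{ν/2} / z^{ν/2} = exp(-i ν arg(z)/2)`. -/
def phaseCocycle (ν : ℝ) (z : ℂ) : ℂ := Complex.exp (-Complex.I * (ν / 2) * z.arg)

end ChiralGinibre

end

/-! Write P_n(z) = τ^n L_n^{(ν)}(z/τ), c_n = `gammaRatio ν n`, h_n = `hilleCoeff ν n` and V_k =
Σ_{l≤k} c_{2l} P_{2l}. Up to a constant the pre-kernel is a partial sum of Σ c_{2k+1} (P_{2k+1}(z)
V_k(u) − V_k(z) P_{2k+1}(u)). The proof has an analytic half, the limit of this sum, and an
algebraic half, the Pfaffian formula for the correlations.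

Analytic half. The second order operator T = `lagT` acts as a ladder, T P_n = (n+1) P_{n+1} − (n+ν)
P_{n−1}, and telescopes on V_k. Hence it maps the skew sum to −2^{ν+1} times the Hardy–Hille sum Σ
h_m P_m(z) P_m(u), up to a boundary term (`lagT_skewPoly`); a companion operator annihilates the
Hardy–Hille sum up to boundary terms (`hilleOp_hillePoly`). Since P_n decays geometrically on
compact sets (`exists_norm_eval_lag_le`), the boundary terms disappear and both identities become
differential equations for entire functions. After rescaling by 1 − τ² and multiplication by
exponentials e^{τζ}, the Hardy–Hille sum becomes a multiple of E(x) = Σ x^n/(n! Γ(n+ν+1)) at x = ζη,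
and the skew sum solves z f'' + (ν+1) f' − z f = K E(zu). The sinh–Bessel integral solves the same
equation up to the constant K, because under the operator its integrand becomes an exact derivative
(`hasDerivAt_skewPrimitive`). For ν > −1 an entire solution is determined by its value at 0
(`eq_zero_of_ode`), and antisymmetry provides that value (`skewSum_eq`).

Algebraic half. The weight is a mixture of Gaussians with real centres (`weight_eq_integral`), so
the form ∫ p(z) q(z̄) w is explicit and the P_n are orthogonal for it. The three-term recurrence
then makes V_k and P_{2k+1} skew-orthogonal for the density (z̄ − z) w, and after normalisation all
pairs have the same skew norm. The joint density is a constant times the determinant of these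
polynomials at all z_i, z̄_i, times ∏ (z̄_i − z_i) w(z_i); integrating out variables leaves a
Pfaffian of the pre-kernel (`corr_eq_pfaffian`).

A Pfaffian of fixed size is a polynomial in its entries, so the limit passes through it. The
cocycles multiply to 1 over each pair z, z̄; on the negative axis, where this fails for the phase,
the factor z̄ − z vanishes. -/

namespace ChiralGinibre

/-! ### Laguerre polynomials -/

/-- The coefficient of `z ^ i` in `τ ^ n L_n^{(α)}(z / τ)`. -/
noncomputable def lagCoeff (α τ : ℝ) (n i : ℕ) : ℝ :=
  if i ≤ n then
    (-1) ^ i * (Real.Gamma (n + α + 1) / ((n - i)! * Real.Gamma (i + α + 1)) / i !) * τ ^ (n - i)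
  else 0

/-- The polynomial `τ ^ n L_n^{(α)}(z / τ)`. -/
noncomputable def lag (α τ : ℝ) (n : ℕ) : Polynomial ℂ :=
  ∑ i ∈ Finset.range (n + 1), Polynomial.monomial i ((lagCoeff α τ n i : ℝ) : ℂ)

/-- The operator `z ∂² + (α + 1) ∂` on polynomials. -/
noncomputable def lagD (α : ℝ) (p : Polynomial ℂ) : Polynomial ℂ :=
  Polynomial.X * Polynomial.derivative (Polynomial.derivative p) +
    Polynomial.C ((α + 1 : ℝ) : ℂ) * Polynomial.derivative p

/-! ### Recurrences for the coefficients of the rescaled Laguerre polynomials. -/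

section coefficients

variable {α : ℝ} (τ : ℝ)

theorem gamma_nat_pos (hα : -1 < α) (n : ℕ) : 0 < Real.Gamma (n + α + 1) :=
  Real.Gamma_pos_of_pos (by have : (0 : ℝ) ≤ n := n.cast_nonneg; linarith)

theorem gamma_nat_succ (hα : -1 < α) (n : ℕ) :
    Real.Gamma ((n + 1 : ℕ) + α + 1) = (n + α + 1) * Real.Gamma (n + α + 1) := by
  have h : (n : ℝ) + α + 1 ≠ 0 := by
    have : (0 : ℝ) ≤ n := n.cast_nonneg
    linarith
  rw [← Real.Gamma_add_one h]
  congr 1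
  push_cast
  ring

theorem lagCoeff_of_gt {n i : ℕ} (h : n < i) : lagCoeff α τ n i = 0 := by
  rw [lagCoeff, if_neg (by omega)]

theorem lagCoeff_add (i d : ℕ) :
    lagCoeff α τ (i + d) i = (-1) ^ i *
      (Real.Gamma ((i + d : ℕ) + α + 1) / (d ! * Real.Gamma (i + α + 1)) / i !) * τ ^ d := by
  rw [lagCoeff, if_pos (by omega), Nat.add_sub_cancel_left]

/-- The coefficient form of the lowering relation for `lagD`; the scaling by τ ^ n keeps it free of
τ. Together with `lagCoeff_scale` it yields the Laguerre equation and the raising relation without a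
return to Gamma functions. -/
theorem lagCoeff_lower (hα : -1 < α) (n i : ℕ) :
    (i + 1) * (i + 1 + α) * lagCoeff α τ (n + 1) (i + 1) = -((n + 1 + α) * lagCoeff α τ n i) := by
  rcases le_or_gt i n with h | h
  · obtain ⟨d, rfl⟩ := Nat.exists_eq_add_of_le h
    rw [show i + d + 1 = (i + 1) + d by ring, lagCoeff_add, lagCoeff_add,
      show i + 1 + d = (i + d) + 1 by ring, gamma_nat_succ hα, gamma_nat_succ hα]
    have h1 := (gamma_nat_pos hα i).ne'
    have h2 : (i : ℝ) + α + 1 ≠ 0 := by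
      have : (0 : ℝ) ≤ i := i.cast_nonneg
      linarith
    have h3 : ((i ! : ℕ) : ℝ) ≠ 0 := by positivity
    rw [Nat.factorial_succ]
    push_cast
    field_simp
    ring
  · rw [lagCoeff_of_gt τ h, lagCoeff_of_gt τ (by omega : n + 1 < i + 1)]
    ring

theorem lagCoeff_scale (hα : -1 < α) (n i : ℕ) :
    (n + 1 - i) * lagCoeff α τ (n + 1) i = (n + 1 + α) * τ * lagCoeff α τ n i := by
  rcases le_or_gt i n with h | h
  · obtain ⟨d, rfl⟩ := Nat.exists_eq_add_of_le h
    rw [show i + d + 1 = i + (d + 1) by ring, lagCoeff_add, lagCoeff_add, ← add_assoc i d 1,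
      gamma_nat_succ hα]
    have h1 := (gamma_nat_pos hα i).ne'
    have h3 : ((i ! : ℕ) : ℝ) ≠ 0 := by positivity
    have h4 : ((d ! : ℕ) : ℝ) ≠ 0 := by positivity
    rw [Nat.factorial_succ]
    push_cast
    field_simp
    ring
  · rw [lagCoeff_of_gt τ h]
    rcases Nat.lt_or_ge (n + 1) i with h' | h'
    · rw [lagCoeff_of_gt τ h']; ring
    · obtain rfl : i = n + 1 := by omega
      push_cast; ring

theorem lagCoeff_deriv (n i : ℕ) :
    (i + 1) * lagCoeff α τ (n + 1) (i + 1) = -lagCoeff (α + 1) τ n i := by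
  rcases le_or_gt i n with h | h
  · obtain ⟨d, rfl⟩ := Nat.exists_eq_add_of_le h
    rw [show i + d + 1 = (i + 1) + d by ring, lagCoeff_add, lagCoeff_add, Nat.factorial_succ]
    have h3 : ((i ! : ℕ) : ℝ) ≠ 0 := by positivity
    have e1 : ((i + 1 + d : ℕ) : ℝ) + α + 1 = (i + d : ℕ) + (α + 1) + 1 := by push_cast; ring
    have e2 : ((i + 1 : ℕ) : ℝ) + α + 1 = i + (α + 1) + 1 := by push_cast; ring
    rw [e1, e2]
    push_cast
    field_simp
    ring
  · rw [lagCoeff_of_gt τ h, lagCoeff_of_gt τ (by omega : n + 1 < i + 1)]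
    ring

theorem lagCoeff_ode (hα : -1 < α) (n i : ℕ) :
    (n - i) * lagCoeff α τ n i = -(τ * ((i + 1) * (i + 1 + α) * lagCoeff α τ n (i + 1))) := by
  cases n with
  | zero =>
    rw [lagCoeff_of_gt τ (by omega : 0 < i + 1)]
    cases i with
    | zero => simp
    | succ i => rw [lagCoeff_of_gt τ (by omega : 0 < i + 1)]; ring
  | succ n =>
    have h1 := lagCoeff_lower τ hα n i
    have h2 := lagCoeff_scale τ hα n i
    push_cast
    rw [h1]
    linarith

theorem lagCoeff_raise (hα : -1 < α) (n i : ℕ) :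
    (n + 1) * lagCoeff α τ (n + 1) (i + 1) =
      τ * (n + 1 + α + (i + 1)) * lagCoeff α τ n (i + 1) - lagCoeff α τ n i := by
  have hn : (n : ℝ) + 1 + α ≠ 0 := by
    have : (0 : ℝ) ≤ n := n.cast_nonneg
    linarith
  have h1 := lagCoeff_lower τ hα n i
  have h2 := lagCoeff_scale τ hα n (i + 1)
  push_cast at h2
  apply mul_left_cancel₀ hn
  linear_combination (n + 1 + α + (i + 1)) * h2 + h1

theorem lagCoeff_raise_zero (hα : -1 < α) (n : ℕ) :
    (n + 1) * lagCoeff α τ (n + 1) 0 = τ * (n + 1 + α) * lagCoeff α τ n 0 := by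
  have h2 := lagCoeff_scale τ hα n 0
  push_cast at h2
  linear_combination h2

end coefficients

/-! ### Operator identities between the rescaled Laguerre polynomials. -/

section polynomials

variable {α : ℝ} (τ : ℝ)

open Polynomial

theorem coeff_lag (n i : ℕ) : (lag α τ n).coeff i = ((lagCoeff α τ n i : ℝ) : ℂ) := by
  simp only [lag, finsetSum_coeff, coeff_monomial]
  rw [Finset.sum_ite_eq' (Finset.range (n + 1)) i]
  split_ifs with h
  · rfl
  · rw [lagCoeff_of_gt τ (by simpa using h)]; simp

theorem coeff_lagD (p : ℂ[X]) (i : ℕ) :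
    (lagD α p).coeff i = ((i + 1) * (i + 1 + α) : ℝ) * p.coeff (i + 1) := by
  rw [lagD, coeff_add, coeff_C_mul, coeff_derivative]
  cases i with
  | zero => simp [mul_comm, add_comm]
  | succ i =>
    rw [coeff_X_mul, coeff_derivative, coeff_derivative]
    push_cast
    ring

theorem lagD_lag_succ (hα : -1 < α) (n : ℕ) :
    lagD α (lag α τ (n + 1)) = -(C ((n + 1 + α : ℝ) : ℂ) * lag α τ n) := by
  ext i
  rw [coeff_lagD, coeff_neg, coeff_C_mul, coeff_lag, coeff_lag]
  exact_mod_cast lagCoeff_lower τ hα n i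

theorem lag_zero (hα : -1 < α) : lag α τ 0 = 1 := by
  ext i
  rw [coeff_lag, coeff_one]
  cases i with
  | zero =>
    have h := (gamma_nat_pos hα 0).ne'
    have : lagCoeff α τ 0 0 = 1 := by
      simp only [lagCoeff]
      simpa using div_self (by simpa using h)
    simp [this]
  | succ i => rw [lagCoeff_of_gt τ (by omega : 0 < i + 1)]; simp

theorem lagD_lag_zero (hα : -1 < α) : lagD α (lag α τ 0) = 0 := by
  simp [lag_zero τ hα, lagD]

theorem lag_ode (hα : -1 < α) (n : ℕ) :
    C (n : ℂ) * lag α τ n = X * derivative (lag α τ n) - C (τ : ℂ) * lagD α (lag α τ n) := by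
  ext i
  rw [coeff_sub, coeff_C_mul, coeff_C_mul, coeff_lagD]
  have h := lagCoeff_ode τ hα n i
  have h' : ((n : ℂ) - i) * lagCoeff α τ n i =
      -(τ * (((i + 1) * (i + 1 + α) : ℝ) * lagCoeff α τ n (i + 1))) := by exact_mod_cast h
  cases i with
  | zero =>
    simp only [coeff_lag, coeff_X_mul_zero]
    push_cast at h' ⊢
    linear_combination h'
  | succ i =>
    simp only [coeff_lag, coeff_X_mul, coeff_derivative]
    push_cast at h' ⊢
    linear_combination h'

theorem lag_raise (hα : -1 < α) (n : ℕ) :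
    C ((n : ℂ) + 1) * lag α τ (n + 1) = C ((τ : ℂ) * (n + 1 + α)) * lag α τ n +
      C (τ : ℂ) * (X * derivative (lag α τ n)) - X * lag α τ n := by
  ext i
  cases i with
  | zero =>
    have h : ((n : ℂ) + 1) * lagCoeff α τ (n + 1) 0 = τ * (n + 1 + α) * lagCoeff α τ n 0 := by
      exact_mod_cast lagCoeff_raise_zero τ hα n
    simp only [coeff_sub, coeff_add, coeff_C_mul, coeff_lag, coeff_X_mul_zero]
    linear_combination h
  | succ i =>
    have h : ((n : ℂ) + 1) * lagCoeff α τ (n + 1) (i + 1) =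
      τ * (n + 1 + α + (i + 1)) * lagCoeff α τ n (i + 1) - lagCoeff α τ n i := by
      exact_mod_cast lagCoeff_raise τ hα n i
    simp only [coeff_sub, coeff_add, coeff_C_mul, coeff_lag, coeff_X_mul, coeff_derivative]
    linear_combination h

theorem derivative_lag_succ (n : ℕ) :
    derivative (lag α τ (n + 1)) = -lag (α + 1) τ n := by
  ext i
  rw [coeff_derivative, coeff_neg, coeff_lag, coeff_lag]
  have h : ((i : ℂ) + 1) * lagCoeff α τ (n + 1) (i + 1) = -lagCoeff (α + 1) τ n i := by
    exact_mod_cast lagCoeff_deriv τ n i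
  linear_combination h

theorem eval_lag_eq_sum (n : ℕ) (z : ℂ) :
    (lag α τ n).eval z = ∑ i ∈ Finset.range (n + 1), (lagCoeff α τ n i : ℂ) * z ^ i := by
  simp [lag, eval_finsetSum, eval_monomial]

theorem eval_lag {τ : ℝ} (hτ : τ ≠ 0) (n : ℕ) (z : ℂ) :
    (lag α τ n).eval z = τ ^ n * laguerre α n (z / τ) := by
  rw [eval_lag_eq_sum, laguerre, Finset.mul_sum]
  refine Finset.sum_congr rfl fun i hi => ?_
  obtain ⟨d, rfl⟩ := Nat.exists_eq_add_of_le (Nat.lt_succ_iff.1 (Finset.mem_range.1 hi))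
  have hτ' : (τ : ℂ) ≠ 0 := by exact_mod_cast hτ
  rw [lagCoeff_add, Nat.add_sub_cancel_left]
  push_cast
  rw [div_pow, pow_add]
  field_simp

theorem eval_lag_smul {τ : ℝ} (n : ℕ) (s : ℂ) :
    (lag α τ n).eval (τ * s) = τ ^ n * (lag α 1 n).eval s := by
  rw [eval_lag_eq_sum, eval_lag_eq_sum, Finset.mul_sum]
  refine Finset.sum_congr rfl fun i hi => ?_
  obtain ⟨d, rfl⟩ := Nat.exists_eq_add_of_le (Nat.lt_succ_iff.1 (Finset.mem_range.1 hi))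
  rw [lagCoeff_add, lagCoeff_add]
  push_cast
  rw [mul_pow, pow_add]
  ring

theorem eval_zero_lag (n : ℕ) : (lag α τ n).eval 0 =
    ((Real.Gamma (n + α + 1) / (n ! * Real.Gamma (α + 1)) * τ ^ n : ℝ) : ℂ) := by
  rw [← coeff_zero_eq_eval_zero, coeff_lag]
  simp [lagCoeff]

theorem natDegree_lag_le (n : ℕ) : (lag α τ n).natDegree ≤ n := by
  rw [natDegree_le_iff_coeff_eq_zero]
  intro i hi
  rw [coeff_lag, lagCoeff_of_gt τ hi]; simp

theorem coeff_lag_self (hα : -1 < α) (n : ℕ) : (lag α τ n).coeff n = (-1) ^ n / n ! := by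
  rw [coeff_lag]
  have h := (gamma_nat_pos hα n).ne'
  have : lagCoeff α τ n n = (-1) ^ n / n ! := by
    simp only [lagCoeff, le_refl, if_true, Nat.sub_self]
    field_simp
    simp
  rw [this]; push_cast; rfl

end polynomials

/-! ### Bounds -/

/-- Raising d by one multiplies the left side by (i+d+α+1)/(d+1) and the binomial by
(i+d+p+1)/(d+1). An integer p ≥ α thus replaces a generalised binomial by an ordinary one, to which
the binomial theorem applies. -/
theorem gamma_div_le_choose {α : ℝ} (hα : -1 < α) {p : ℕ} (hp : α ≤ p) (i d : ℕ) :
    Real.Gamma ((i + d : ℕ) + α + 1) / (d ! * Real.Gamma (i + α + 1)) ≤ (i + d + p).choose d := by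
  induction d with
  | zero => simp [div_self (gamma_nat_pos hα i).ne']
  | succ d ih =>
    have h1 := gamma_nat_pos hα i
    rw [← add_assoc i d 1, gamma_nat_succ hα, Nat.factorial_succ]
    have hd : (0 : ℝ) < d + 1 := by positivity
    have hpos : 0 ≤ ((i + d : ℕ) : ℝ) + α + 1 := by
      have : (0 : ℝ) ≤ (i + d : ℕ) := Nat.cast_nonneg _
      linarith
    have key : (((i + d + 1 + p).choose (d + 1) : ℕ) : ℝ) * (d + 1) =
        (i + d + 1 + p) * ((i + d + p).choose d : ℕ) := by
      have := Nat.add_one_mul_choose_eq (i + d + p) d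
      rw [show i + d + 1 + p = i + d + p + 1 by ring, ← Nat.cast_succ, ← Nat.cast_mul, ← this]
      push_cast; ring
    have e : ((i + d : ℕ) + α + 1) * Real.Gamma ((i + d : ℕ) + α + 1) /
        (((d + 1) * d ! : ℕ) * Real.Gamma (i + α + 1)) = ((i + d : ℕ) + α + 1) / (d + 1) *
        (Real.Gamma ((i + d : ℕ) + α + 1) / (d ! * Real.Gamma (i + α + 1))) := by
      push_cast
      field_simp
    rw [e]
    calc _ ≤ ((i + d : ℕ) + α + 1) / (d + 1) * ((i + d + p).choose d : ℕ) := by gcongr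
      _ ≤ (i + d + 1 + p) / (d + 1) * ((i + d + p).choose d : ℕ) := by
        gcongr ?_ / _ * _
        push_cast; linarith
      _ = _ := by rw [div_mul_eq_mul_div, ← key, mul_div_cancel_right₀ _ hd.ne']

/-- By R^i/i! ≤ e^{R/ε} ε^i the coefficient bounds become terms of the expansion of (τ+ε)^{n+p}, and
ε = (1−τ)/2 makes the base (1+τ)/2 < 1. This decay drives the convergence of both series and of
their boundary terms. -/
theorem exists_norm_eval_lag_le {α τ : ℝ} (hα : -1 < α) (hτ0 : 0 ≤ τ) (hτ1 : τ < 1) {R : ℝ}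
    (hR : 0 ≤ R) :
    ∃ C : ℝ, 0 ≤ C ∧ ∀ n : ℕ, ∀ z : ℂ, ‖z‖ ≤ R →
      ‖(lag α τ n).eval z‖ ≤ C * ((1 + τ) / 2) ^ n := by
  obtain ⟨p, hp⟩ := exists_nat_ge α
  set ε : ℝ := (1 - τ) / 2 with hε
  have hε0 : 0 < ε := by rw [hε]; linarith
  refine ⟨Real.exp (R / ε) / ε ^ p * ((1 + τ) / 2) ^ p, by positivity, fun n z hz => ?_⟩
  have hterm : ∀ i ∈ Finset.range (n + 1), ‖((lagCoeff α τ n i : ℝ) : ℂ) * z ^ i‖ ≤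
      Real.exp (R / ε) / ε ^ p * (τ ^ (n - i) * ε ^ (n + p - (n - i)) *
        ((n + p).choose (n - i) : ℕ)) := by
    intro i hi
    obtain ⟨d, rfl⟩ := Nat.exists_eq_add_of_le (Nat.lt_succ_iff.1 (Finset.mem_range.1 hi))
    rw [lagCoeff_add, norm_mul, norm_pow, Complex.norm_real, Nat.add_sub_cancel_left,
      show i + d + p - d = i + p by omega, norm_mul, norm_mul, norm_pow, norm_neg, norm_one,
      one_pow, one_mul, Real.norm_of_nonneg (by positivity : 0 ≤ τ ^ d)]
    have hΓ := gamma_nat_pos hα i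
    have hΓ' := gamma_nat_pos hα (i + d)
    rw [Real.norm_of_nonneg (by positivity)]
    have h1 := gamma_div_le_choose hα hp i d
    have h2 : R ^ i / i ! ≤ Real.exp (R / ε) * ε ^ i := by
      have := Real.pow_div_factorial_le_exp (R / ε) (by positivity) i
      rw [div_pow, div_div, div_le_iff₀ (by positivity)] at this
      rw [div_le_iff₀ (by positivity)]
      linarith
    calc _ ≤ ((i + d + p).choose d : ℕ) / (i ! : ℝ) * τ ^ d * R ^ i := by gcongr
      _ = ((i + d + p).choose d : ℕ) * τ ^ d * (R ^ i / i !) := by ring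
      _ ≤ ((i + d + p).choose d : ℕ) * τ ^ d * (Real.exp (R / ε) * ε ^ i) := by gcongr
      _ = _ := by rw [pow_add]; field_simp
  calc ‖(lag α τ n).eval z‖ ≤ ∑ i ∈ Finset.range (n + 1), Real.exp (R / ε) / ε ^ p *
          (τ ^ (n - i) * ε ^ (n + p - (n - i)) * ((n + p).choose (n - i) : ℕ)) := by
        rw [eval_lag_eq_sum]
        exact norm_sum_le_of_le _ hterm
    _ = Real.exp (R / ε) / ε ^ p * ∑ j ∈ Finset.range (n + 1),
          (τ ^ j * ε ^ (n + p - j) * ((n + p).choose j : ℕ)) := by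
        rw [← Finset.mul_sum]
        congr 1
        exact Finset.sum_range_reflect
          (fun j => τ ^ j * ε ^ (n + p - j) * (((n + p).choose j : ℕ) : ℝ)) (n + 1)
    _ ≤ Real.exp (R / ε) / ε ^ p * ∑ j ∈ Finset.range (n + p + 1),
          (τ ^ j * ε ^ (n + p - j) * ((n + p).choose j : ℕ)) := by
        refine mul_le_mul_of_nonneg_left ?_ (by positivity)
        refine Finset.sum_le_sum_of_subset_of_nonneg ?_ fun _ _ _ => by positivity
        intro j hj
        rw [Finset.mem_range] at hj ⊢
        omega
    _ = _ := by
        rw [← add_pow, show τ + ε = (1 + τ) / 2 by rw [hε]; ring, pow_add]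
        ring

/-! ### The coefficients -/

/-- `Γ((n + 1) / 2) / Γ((n + ν) / 2 + 1)`. -/
noncomputable def gammaRatio (ν : ℝ) (n : ℕ) : ℝ :=
  Real.Gamma ((n + 1) / 2) / Real.Gamma ((n + ν) / 2 + 1)

/-- `n! / Γ(n + ν + 1)`. -/
noncomputable def hilleCoeff (ν : ℝ) (n : ℕ) : ℝ := n ! / Real.Gamma (n + ν + 1)

section gammaRatio

variable {ν : ℝ}

theorem gammaRatio_pos (hν : -1 < ν) (n : ℕ) : 0 < gammaRatio ν n := by
  have : (0 : ℝ) ≤ n := n.cast_nonneg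
  exact div_pos (Real.Gamma_pos_of_pos (by linarith)) (Real.Gamma_pos_of_pos (by linarith))

theorem gammaRatio_add_two (hν : -1 < ν) (n : ℕ) :
    (n + 2 + ν) * gammaRatio ν (n + 2) = (n + 1) * gammaRatio ν n := by
  have hn : (0 : ℝ) ≤ n := n.cast_nonneg
  have h1 : Real.Gamma (((n + 2 : ℕ) + 1 : ℝ) / 2) = (n + 1) / 2 * Real.Gamma ((n + 1) / 2) := by
    rw [← Real.Gamma_add_one (by linarith)]
    congr 1; push_cast; ring
  have h2 : Real.Gamma (((n + 2 : ℕ) + ν : ℝ) / 2 + 1) =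
      ((n + ν) / 2 + 1) * Real.Gamma ((n + ν) / 2 + 1) := by
    rw [← Real.Gamma_add_one (by linarith)]
    congr 1; push_cast; ring
  have h3 : Real.Gamma ((n + ν) / 2 + 1) ≠ 0 := (Real.Gamma_pos_of_pos (by linarith)).ne'
  have h4 : (n + ν) / 2 + 1 ≠ 0 := by linarith
  rw [gammaRatio, gammaRatio, h1, h2]
  generalize Real.Gamma ((n + ν) / 2 + 1) = x at h3 ⊢
  have h5 : (n + 2 + ν) * ((n + 1) / 2 / ((n + ν) / 2 + 1)) = (n + 1 : ℝ) := by
    rw [← mul_div_assoc, div_eq_iff h4]; ring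
  rw [mul_div_mul_comm, ← mul_assoc, h5]

theorem hilleCoeff_pos (hν : -1 < ν) (n : ℕ) : 0 < hilleCoeff ν n :=
  div_pos (by positivity) (gamma_nat_pos hν n)

theorem hilleCoeff_succ (hν : -1 < ν) (n : ℕ) :
    (n + 1 + ν) * hilleCoeff ν (n + 1) = (n + 1) * hilleCoeff ν n := by
  have hn : (0 : ℝ) ≤ n := n.cast_nonneg
  have h1 := (gamma_nat_pos hν n).ne'
  have h2 : (n : ℝ) + ν + 1 ≠ 0 := by linarith
  rw [hilleCoeff, hilleCoeff, gamma_nat_succ hν, Nat.factorial_succ]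
  push_cast
  field_simp
  ring

/-- Legendre's duplication formula in numerator and denominator. It ties the constants of the skew
kernel to those of the Hardy–Hille series, and later makes the skew norms independent of the degree.
-/
theorem gammaRatio_mul_succ (hν : -1 < ν) (n : ℕ) :
    (n + 1 + ν) * (gammaRatio ν n * gammaRatio ν (n + 1)) =
      (2 : ℝ) ^ (ν + 1) * hilleCoeff ν n := by
  have hn : (0 : ℝ) ≤ n := n.cast_nonneg
  have h1 := Real.Gamma_mul_Gamma_add_half ((n + 1) / 2 : ℝ)
  have h2 := Real.Gamma_mul_Gamma_add_half ((n + ν) / 2 + 1)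
  rw [show 2 * (((n : ℝ) + 1) / 2) = n + 1 by ring, Real.Gamma_nat_eq_factorial] at h1
  rw [show 2 * (((n : ℝ) + ν) / 2 + 1) = (n + 1 : ℕ) + ν + 1 by push_cast; ring,
    gamma_nat_succ hν] at h2
  have h3 := (gamma_nat_pos hν n).ne'
  have h4 : (n : ℝ) + 1 + ν ≠ 0 := by linarith
  have h4' : (n : ℝ) + ν + 1 ≠ 0 := by linarith
  have e : gammaRatio ν n * gammaRatio ν (n + 1) =
      (Real.Gamma ((n + 1) / 2) * Real.Gamma ((n + 1) / 2 + 1 / 2)) /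
        (Real.Gamma ((n + ν) / 2 + 1) * Real.Gamma ((n + ν) / 2 + 1 + 1 / 2)) := by
    rw [gammaRatio, gammaRatio, div_mul_div_comm,
      show (((n + 1 : ℕ) : ℝ) + 1) / 2 = (n + 1) / 2 + 1 / 2 by push_cast; ring,
      show (((n + 1 : ℕ) : ℝ) + ν) / 2 + 1 = (n + ν) / 2 + 1 + 1 / 2 by push_cast; ring]
  have h5 : (2 : ℝ) ^ (1 - ((n : ℝ) + 1)) = (2 : ℝ) ^ (ν + 1) *
      (2 : ℝ) ^ (1 - (((n + 1 : ℕ) : ℝ) + ν + 1)) := by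
    rw [← Real.rpow_add two_pos]
    congr 1; push_cast; ring
  rw [e, h1, h2, h5, hilleCoeff]
  have h6 : √Real.pi ≠ 0 := by positivity
  have h7 : (2 : ℝ) ^ (1 - (((n + 1 : ℕ) : ℝ) + ν + 1)) ≠ 0 := by positivity
  field_simp
  ring

/-- For ν > −1 the recurrence `gammaRatio_add_two` makes steps of length two non-increasing, so the
first two values bound all others. -/
theorem exists_gammaRatio_le (hν : -1 < ν) : ∃ C : ℝ, ∀ n, gammaRatio ν n ≤ C := by
  refine ⟨max (gammaRatio ν 0) (gammaRatio ν 1), fun n => ?_⟩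
  induction n using Nat.twoStepInduction with
  | zero => exact le_max_left _ _
  | one => exact le_max_right _ _
  | more n ih _ =>
    refine le_trans ?_ ih
    have h := gammaRatio_add_two hν n
    have hn : (0 : ℝ) ≤ n := n.cast_nonneg
    have h1 := gammaRatio_pos hν n
    have h2 : (n + 2 + ν) * gammaRatio ν (n + 2) ≤ (n + 2 + ν) * gammaRatio ν n := by
      rw [h]; exact mul_le_mul_of_nonneg_right (by linarith) h1.le
    exact le_of_mul_le_mul_left h2 (by linarith)

end gammaRatio

/-- The even skew-orthogonal polynomials. -/
noncomputable def evenPoly (ν τ : ℝ) (k : ℕ) : Polynomial ℂ :=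
  ∑ l ∈ Finset.range (k + 1), Polynomial.C ((gammaRatio ν (2 * l) : ℝ) : ℂ) * lag ν τ (2 * l)

/-- The double factorials are Gamma values: (2k)!! = 2^k Γ(k+1) and (2l−1)!! = 2^l Γ(l+1/2)/√π. The
√π of the odd coefficient cancels that of the even one. -/
theorem preKernel_eq {ν τ : ℝ} (hτ : τ ≠ 0) (N : ℕ) (z u : ℂ) :
    preKernel ν τ N z u = -((Real.Gamma (ν + 2) / 2 ^ (ν + 1) : ℝ) : ℂ) *
      ∑ k ∈ Finset.range N, (gammaRatio ν (2 * k + 1) : ℂ) *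
        ((lag ν τ (2 * k + 1)).eval z * (evenPoly ν τ k).eval u -
          (evenPoly ν τ k).eval z * (lag ν τ (2 * k + 1)).eval u) := by
  rw [preKernel, neg_mul, Finset.mul_sum, neg_inj]
  refine Finset.sum_congr rfl fun k _ => ?_
  have hodd : √Real.pi * Real.Gamma (ν + 2) * ((2 * k)‼ : ℕ) * τ ^ (2 * k + 1) /
      ((2 : ℝ) ^ ((k : ℝ) + ν + 1) * Real.Gamma (k + ν / 2 + 3 / 2)) =
      Real.Gamma (ν + 2) / 2 ^ (ν + 1) * gammaRatio ν (2 * k + 1) * √Real.pi *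
        τ ^ (2 * k + 1) := by
    rw [Nat.doubleFactorial_two_mul, gammaRatio, add_assoc (k : ℝ), Real.rpow_add two_pos,
      Real.rpow_natCast, show (((2 * k + 1 : ℕ) : ℝ) + 1) / 2 = k + 1 by push_cast; ring,
      Real.Gamma_nat_eq_factorial,
      show ((2 * k + 1 : ℕ) + ν) / 2 + 1 = k + ν / 2 + 3 / 2 by push_cast; ring]
    push_cast
    field_simp
  have heven : ∀ l : ℕ, ((2 * l - 1)‼ : ℕ) * τ ^ (2 * l) /
      ((2 : ℝ) ^ l * Real.Gamma (l + ν / 2 + 1)) =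
      gammaRatio ν (2 * l) * τ ^ (2 * l) / √Real.pi := by
    intro l
    have h6 : √Real.pi ≠ 0 := by positivity
    rw [gammaRatio, show (((2 * l : ℕ) : ℝ) + 1) / 2 = l + 1 / 2 by push_cast; ring,
      Real.Gamma_nat_add_half, show ((2 * l : ℕ) + ν) / 2 + 1 = l + ν / 2 + 1 by push_cast; ring]
    field_simp
  have hπ : ((√Real.pi : ℝ) : ℂ) ≠ 0 := by
    have h6 : √Real.pi ≠ 0 := by positivity
    exact_mod_cast h6
  simp only [hodd, heven, evenPoly, Polynomial.eval_finsetSum, Polynomial.eval_mul,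
    Polynomial.eval_C, eval_lag hτ, Finset.mul_sum, Finset.sum_mul, ← Finset.sum_sub_distrib]
  refine Finset.sum_congr rfl fun l _ => ?_
  push_cast
  field_simp

/-! ### Christoffel–Darboux identities -/

section operators

open Polynomial

variable {ν τ : ℝ}

theorem lagD_add (p q : ℂ[X]) : lagD ν (p + q) = lagD ν p + lagD ν q := by
  simp only [lagD, derivative_add]; ring

theorem lagD_C_mul (c : ℂ) (p : ℂ[X]) : lagD ν (C c * p) = C c * lagD ν p := by
  simp only [lagD, derivative_C_mul]; ring

/-- The operator `(1 - τ²)(z ∂² + (ν + 1) ∂) + 2 τ z ∂ + τ (ν + 1) - z`. -/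
noncomputable def lagT (ν τ : ℝ) (p : ℂ[X]) : ℂ[X] :=
  C ((1 - τ ^ 2 : ℝ) : ℂ) * lagD ν p + C (2 * τ : ℂ) * (X * derivative p) +
    (C (τ * (ν + 1) : ℂ) - X) * p

theorem lagT_add (p q : ℂ[X]) : lagT ν τ (p + q) = lagT ν τ p + lagT ν τ q := by
  simp only [lagT, lagD_add, derivative_add]; ring

theorem lagT_C_mul (c : ℂ) (p : ℂ[X]) : lagT ν τ (C c * p) = C c * lagT ν τ p := by
  simp only [lagT, lagD_C_mul, derivative_C_mul]; ring

/-- T is the raising operator plus `lagD`, rewritten by the Laguerre equation so that the degree n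
no longer occurs in the operator. -/
theorem lagT_lag (hν : -1 < ν) (n : ℕ) :
    lagT ν τ (lag ν τ n) = C ((n : ℂ) + 1) * lag ν τ (n + 1) + lagD ν (lag ν τ n) := by
  rw [lag_raise τ hν, lagT]
  have h := lag_ode τ hν n
  simp only [map_mul, map_add, map_sub, map_pow, map_one, Complex.ofReal_sub, Complex.ofReal_one,
    Complex.ofReal_pow, map_ofNat] at h ⊢
  linear_combination C (τ : ℂ) * (-h)

theorem lagT_lag_zero (hν : -1 < ν) : lagT ν τ (lag ν τ 0) = lag ν τ 1 := by
  rw [lagT_lag hν, lagD_lag_zero τ hν]; simp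

theorem lagT_lag_succ (hν : -1 < ν) (n : ℕ) : lagT ν τ (lag ν τ (n + 1)) =
    C ((n : ℂ) + 2) * lag ν τ (n + 2) - C ((n + 1 + ν : ℝ) : ℂ) * lag ν τ n := by
  rw [lagT_lag hν, lagD_lag_succ τ hν, ← sub_eq_add_neg]
  congr 3
  push_cast; ring

/-- By `gammaRatio_add_two` the downward term of each new summand cancels the upward term left over
by the previous ones. -/
theorem lagT_evenPoly (hν : -1 < ν) (k : ℕ) : lagT ν τ (evenPoly ν τ k) =
    C (((2 * k + 1) * gammaRatio ν (2 * k) : ℝ) : ℂ) * lag ν τ (2 * k + 1) := by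
  induction k with
  | zero =>
    simp only [evenPoly, zero_add, Finset.sum_range_one, lagT_C_mul, mul_zero, lagT_lag_zero hν,
      Nat.cast_zero, one_mul]
  | succ k ih =>
    rw [evenPoly, Finset.sum_range_succ, lagT_add, ← evenPoly, ih, lagT_C_mul,
      show 2 * (k + 1) = 2 * k + 1 + 1 by ring, lagT_lag_succ hν]
    have h := gammaRatio_add_two hν (2 * k)
    rw [show 2 * k + 1 + 2 = 2 * k + 1 + 1 + 1 by ring, mul_sub, ← mul_assoc, ← mul_assoc,
      ← C_mul, ← C_mul, add_sub_left_comm, ← sub_mul, ← C_sub]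
    have e : (((2 * k + 1) * gammaRatio ν (2 * k) : ℝ) : ℂ) -
        (gammaRatio ν (2 * k + 1 + 1) : ℂ) * (((2 * k + 1 : ℕ) + 1 + ν : ℝ) : ℂ) = 0 := by
      rw [← Complex.ofReal_mul, ← Complex.ofReal_sub, Complex.ofReal_eq_zero]
      push_cast at h ⊢
      linear_combination -h
    rw [e, C_0, zero_mul, add_zero]
    congr 2
    push_cast
    ring

/-- The partial sums of the skew kernel as polynomials in the first variable. -/
noncomputable def skewPoly (ν τ : ℝ) (u : ℂ) (N : ℕ) : ℂ[X] :=
  ∑ k ∈ Finset.range N, (C (gammaRatio ν (2 * k + 1) * (evenPoly ν τ k).eval u) *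
      lag ν τ (2 * k + 1) -
    C (gammaRatio ν (2 * k + 1) * (lag ν τ (2 * k + 1)).eval u) * evenPoly ν τ k)

/-- The partial sums of the Hardy–Hille series as polynomials in the first variable. -/
noncomputable def hillePoly (ν τ : ℝ) (u : ℂ) (N : ℕ) : ℂ[X] :=
  ∑ m ∈ Finset.range N, C (hilleCoeff ν m * (lag ν τ m).eval u) * lag ν τ m

theorem lagT_sub (p q : ℂ[X]) : lagT ν τ (p - q) = lagT ν τ p - lagT ν τ q := by
  rw [sub_eq_add_neg, ← neg_one_mul, ← C_1, ← C_neg, lagT_add, lagT_C_mul]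
  simp [sub_eq_add_neg]

/-- T sends P_{2k+1} to its two even neighbours and V_k to a multiple of P_{2k+1}. The duplication
formula turns the surviving coefficients into h_m, and the even contributions telescope to a single
boundary term. -/
theorem lagT_skewPoly (hν : -1 < ν) (u : ℂ) (N : ℕ) :
    lagT ν τ (skewPoly ν τ u N) = -(C (((2 : ℝ) ^ (ν + 1) : ℝ) : ℂ) * hillePoly ν τ u (2 * N)) +
      C (((2 * N + 1 + ν) * gammaRatio ν (2 * N + 1) : ℝ) *
        ∑ l ∈ Finset.range N, gammaRatio ν (2 * l) * (lag ν τ (2 * l)).eval u) *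
          lag ν τ (2 * N) := by
  induction N with
  | zero => simp [skewPoly, hillePoly, lagT, lagD]
  | succ N ih =>
    rw [skewPoly, Finset.sum_range_succ, lagT_add, ← skewPoly, ih, lagT_sub, lagT_C_mul,
      lagT_C_mul, lagT_evenPoly hν, lagT_lag_succ hν, show 2 * (N + 1) = 2 * N + 1 + 1 by ring,
      hillePoly, hillePoly, Finset.sum_range_succ _ (2 * N + 1), Finset.sum_range_succ _ (2 * N),
      Finset.sum_range_succ _ N]
    have hV : (evenPoly ν τ N).eval u = ∑ l ∈ Finset.range N,
        gammaRatio ν (2 * l) * (lag ν τ (2 * l)).eval u +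
          gammaRatio ν (2 * N) * (lag ν τ (2 * N)).eval u := by
      simp [evenPoly, eval_finsetSum, Finset.sum_range_succ]
    have h1 := congrArg (fun x : ℝ => (x : ℂ)) (gammaRatio_mul_succ hν (2 * N))
    have h2 := congrArg (fun x : ℝ => (x : ℂ)) (gammaRatio_mul_succ hν (2 * N + 1))
    have h3 := congrArg (fun x : ℝ => (x : ℂ)) (gammaRatio_add_two hν (2 * N + 1))
    have h4 := congrArg (fun x : ℝ => (x : ℂ)) (gammaRatio_add_two hν (2 * N))
    rw [hV]
    generalize ∑ l ∈ Finset.range N, (gammaRatio ν (2 * l) : ℂ) * (lag ν τ (2 * l)).eval u = V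
    generalize ∑ m ∈ Finset.range (2 * N), C (hilleCoeff ν m * (lag ν τ m).eval u) * lag ν τ m = W
    simp only [show 2 * N + 1 + 2 = 2 * N + 1 + 1 + 1 by ring] at h3 ⊢
    push_cast at h1 h2 h3 h4 ⊢
    rw [show 2 * N + 1 + 1 = 2 * N + 2 by ring, show 2 * N + 2 + 1 = 2 * N + 3 by ring] at *
    -- With the special values made into free variables, the claim is a polynomial identity modulo
    -- the four relations `h1`–`h4`.
    generalize gammaRatio ν (2 * N) = c0 at *
    generalize gammaRatio ν (2 * N + 1) = c1 at *
    generalize gammaRatio ν (2 * N + 2) = c2 at *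
    generalize gammaRatio ν (2 * N + 3) = c3 at *
    generalize lag ν τ (2 * N) = p0 at *
    generalize lag ν τ (2 * N + 1) = p1 at *
    generalize lag ν τ (2 * N + 2) = p2 at *
    generalize hilleCoeff ν (2 * N) = g0 at *
    generalize hilleCoeff ν (2 * N + 1) = g1 at *
    generalize (((2 : ℝ) ^ (ν + 1) : ℝ) : ℂ) = t at *
    have h1' := congrArg (C : ℂ → ℂ[X]) h1
    have h2' := congrArg (C : ℂ → ℂ[X]) h2
    have h3' := congrArg (C : ℂ → ℂ[X]) h3
    have h4' := congrArg (C : ℂ → ℂ[X]) h4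
    simp only [map_mul, map_add, map_one, map_ofNat, map_natCast] at h1' h2' h3' h4' ⊢
    linear_combination (-(C (eval u p0)) * p0) * h1' - C (eval u p1) * p1 * h2' -
      (C V + C (c0 : ℂ) * C (eval u p0)) * p2 * h3' + C (eval u p1) * C (c1 : ℂ) * p1 * h4'

/-- The operator annihilating `∑ₘ hₘ Pₘ(z) Pₘ(·)`. -/
noncomputable def hilleOp (ν τ : ℝ) (z : ℂ) (p : ℂ[X]) : ℂ[X] :=
  C ((1 - τ ^ 2 : ℝ) : ℂ) * lagT ν τ p + (X - C z) * p

theorem hilleOp_add (z : ℂ) (p q : ℂ[X]) :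
    hilleOp ν τ z (p + q) = hilleOp ν τ z p + hilleOp ν τ z q := by
  simp only [hilleOp, lagT_add]; ring

theorem hilleOp_C_mul (z : ℂ) (c : ℂ) (p : ℂ[X]) :
    hilleOp ν τ z (C c * p) = C c * hilleOp ν τ z p := by
  simp only [hilleOp, lagT_C_mul]; ring

end operators

/-! ### The three-term recurrence and the Christoffel–Darboux identity for the Hardy–Hille sum. -/

section three_term

open Polynomial

variable {ν τ : ℝ}

theorem lag_three_term (hν : -1 < ν) (n : ℕ) : X * lag ν τ (n + 1) =
    C ((τ * (2 * n + 3 + ν) : ℝ) : ℂ) * lag ν τ (n + 1) - C ((n : ℂ) + 2) * lag ν τ (n + 2) -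
      C ((τ ^ 2 * (n + 1 + ν) : ℝ) : ℂ) * lag ν τ n := by
  have h1 := lag_raise τ hν (n + 1)
  have h2 := lag_ode τ hν (n + 1)
  rw [lagD_lag_succ τ hν] at h2
  simp only [map_mul, map_add, map_pow, map_one, map_natCast, map_ofNat, Nat.cast_add,
    Nat.cast_one, Complex.ofReal_add, Complex.ofReal_mul, Complex.ofReal_pow, Complex.ofReal_one,
    Complex.ofReal_ofNat, Complex.ofReal_natCast] at h1 h2 ⊢
  linear_combination h1 - C (τ : ℂ) * h2

theorem lag_three_term_zero (hν : -1 < ν) : X * lag ν τ 0 =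
    C ((τ * (1 + ν) : ℝ) : ℂ) * lag ν τ 0 - lag ν τ 1 := by
  have h1 := lag_raise τ hν 0
  rw [lag_zero τ hν] at h1 ⊢
  simp only [map_mul, map_add, map_one, CharP.cast_eq_zero, zero_add, derivative_one, mul_zero,
    add_zero, Complex.ofReal_add, Complex.ofReal_mul, Complex.ofReal_one] at h1 ⊢
  linear_combination h1

/-- (1−τ²)T + X sends P_n to −τ²(n+1) P_{n+1} + τ(2n+1+ν) P_n − (n+ν) P_{n−1}. With the weights h_n,
where (n+ν) h_n = n h_{n−1}, this is the transpose of multiplication by the variable, so applying it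
in one variable cancels multiplication by z in the other except at the last index. -/
theorem hilleOp_hillePoly (hν : -1 < ν) (z : ℂ) (N : ℕ) :
    hilleOp ν τ z (hillePoly ν τ z (N + 1)) =
      C (((N + 1) * hilleCoeff ν N : ℝ) * (lag ν τ (N + 1)).eval z) * lag ν τ N -
      C ((τ ^ 2 * ((N + 1) * hilleCoeff ν N) : ℝ) * (lag ν τ N).eval z) * lag ν τ (N + 1) := by
  induction N with
  | zero =>
    have h1 := lag_three_term_zero (τ := τ) hν
    have h2 := congrArg (eval z) h1
    rw [hillePoly, zero_add, Finset.sum_range_one, hilleOp_C_mul, hilleOp, lagT_lag_zero hν]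
    simp only [eval_mul, eval_X, eval_sub, eval_C] at h2
    have h2' := congrArg (C : ℂ → ℂ[X]) h2
    simp only [map_mul, map_add, map_sub, map_pow, map_one, CharP.cast_eq_zero, zero_add,
      Complex.ofReal_add, Complex.ofReal_mul, Complex.ofReal_one, Complex.ofReal_pow,
      Complex.ofReal_sub, one_mul] at h1 h2' ⊢
    linear_combination C (hilleCoeff ν 0 : ℂ) * C (eval z (lag ν τ 0)) * h1 -
      C (hilleCoeff ν 0 : ℂ) * lag ν τ 0 * h2'
  | succ N ih =>
    have h1 := lag_three_term (τ := τ) hν N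
    have h2 := congrArg (eval z) h1
    have h3 := congrArg (fun x : ℝ => C (x : ℂ)) (hilleCoeff_succ hν N)
    rw [hillePoly, Finset.sum_range_succ, ← hillePoly, hilleOp_add, ih, hilleOp_C_mul, hilleOp,
      lagT_lag_succ hν]
    simp only [eval_mul, eval_X, eval_sub, eval_C] at h2
    have h2' := congrArg (C : ℂ → ℂ[X]) h2
    simp only [map_mul, map_add, map_sub, map_pow, map_one, map_natCast, map_ofNat, Nat.cast_add,
      Nat.cast_one, Complex.ofReal_add, Complex.ofReal_mul, Complex.ofReal_pow, Complex.ofReal_one,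
      Complex.ofReal_sub,
      Complex.ofReal_ofNat, Complex.ofReal_natCast] at h1 h2' h3 ⊢
    rw [show N + 1 + 1 = N + 2 by ring]
    linear_combination C (hilleCoeff ν (N + 1) : ℂ) * C (eval z (lag ν τ (N + 1))) * h1 -
      C (hilleCoeff ν (N + 1) : ℂ) * lag ν τ (N + 1) * h2' +
      (C (τ : ℂ) ^ 2 * C (eval z (lag ν τ N)) * lag ν τ (N + 1) -
        C (eval z (lag ν τ (N + 1))) * lag ν τ N) * h3

end three_term

/-! ### Entire functions -/

theorem tendstoLocallyUniformlyOn_univ_of_closedBall {F : ℕ → ℂ → ℂ} {f : ℂ → ℂ}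
    (h : ∀ R : ℝ, 0 ≤ R → TendstoUniformlyOn F f atTop (Metric.closedBall 0 R)) :
    TendstoLocallyUniformlyOn F f atTop Set.univ := by
  rw [tendstoLocallyUniformlyOn_iff_forall_isCompact isOpen_univ]
  intro K _ hK
  obtain ⟨R, hR⟩ := hK.isBounded.subset_closedBall (0 : ℂ)
  exact (h (max R 0) (le_max_right _ _)).mono
    (hR.trans (Metric.closedBall_subset_closedBall (le_max_left _ _)))

/-- Weierstrass' theorem; it carries differential identities from the partial sums to the limits. -/
theorem tendsto_derivative_eval {p : ℕ → Polynomial ℂ} {f : ℂ → ℂ}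
    (h : TendstoLocallyUniformlyOn (fun N z => (p N).eval z) f atTop Set.univ) :
    Differentiable ℂ f ∧
      TendstoLocallyUniformlyOn (fun N z => (p N).derivative.eval z) (deriv f) atTop Set.univ := by
  have hd : ∀ᶠ N in atTop, DifferentiableOn ℂ (fun z => (p N).eval z) Set.univ :=
    Eventually.of_forall fun N => (p N).differentiable.differentiableOn
  refine ⟨differentiableOn_univ.1 (h.differentiableOn hd isOpen_univ), ?_⟩
  refine (h.deriv hd isOpen_univ).congr fun N z _ => ?_
  exact Polynomial.deriv _

theorem tendsto_lagT_eval {ν τ : ℝ} {p : ℕ → Polynomial ℂ} {f : ℂ → ℂ}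
    (h : TendstoLocallyUniformlyOn (fun N z => (p N).eval z) f atTop Set.univ) (z : ℂ) :
    Tendsto (fun N => (lagT ν τ (p N)).eval z) atTop (𝓝 ((1 - τ ^ 2) *
      (z * deriv (deriv f) z + (ν + 1) * deriv f z) + 2 * τ * (z * deriv f z) +
        (τ * (ν + 1) - z) * f z)) := by
  have h1 := tendsto_derivative_eval h
  have h2 := tendsto_derivative_eval h1.2
  have t0 := h.tendsto_at (Set.mem_univ z)
  have t1 := h1.2.tendsto_at (Set.mem_univ z)
  have t2 := h2.2.tendsto_at (Set.mem_univ z)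
  simp only [lagT, lagD, Polynomial.eval_add, Polynomial.eval_mul, Polynomial.eval_sub,
    Polynomial.eval_C, Polynomial.eval_X]
  push_cast
  exact (((t2.const_mul z).add (t1.const_mul _)).const_mul _).add ((t1.const_mul z).const_mul _)
    |>.add (t0.const_mul _)

theorem iteratedDeriv_id_mul {g : ℂ → ℂ} (hg : Differentiable ℂ g) (n : ℕ) (z : ℂ) :
    iteratedDeriv (n + 1) (fun w => w * g w) z =
      z * iteratedDeriv (n + 1) g z + (n + 1) * iteratedDeriv n g z := by
  have hdiff : ∀ m, Differentiable ℂ (iteratedDeriv m g) := fun m =>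
    (hg.contDiff (n := ((m + 1 : ℕ) : ℕ∞))).differentiable_iteratedDeriv m
      (by exact_mod_cast Nat.lt_succ_self m)
  induction n generalizing z with
  | zero =>
    rw [zero_add, iteratedDeriv_one, iteratedDeriv_one, iteratedDeriv_zero]
    have := ((hasDerivAt_id z).mul (hg z).hasDerivAt).deriv
    simp only [id] at this
    rw [show (fun w => w * g w) = (id * g) by rfl, this]
    push_cast; ring
  | succ n ih =>
    rw [iteratedDeriv_succ, show iteratedDeriv (n + 1) (fun w => w * g w) =
      fun z => z * iteratedDeriv (n + 1) g z + (n + 1) * iteratedDeriv n g z from funext ih]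
    have h1 := (hasDerivAt_id z).mul (hdiff (n + 1) z).hasDerivAt
    have h2 := ((hdiff n z).hasDerivAt).const_mul ((n : ℂ) + 1)
    have h3 := (h1.add h2).deriv
    simp only [id, ← iteratedDeriv_succ] at h3
    refine Eq.trans ?_ (h3.trans ?_)
    · rfl
    · push_cast; ring

/-- Frobenius uniqueness at the origin for `z f'' + (ν + 1) f' = (a z + b) f`. -/
theorem eq_zero_of_ode {ν : ℝ} (hν : -1 < ν) {f : ℂ → ℂ} (hf : Differentiable ℂ f) {a b : ℂ}
    (hode : ∀ z, z * deriv (deriv f) z + (ν + 1) * deriv f z = (a * z + b) * f z)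
    (h0 : f 0 = 0) (z : ℂ) : f z = 0 := by
  have hf1 : Differentiable ℂ (deriv f) := hf.deriv
  have hf2 : Differentiable ℂ (deriv (deriv f)) := hf1.deriv
  have hD : ∀ (g : ℂ → ℂ) (_ : Differentiable ℂ g) (m : ℕ) (x : ℂ), ContDiffAt ℂ m g x :=
    fun g hg m x => hg.contDiff.contDiffAt
  have hdiv : ∀ k, iteratedDeriv k (deriv f) 0 = iteratedDeriv (k + 1) f 0 := fun k => by
    rw [iteratedDeriv_succ']
  have hdiv2 : ∀ k, iteratedDeriv k (deriv (deriv f)) 0 = iteratedDeriv (k + 2) f 0 := fun k => by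
    rw [iteratedDeriv_succ', iteratedDeriv_succ']
  have hn : ∀ n, iteratedDeriv n f 0 = 0 ∧ iteratedDeriv (n + 1) f 0 = 0 := by
    intro n
    have hν1 : ∀ m : ℕ, ((m : ℂ) + (ν + 1)) ≠ 0 := by
      intro m
      have : (m : ℝ) + (ν + 1) ≠ 0 := by
        have : (0 : ℝ) ≤ m := m.cast_nonneg
        linarith
      exact_mod_cast this
    induction n with
    | zero =>
      rw [iteratedDeriv_zero, iteratedDeriv_one]
      refine ⟨h0, ?_⟩
      have := hode 0
      rw [h0, zero_mul, zero_add, mul_zero] at this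
      simpa using (mul_eq_zero.1 this).resolve_left (by simpa using hν1 0)
    | succ n ih =>
      refine ⟨ih.2, ?_⟩
      -- Differentiating the equation n + 1 times at 0 leaves (n + 1 + ν + 1) f^{(n+2)}(0) on the
      -- left and multiples of f^{(n)}(0) and f^{(n+1)}(0) on the right; ν > −1 keeps the factor
      -- nonzero.
      have key : iteratedDeriv (n + 1)
          (fun z => z * deriv (deriv f) z + (ν + 1) * deriv f z) 0 =
          iteratedDeriv (n + 1) (fun z => (a * z + b) * f z) 0 := by rw [funext hode]
      have e : (fun z => (a * z + b) * f z) = fun z => a * (z * f z) + b * f z := by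
        funext z; ring
      rw [e, iteratedDeriv_fun_add, iteratedDeriv_fun_add, iteratedDeriv_const_mul_field,
        iteratedDeriv_const_mul_field, iteratedDeriv_const_mul_field, iteratedDeriv_id_mul hf2,
        iteratedDeriv_id_mul hf, hdiv, hdiv2, hdiv2, ih.1, ih.2] at key
      · have h5 : ((n + 1 : ℕ) + ((ν : ℂ) + 1)) * iteratedDeriv (n + 1 + 1) f 0 = 0 := by
          push_cast
          linear_combination key
        exact (mul_eq_zero.1 h5).resolve_left (hν1 _)
      all_goals
        refine hD _ ?_ _ _
        fun_prop
  rw [← Complex.taylorSeries_eq_of_entire' 0 z hf]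
  simp [hn]

/-! ### Convergence of the kernels -/

/-- The duplication formula expresses h_n through (n+1+ν) c_n c_{n+1} with bounded c_n. Any
polynomial bound suffices against geometric decay. -/
theorem exists_hilleCoeff_le {ν : ℝ} (hν : -1 < ν) :
    ∃ A : ℝ, 0 ≤ A ∧ ∀ n : ℕ, hilleCoeff ν n ≤ A * (n + 1) := by
  obtain ⟨K, hK⟩ := exists_gammaRatio_le hν
  refine ⟨K ^ 2 * (1 + |ν|) / (2 : ℝ) ^ (ν + 1), by positivity, fun n => ?_⟩
  have h := gammaRatio_mul_succ hν n
  have hn : (0 : ℝ) ≤ n := n.cast_nonneg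
  rw [div_mul_eq_mul_div, le_div_iff₀ (by positivity), mul_comm, ← h]
  have h1 := (gammaRatio_pos hν n).le
  have h2 := (gammaRatio_pos hν (n + 1)).le
  have h3 : gammaRatio ν n * gammaRatio ν (n + 1) ≤ K ^ 2 := by
    rw [sq]; exact mul_le_mul (hK _) (hK _) h2 (h1.trans (hK _))
  have h4 : (n : ℝ) + 1 + ν ≤ (1 + |ν|) * (n + 1) := by
    have := le_abs_self ν
    have := abs_nonneg ν
    nlinarith
  calc _ ≤ ((1 + |ν|) * (n + 1)) * K ^ 2 := by gcongr
    _ = _ := by ring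

section limits

variable {ν τ : ℝ}

theorem exists_norm_sum_even_le (hν : -1 < ν) (hτ0 : 0 < τ) (hτ1 : τ < 1) {R : ℝ} (hR : 0 ≤ R) :
    ∃ C : ℝ, 0 ≤ C ∧ ∀ N : ℕ, ∀ z : ℂ, ‖z‖ ≤ R →
      ‖∑ l ∈ Finset.range N, (gammaRatio ν (2 * l) : ℂ) * (lag ν τ (2 * l)).eval z‖ ≤ C := by
  obtain ⟨K, hK⟩ := exists_gammaRatio_le hν
  have hK0 : 0 ≤ K := (gammaRatio_pos hν 0).le.trans (hK 0)
  obtain ⟨C, hC0, hC⟩ := exists_norm_eval_lag_le hν hτ0.le hτ1 hR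
  have hρ0 : 0 ≤ (1 + τ) / 2 := by linarith
  have hρ1 : (1 + τ) / 2 < 1 := by linarith
  refine ⟨K * C * (1 - (1 + τ) / 2)⁻¹, mul_nonneg (by positivity)
    (inv_nonneg.2 (by linarith)), fun N z hz => ?_⟩
  refine (norm_sum_le_of_le (n := fun l => K * C * ((1 + τ) / 2) ^ l) _ fun l _ => ?_).trans ?_
  · rw [norm_mul, Complex.norm_real, Real.norm_of_nonneg (gammaRatio_pos hν _).le, mul_assoc]
    refine mul_le_mul (hK _) ((hC _ z hz).trans ?_) (norm_nonneg _) hK0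
    exact mul_le_mul_of_nonneg_left (pow_le_pow_of_le_one hρ0 hρ1.le (by omega)) hC0
  · rw [← Finset.mul_sum, ← tsum_geometric_of_lt_one hρ0 hρ1]
    exact mul_le_mul_of_nonneg_left ((summable_geometric_of_lt_one hρ0 hρ1).sum_le_tsum _
      fun i _ => by positivity) (by positivity)

theorem eval_evenPoly (k : ℕ) (z : ℂ) : (evenPoly ν τ k).eval z =
    ∑ l ∈ Finset.range (k + 1), (gammaRatio ν (2 * l) : ℂ) * (lag ν τ (2 * l)).eval z := by
  simp [evenPoly, Polynomial.eval_finsetSum]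

/-- The terms of the skew kernel. -/
noncomputable def skewTerm (ν τ : ℝ) (z u : ℂ) (k : ℕ) : ℂ :=
  (gammaRatio ν (2 * k + 1) : ℂ) * ((lag ν τ (2 * k + 1)).eval z * (evenPoly ν τ k).eval u -
    (evenPoly ν τ k).eval z * (lag ν τ (2 * k + 1)).eval u)

/-- The limit of the skew kernel. -/
noncomputable def skewSum (ν τ : ℝ) (z u : ℂ) : ℂ := ∑' k, skewTerm ν τ z u k

/-- The Hardy–Hille series. -/
noncomputable def hilleSum (ν τ : ℝ) (z u : ℂ) : ℂ :=
  ∑' m, (hilleCoeff ν m : ℂ) * ((lag ν τ m).eval u * (lag ν τ m).eval z)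

theorem skewSum_antisymm (z u : ℂ) : skewSum ν τ z u = -skewSum ν τ u z := by
  rw [skewSum, skewSum, ← tsum_neg]
  exact tsum_congr fun k => by simp only [skewTerm]; ring

theorem hilleSum_comm (z u : ℂ) : hilleSum ν τ z u = hilleSum ν τ u z :=
  tsum_congr fun k => by ring

theorem exists_norm_skewTerm_le (hν : -1 < ν) (hτ0 : 0 < τ) (hτ1 : τ < 1) {R : ℝ} (hR : 0 ≤ R) :
    ∃ C : ℝ, ∀ (k : ℕ) (z u : ℂ), ‖z‖ ≤ R → ‖u‖ ≤ R →
      ‖skewTerm ν τ z u k‖ ≤ C * ((1 + τ) / 2) ^ k := by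
  obtain ⟨K, hK⟩ := exists_gammaRatio_le hν
  have hK0 : 0 ≤ K := (gammaRatio_pos hν 0).le.trans (hK 0)
  obtain ⟨C, hC0, hC⟩ := exists_norm_eval_lag_le hν hτ0.le hτ1 hR
  obtain ⟨B, hB0, hB⟩ := exists_norm_sum_even_le hν hτ0 hτ1 hR
  have hρ0 : 0 ≤ (1 + τ) / 2 := by linarith
  have hρ1 : (1 + τ) / 2 < 1 := by linarith
  refine ⟨K * (2 * (C * B)), fun k z u hz hu => ?_⟩
  have hP : ∀ w : ℂ, ‖w‖ ≤ R → ‖(lag ν τ (2 * k + 1)).eval w‖ ≤ C * ((1 + τ) / 2) ^ k :=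
    fun w hw => (hC _ w hw).trans
      (mul_le_mul_of_nonneg_left (pow_le_pow_of_le_one hρ0 hρ1.le (by omega)) hC0)
  have hV : ∀ w : ℂ, ‖w‖ ≤ R → ‖(evenPoly ν τ k).eval w‖ ≤ B := fun w hw => by
    rw [eval_evenPoly]; exact hB _ w hw
  rw [skewTerm, norm_mul, Complex.norm_real, Real.norm_of_nonneg (gammaRatio_pos hν _).le]
  calc _ ≤ K * (‖(lag ν τ (2 * k + 1)).eval z‖ * ‖(evenPoly ν τ k).eval u‖ +
        ‖(evenPoly ν τ k).eval z‖ * ‖(lag ν τ (2 * k + 1)).eval u‖) := by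
        refine mul_le_mul (hK _) ((norm_sub_le _ _).trans ?_) (norm_nonneg _) hK0
        rw [norm_mul, norm_mul]
    _ ≤ K * ((C * ((1 + τ) / 2) ^ k) * B + B * (C * ((1 + τ) / 2) ^ k)) := by
        gcongr
        exacts [hP z hz, hV u hu, hV z hz, hP u hu]
    _ = _ := by ring

/-- The separate indices m1, m2 ≥ m let one bound serve both the series and the shifted boundary
terms of `hilleOp_hillePoly`. -/
theorem exists_norm_hilleTerm_le (hν : -1 < ν) (hτ0 : 0 < τ) (hτ1 : τ < 1) {R : ℝ} (hR : 0 ≤ R) :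
    ∃ C : ℝ, ∀ (m m1 m2 : ℕ) (z u : ℂ), m ≤ m1 → m ≤ m2 → ‖z‖ ≤ R → ‖u‖ ≤ R →
      ‖(hilleCoeff ν m : ℂ) * ((lag ν τ m1).eval u * (lag ν τ m2).eval z)‖ ≤
        C * ((m + 1) * ((1 + τ) / 2) ^ m) := by
  obtain ⟨A, hA0, hA⟩ := exists_hilleCoeff_le hν
  obtain ⟨C, hC0, hC⟩ := exists_norm_eval_lag_le hν hτ0.le hτ1 hR
  have hρ0 : 0 ≤ (1 + τ) / 2 := by linarith
  have hρ1 : (1 + τ) / 2 < 1 := by linarith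
  refine ⟨A * (C * C), fun m m1 m2 z u h1 h2 hz hu => ?_⟩
  have hP : ‖(lag ν τ m1).eval u‖ ≤ C * ((1 + τ) / 2) ^ m :=
    (hC _ u hu).trans
      (mul_le_mul_of_nonneg_left (pow_le_pow_of_le_one hρ0 hρ1.le (by omega)) hC0)
  have hQ : ‖(lag ν τ m2).eval z‖ ≤ C :=
    (hC _ z hz).trans (mul_le_of_le_one_right hC0 (pow_le_one₀ hρ0 hρ1.le))
  rw [norm_mul, norm_mul, Complex.norm_real, Real.norm_of_nonneg (hilleCoeff_pos hν _).le]
  calc _ ≤ (A * (m + 1)) * ((C * ((1 + τ) / 2) ^ m) * C) := by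
        gcongr
        exact hA m
    _ = _ := by ring

theorem summable_add_one_pow_mul_geometric {ρ : ℝ} (hρ0 : 0 < ρ) (hρ1 : ρ < 1) (j : ℕ) :
    Summable fun m : ℕ => ((m : ℝ) + 1) ^ j * ρ ^ m := by
  have hρ : ‖ρ‖ < 1 := by rwa [Real.norm_of_nonneg hρ0.le]
  have h0 : Summable fun m : ℕ => (m : ℝ) ^ j * ρ ^ m :=
    summable_pow_mul_geometric_of_norm_lt_one j hρ
  have h : Summable fun m : ℕ => ((m + 1 : ℕ) : ℝ) ^ j * ρ ^ (m + 1) :=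
    (summable_nat_add_iff (f := fun m : ℕ => (m : ℝ) ^ j * ρ ^ m) 1).2 h0
  refine (h.mul_left ρ⁻¹).congr fun m => ?_
  rw [pow_succ ρ, Nat.cast_add, Nat.cast_one, mul_comm (ρ ^ m), mul_left_comm, ← mul_assoc ρ⁻¹,
    inv_mul_cancel₀ hρ0.ne', one_mul]

theorem summable_skew_bound (hτ0 : 0 < τ) (hτ1 : τ < 1) (C : ℝ) :
    Summable fun k : ℕ => C * ((1 + τ) / 2) ^ k :=
  (summable_geometric_of_lt_one (by linarith) (by linarith)).mul_left C

theorem tendsto_skewPoly (hν : -1 < ν) (hτ0 : 0 < τ) (hτ1 : τ < 1) (u : ℂ) :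
    TendstoLocallyUniformlyOn (fun N z => (skewPoly ν τ u N).eval z)
      (fun z => skewSum ν τ z u) atTop Set.univ := by
  refine tendstoLocallyUniformlyOn_univ_of_closedBall fun R hR => ?_
  obtain ⟨C, hC⟩ := exists_norm_skewTerm_le hν hτ0 hτ1 (le_max_of_le_left hR : 0 ≤ max R ‖u‖)
  refine (tendstoUniformlyOn_tsum_nat (f := fun k z => skewTerm ν τ z u k)
    (summable_skew_bound hτ0 hτ1 C)
    fun k z hz => hC k z u ((mem_closedBall_zero_iff.1 hz).trans (le_max_left _ _))
      (le_max_right _ _)).congr ?_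
  refine Eventually.of_forall fun N z _ => ?_
  simp only [skewPoly, Polynomial.eval_finsetSum, skewTerm, Polynomial.eval_sub,
    Polynomial.eval_mul, Polynomial.eval_C]
  exact Finset.sum_congr rfl fun k _ => by ring

theorem tendsto_hillePoly (hν : -1 < ν) (hτ0 : 0 < τ) (hτ1 : τ < 1) (u : ℂ) :
    TendstoLocallyUniformlyOn (fun N z => (hillePoly ν τ u N).eval z)
      (fun z => hilleSum ν τ z u) atTop Set.univ := by
  refine tendstoLocallyUniformlyOn_univ_of_closedBall fun R hR => ?_
  obtain ⟨C, hC⟩ := exists_norm_hilleTerm_le hν hτ0 hτ1 (le_max_of_le_left hR : 0 ≤ max R ‖u‖)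
  have hs : Summable fun m : ℕ => C * (((m : ℝ) + 1) * ((1 + τ) / 2) ^ m) := by
    simpa using (summable_add_one_pow_mul_geometric (by linarith : 0 < (1 + τ) / 2) (by linarith) 1).mul_left C
  refine (tendstoUniformlyOn_tsum_nat
    (f := fun m z => (hilleCoeff ν m : ℂ) * ((lag ν τ m).eval u * (lag ν τ m).eval z)) hs
    fun k z hz => hC k k k z u le_rfl le_rfl ((mem_closedBall_zero_iff.1 hz).trans
      (le_max_left _ _)) (le_max_right _ _)).congr ?_
  refine Eventually.of_forall fun N z _ => ?_
  simp only [hillePoly, Polynomial.eval_finsetSum, Polynomial.eval_mul, Polynomial.eval_C]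
  exact Finset.sum_congr rfl fun k _ => by ring

/-- The skew kernel is mapped to the Hardy–Hille series. -/
theorem skewSum_ode (hν : -1 < ν) (hτ0 : 0 < τ) (hτ1 : τ < 1) (u z : ℂ) :
    (1 - τ ^ 2) * (z * deriv (deriv fun z => skewSum ν τ z u) z +
      (ν + 1) * deriv (fun z => skewSum ν τ z u) z) +
      2 * τ * (z * deriv (fun z => skewSum ν τ z u) z) + (τ * (ν + 1) - z) * skewSum ν τ z u =
      -(((2 : ℝ) ^ (ν + 1) : ℝ) : ℂ) * hilleSum ν τ z u := by
  refine tendsto_nhds_unique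
    (tendsto_lagT_eval (ν := ν) (τ := τ) (tendsto_skewPoly hν hτ0 hτ1 u) z) ?_
  simp only [lagT_skewPoly hν, Polynomial.eval_add, Polynomial.eval_neg, Polynomial.eval_mul,
    Polynomial.eval_C]
  have h1 : Tendsto (fun N : ℕ => (hillePoly ν τ u (2 * N)).eval z) atTop
      (𝓝 (hilleSum ν τ z u)) :=
    ((tendsto_hillePoly hν hτ0 hτ1 u).tendsto_at (Set.mem_univ z)).comp
      (tendsto_id.const_mul_atTop' two_pos)
  -- The boundary term is a factor of linear growth, times a bounded even sum, times the
  -- geometrically small P_{2N}(z).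
  have h2 : Tendsto (fun N : ℕ => (((2 * N + 1 + ν) * gammaRatio ν (2 * N + 1) : ℝ) : ℂ) *
      (∑ l ∈ Finset.range N, gammaRatio ν (2 * l) * (lag ν τ (2 * l)).eval u) *
      (lag ν τ (2 * N)).eval z) atTop (𝓝 0) := by
    have hR : 0 ≤ max ‖z‖ ‖u‖ := le_max_of_le_left (norm_nonneg _)
    obtain ⟨K, hK⟩ := exists_gammaRatio_le hν
    have hK0 : 0 ≤ K := (gammaRatio_pos hν 0).le.trans (hK 0)
    obtain ⟨C, hC0, hC⟩ := exists_norm_eval_lag_le hν hτ0.le hτ1 hR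
    obtain ⟨B, hB0, hB⟩ := exists_norm_sum_even_le hν hτ0 hτ1 hR
    have hρ0 : 0 ≤ (1 + τ) / 2 := by linarith
    have hρ1 : (1 + τ) / 2 < 1 := by linarith
    have ht := ((summable_add_one_pow_mul_geometric (by linarith : 0 < (1 + τ) / 2) (by linarith) 1).tendsto_atTop_zero).const_mul
      ((2 + |ν|) * K * B * C)
    rw [mul_zero] at ht
    refine squeeze_zero_norm (fun N => ?_) ht
    have hN : (0 : ℝ) ≤ N := N.cast_nonneg
    have h4 : ‖(lag ν τ (2 * N)).eval z‖ ≤ C * ((1 + τ) / 2) ^ N :=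
      (hC _ z (le_max_left _ _)).trans
        (mul_le_mul_of_nonneg_left (pow_le_pow_of_le_one hρ0 hρ1.le (by omega)) hC0)
    have h5 : 2 * (N : ℝ) + 1 + ν ≤ (2 + |ν|) * (N + 1) := by
      have := le_abs_self ν
      have := abs_nonneg ν
      nlinarith
    rw [norm_mul, norm_mul, Complex.norm_real, Real.norm_of_nonneg
      (mul_nonneg (by linarith) (gammaRatio_pos hν _).le)]
    calc _ ≤ ((2 + |ν|) * (N + 1)) * K * B * (C * ((1 + τ) / 2) ^ N) := by
          gcongr
          · exact (gammaRatio_pos hν _).le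
          · exact hK _
          · exact hB _ _ (le_max_right _ _)
      _ = _ := by rw [pow_one]; ring
  simpa using (h1.const_mul (((2 : ℝ) ^ (ν + 1) : ℝ) : ℂ)).neg.add h2

theorem hilleSum_ode (hν : -1 < ν) (hτ0 : 0 < τ) (hτ1 : τ < 1) (z u : ℂ) :
    (1 - τ ^ 2) * ((1 - τ ^ 2) * (u * deriv (deriv fun u => hilleSum ν τ u z) u +
      (ν + 1) * deriv (fun u => hilleSum ν τ u z) u) +
      2 * τ * (u * deriv (fun u => hilleSum ν τ u z) u) + (τ * (ν + 1) - u) * hilleSum ν τ u z) +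
      (u - z) * hilleSum ν τ u z = 0 := by
  have hH := tendsto_hillePoly hν hτ0 hτ1 z
  have key := ((tendsto_lagT_eval (ν := ν) (τ := τ) hH u).const_mul ((1 - τ ^ 2 : ℝ) : ℂ)).add
    ((hH.tendsto_at (Set.mem_univ u)).const_mul (u - z))
  have key2 : Tendsto (fun N => (hilleOp ν τ z (hillePoly ν τ z (N + 1))).eval u) atTop (𝓝 0) := by
    simp only [hilleOp_hillePoly hν, Polynomial.eval_sub, Polynomial.eval_mul, Polynomial.eval_C]
    have hR : 0 ≤ max ‖z‖ ‖u‖ := le_max_of_le_left (norm_nonneg _)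
    obtain ⟨C, hC⟩ := exists_norm_hilleTerm_le hν hτ0 hτ1 hR
    have hz : Tendsto (fun N : ℕ => C * (((N : ℝ) + 1) ^ 2 * ((1 + τ) / 2) ^ N)) atTop (𝓝 0) := by
      simpa using ((summable_add_one_pow_mul_geometric (by linarith : 0 < (1 + τ) / 2) (by linarith) 2).tendsto_atTop_zero).const_mul C
    have t1 : Tendsto (fun N : ℕ => ((N : ℂ) + 1) * ((hilleCoeff ν N : ℂ) *
        ((lag ν τ (N + 1)).eval z * (lag ν τ N).eval u))) atTop (𝓝 0) := by
      refine squeeze_zero_norm (fun N => ?_) hz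
      rw [norm_mul, show ((N : ℂ) + 1) = ((N + 1 : ℝ) : ℂ) by push_cast; rfl, Complex.norm_real,
        Real.norm_of_nonneg (by positivity)]
      calc _ ≤ ((N : ℝ) + 1) * (C * ((N + 1) * ((1 + τ) / 2) ^ N)) := by
            gcongr
            exact hC N (N + 1) N u z (by omega) le_rfl (le_max_right _ _) (le_max_left _ _)
        _ = _ := by ring
    have t2 : Tendsto (fun N : ℕ => ((N : ℂ) + 1) * ((hilleCoeff ν N : ℂ) *
        ((lag ν τ N).eval z * (lag ν τ (N + 1)).eval u))) atTop (𝓝 0) := by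
      refine squeeze_zero_norm (fun N => ?_) hz
      rw [norm_mul, show ((N : ℂ) + 1) = ((N + 1 : ℝ) : ℂ) by push_cast; rfl, Complex.norm_real,
        Real.norm_of_nonneg (by positivity)]
      calc _ ≤ ((N : ℝ) + 1) * (C * ((N + 1) * ((1 + τ) / 2) ^ N)) := by
            gcongr
            exact hC N N (N + 1) u z le_rfl (by omega) (le_max_right _ _) (le_max_left _ _)
        _ = _ := by ring
    have := t1.sub (t2.const_mul ((τ : ℂ) ^ 2))
    rw [mul_zero, sub_zero] at this
    refine this.congr fun N => ?_
    push_cast; ring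
  have := tendsto_nhds_unique (key.comp (tendsto_add_atTop_nat 1)) (key2.congr fun N => by
    simp only [hilleOp, Polynomial.eval_add, Polynomial.eval_mul, Polynomial.eval_sub,
      Polynomial.eval_C, Polynomial.eval_X, Function.comp_def])
  push_cast at this
  exact this

end limits

/-! ### The entire function `E` -/

/-- `∑ₙ xⁿ / (n! Γ(n + ν + 1))`. -/
noncomputable def besselE (ν : ℝ) (x : ℂ) : ℂ :=
  ∑' n : ℕ, x ^ n / ((n ! : ℂ) * ((Real.Gamma (n + ν + 1) : ℝ) : ℂ))

section besselE

variable {ν : ℝ}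

theorem exists_summable_besselE_bound (hν : -1 < ν) (R : ℝ) :
    ∃ b : ℕ → ℝ, Summable b ∧ ∀ (n : ℕ) (x : ℂ), ‖x‖ ≤ R →
      ‖x ^ n / ((n ! : ℂ) * ((Real.Gamma (n + ν + 1) : ℝ) : ℂ))‖ ≤ b n := by
  obtain ⟨A, hA0, hA⟩ := exists_hilleCoeff_le hν
  refine ⟨fun n => 2 * A * (R ^ n / n !), (Real.summable_pow_div_factorial R).mul_left _,
    fun n x hx => ?_⟩
  have hR : 0 ≤ R := (norm_nonneg _).trans hx
  have hΓ := gamma_nat_pos hν n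
  have hn : (0 : ℝ) < n ! := by positivity
  -- From n!/Γ(n+ν+1) ≤ A(n+1) and n+1 ≤ 2 n!.
  have h1 : (1 : ℝ) / Real.Gamma (n + ν + 1) ≤ 2 * A := by
    have h2 := hA n
    have h3 : ((n : ℝ) + 1) ≤ 2 * n ! := by
      have h4 := Nat.self_le_factorial n
      have h5 := Nat.factorial_pos n
      exact_mod_cast (by omega : n + 1 ≤ 2 * n !)
    have h4 : (n ! : ℝ) * (1 / Real.Gamma (n + ν + 1)) ≤ n ! * (2 * A) := by
      calc _ = hilleCoeff ν n := by rw [hilleCoeff]; ring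
        _ ≤ A * (n + 1) := h2
        _ ≤ A * (2 * n !) := by gcongr
        _ = _ := by ring
    exact le_of_mul_le_mul_left h4 hn
  rw [norm_div, norm_pow, norm_mul, Complex.norm_real, Real.norm_of_nonneg hΓ.le,
    Complex.norm_natCast]
  calc ‖x‖ ^ n / (n ! * Real.Gamma (n + ν + 1)) ≤ R ^ n / (n ! * Real.Gamma (n + ν + 1)) := by
        gcongr
    _ = (1 / Real.Gamma (n + ν + 1)) * (R ^ n / n !) := by field_simp
    _ ≤ 2 * A * (R ^ n / n !) := mul_le_mul_of_nonneg_right h1 (by positivity)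

theorem summable_besselE (hν : -1 < ν) (x : ℂ) :
    Summable fun n : ℕ => x ^ n / ((n ! : ℂ) * ((Real.Gamma (n + ν + 1) : ℝ) : ℂ)) := by
  obtain ⟨b, hb, h⟩ := exists_summable_besselE_bound hν ‖x‖
  exact hb.of_norm_bounded fun n => h n x le_rfl

theorem besselE_zero : besselE ν 0 = ((1 / Real.Gamma (ν + 1) : ℝ) : ℂ) := by
  rw [besselE, tsum_eq_single 0 fun n hn => by simp [hn]]
  simp

theorem hasDerivAt_besselE (hν : -1 < ν) (x : ℂ) :
    HasDerivAt (besselE ν) (besselE (ν + 1) x) x := by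
  obtain ⟨b, hb, h⟩ := exists_summable_besselE_bound hν (‖x‖ + 1)
  have hx : x ∈ Metric.ball (0 : ℂ) (‖x‖ + 1) := by simp
  have hF : ∀ n : ℕ, DifferentiableOn ℂ (fun x : ℂ => x ^ n / ((n ! : ℂ) *
      ((Real.Gamma (n + ν + 1) : ℝ) : ℂ))) (Metric.ball 0 (‖x‖ + 1)) := fun n => by fun_prop
  have hle : ∀ (n : ℕ) (w : ℂ), w ∈ Metric.ball (0 : ℂ) (‖x‖ + 1) →
      ‖w ^ n / ((n ! : ℂ) * ((Real.Gamma (n + ν + 1) : ℝ) : ℂ))‖ ≤ b n :=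
    fun n w hw => h n w (by simpa using (mem_ball_zero_iff.1 hw).le)
  have hd : DifferentiableAt ℂ (besselE ν) x :=
    (Complex.differentiableOn_tsum_of_summable_norm hb hF Metric.isOpen_ball hle).differentiableAt
      (Metric.isOpen_ball.mem_nhds hx)
  have hs := Complex.hasSum_deriv_of_summable_norm hb hF Metric.isOpen_ball hle hx
  convert! hd.hasDerivAt using 1
  refine (hs.tsum_eq.symm.trans ?_).symm
  rw [hs.summable.tsum_eq_zero_add]
  simp only [pow_zero, deriv_const, zero_add]
  refine tsum_congr fun n => ?_
  rw [deriv_div_const, deriv_pow_field, Nat.add_sub_cancel, Nat.factorial_succ,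
    show ((n + 1 : ℕ) : ℝ) + ν + 1 = n + (ν + 1) + 1 by push_cast; ring]
  have h1 : ((n : ℂ) + 1) ≠ 0 := by exact_mod_cast n.succ_ne_zero
  push_cast
  rw [mul_assoc, mul_div_mul_left _ _ h1]

/-- Comparison of coefficients through Γ(n+ν+2) = (n+ν+1) Γ(n+ν+1). As E' and E'' are E with ν
raised by one and two, this is the Bessel equation x E'' + (ν+1) E' = E. -/
theorem besselE_rec (hν : -1 < ν) (x : ℂ) :
    x * besselE (ν + 2) x + (ν + 1) * besselE (ν + 1) x = besselE ν x := by
  have s0 := summable_besselE hν x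
  have s1 := summable_besselE (by linarith : -1 < ν + 1) x
  have s2 := summable_besselE (by linarith : -1 < ν + 2) x
  have key : ∀ n : ℕ, x ^ n / ((n ! : ℂ) * ((Real.Gamma (n + ν + 1) : ℝ) : ℂ)) -
      (ν + 1) * (x ^ n / ((n ! : ℂ) * ((Real.Gamma (n + (ν + 1) + 1) : ℝ) : ℂ))) =
      n * (x ^ n / ((n ! : ℂ) * ((Real.Gamma (n + (ν + 1) + 1) : ℝ) : ℂ))) := by
    intro n
    have h1 := gamma_nat_succ hν n
    rw [show ((n + 1 : ℕ) : ℝ) + ν + 1 = n + (ν + 1) + 1 by push_cast; ring] at h1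
    have h2 : ((Real.Gamma (n + ν + 1) : ℝ) : ℂ) ≠ 0 := by
      exact_mod_cast (gamma_nat_pos hν n).ne'
    have h3 : (n : ℂ) + ν + 1 ≠ 0 := by
      have : (n : ℝ) + ν + 1 ≠ 0 := by
        have : (0 : ℝ) ≤ n := n.cast_nonneg
        linarith
      exact_mod_cast this
    have h4 : (n ! : ℂ) ≠ 0 := by exact_mod_cast n.factorial_ne_zero
    rw [h1]
    push_cast
    field_simp
    ring
  have e : besselE ν x - (ν + 1) * besselE (ν + 1) x = x * besselE (ν + 2) x := by
    rw [besselE, besselE, besselE, ← tsum_mul_left, ← s0.tsum_sub (s1.mul_left _),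
      tsum_congr key, ← tsum_mul_left]
    have hs : Summable fun n : ℕ =>
        (n : ℂ) * (x ^ n / ((n ! : ℂ) * ((Real.Gamma (n + (ν + 1) + 1) : ℝ) : ℂ))) :=
      (s0.sub (s1.mul_left ((ν : ℂ) + 1))).congr key
    rw [hs.tsum_eq_zero_add]
    simp only [CharP.cast_eq_zero, zero_mul, zero_add]
    refine tsum_congr fun n => ?_
    rw [Nat.factorial_succ, pow_succ',
      show ((n + 1 : ℕ) : ℝ) + (ν + 1) + 1 = n + (ν + 2) + 1 by push_cast; ring]
    have h1 : ((n : ℂ) + 1) ≠ 0 := by exact_mod_cast n.succ_ne_zero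
    push_cast
    rw [mul_assoc ((n : ℂ) + 1), ← mul_div_assoc, mul_div_mul_left _ _ h1, mul_div_assoc]
  linear_combination -e

theorem differentiable_besselE (hν : -1 < ν) : Differentiable ℂ (besselE ν) :=
  fun x => (hasDerivAt_besselE hν x).differentiableAt

theorem continuous_besselE (hν : -1 < ν) : Continuous (besselE ν) :=
  (differentiable_besselE hν).continuous

end besselE

/-! ### The limiting integral -/

/-- `∫₀^{π/2} sinh((z - u) cos α) sin^ν α E(z u sin² α) dα`. -/
noncomputable def skewIntegral (ν : ℝ) (z u : ℂ) : ℂ :=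
  ∫ α in (0 : ℝ)..(Real.pi / 2), ((Real.sin α ^ ν : ℝ) : ℂ) *
    (Complex.sinh ((z - u) * (Real.cos α : ℂ)) * besselE ν (z * (u * (Real.sin α : ℂ) ^ 2)))

theorem skewIntegral_antisymm (ν : ℝ) (z u : ℂ) :
    skewIntegral ν z u = -skewIntegral ν u z := by
  rw [skewIntegral, skewIntegral, ← intervalIntegral.integral_neg]
  refine intervalIntegral.integral_congr fun α _ => ?_
  rw [show (u - z) * (Real.cos α : ℂ) = -((z - u) * (Real.cos α : ℂ)) by ring, Complex.sinh_neg,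
    mul_left_comm u]
  ring

/-- Jordan's inequality sin α ≥ 2α/π controls the singularity at 0 for negative ν; for ν ≥ 0 the
bound 1 is enough. -/
theorem intervalIntegrable_sin_rpow {ν : ℝ} (hν : -1 < ν) :
    IntervalIntegrable (fun α => Real.sin α ^ ν) volume 0 (Real.pi / 2) := by
  have hpi := Real.pi_pos
  have h1 : IntervalIntegrable (fun α : ℝ => 1 + (2 / Real.pi) ^ ν * α ^ ν) volume 0
      (Real.pi / 2) :=
    intervalIntegrable_const.add ((intervalIntegral.intervalIntegrable_rpow' hν).const_mul _)
  refine h1.mono_fun' ?_ ?_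
  · exact (Real.measurable_sin.pow_const ν).aestronglyMeasurable
  · rw [Set.uIoc_of_le (by positivity)]
    refine (ae_restrict_mem measurableSet_Ioc).mono fun α hα => ?_
    have hs : 0 < 2 / Real.pi * α := mul_pos (by positivity) hα.1
    have hle : 2 / Real.pi * α ≤ Real.sin α := Real.mul_le_sin hα.1.le hα.2
    have hsin : 0 < Real.sin α := hs.trans_le hle
    dsimp only
    rw [Real.norm_of_nonneg (by positivity), ← Real.mul_rpow (by positivity) hα.1.le]
    rcases le_or_gt 0 ν with h | h
    · have := Real.rpow_le_one hsin.le (Real.sin_le_one α) h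
      have : 0 ≤ (2 / Real.pi * α) ^ ν := by positivity
      linarith
    · have := Real.rpow_le_rpow_of_nonpos hs hle h.le
      linarith

/-- The weight w may be singular: only its integrability is used, since the derivative of G is
bounded on a compact set and ‖w‖ times that bound dominates. -/
theorem hasDerivAt_integral_mul {w : ℝ → ℂ} {a b : ℝ} (hw : IntervalIntegrable w volume a b)
    {G G' : ℂ → ℝ → ℂ} (hG : Continuous fun p : ℂ × ℝ => G p.1 p.2)
    (hG' : Continuous fun p : ℂ × ℝ => G' p.1 p.2)
    (hd : ∀ z α, HasDerivAt (fun z => G z α) (G' z α) z) (z : ℂ) :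
    HasDerivAt (fun z => ∫ α in a..b, w α * G z α) (∫ α in a..b, w α * G' z α) z := by
  have hc : ∀ z, Continuous (G z) := fun z => hG.comp (Continuous.prodMk_right z)
  have hc' : ∀ z, Continuous (G' z) := fun z => hG'.comp (Continuous.prodMk_right z)
  have hK : IsCompact (Metric.closedBall z 1 ×ˢ Set.uIcc a b) :=
    (isCompact_closedBall z 1).prod isCompact_uIcc
  obtain ⟨C, hC⟩ := hK.exists_bound_of_continuousOn hG'.continuousOn
  have hi : ∀ z, IntervalIntegrable (fun α => w α * G z α) volume a b :=
    fun z => hw.mul_continuousOn (hc z).continuousOn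
  have hi' : ∀ z, IntervalIntegrable (fun α => w α * G' z α) volume a b :=
    fun z => hw.mul_continuousOn (hc' z).continuousOn
  refine (intervalIntegral.hasDerivAt_integral_of_dominated_loc_of_deriv_le
    (bound := fun α => ‖w α‖ * C) (F' := fun z α => w α * G' z α) (Metric.closedBall_mem_nhds z one_pos)
    (Eventually.of_forall fun z => (intervalIntegrable_iff.1 (hi z)).aestronglyMeasurable) (hi z)
    (intervalIntegrable_iff.1 (hi' z)).aestronglyMeasurable ?_ (hw.norm.mul_const C) ?_).2
  · refine Eventually.of_forall fun α hα x hx => ?_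
    rw [norm_mul]
    exact mul_le_mul_of_nonneg_left (hC (x, α) ⟨hx, Set.uIoc_subset_uIcc hα⟩) (norm_nonneg _)
  · exact Eventually.of_forall fun α _ x _ => (hd x α).const_mul _

/-- The derivative in `z` of the smooth part of the integrand of `skewIntegral`. -/
noncomputable def skewIntegrandDeriv (ν : ℝ) (u z : ℂ) (c s : ℂ) : ℂ :=
  Complex.cosh ((z - u) * c) * c * besselE ν (z * s) +
    Complex.sinh ((z - u) * c) * (besselE (ν + 1) (z * s) * s)

/-- The second derivative in `z` of the smooth part of the integrand of `skewIntegral`. -/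
noncomputable def skewIntegrandDerivTwo (ν : ℝ) (u z : ℂ) (c s : ℂ) : ℂ :=
  Complex.sinh ((z - u) * c) * c * c * besselE ν (z * s) +
    Complex.cosh ((z - u) * c) * c * (besselE (ν + 1) (z * s) * s) +
    (Complex.cosh ((z - u) * c) * c * (besselE (ν + 1) (z * s) * s) +
    Complex.sinh ((z - u) * c) * (besselE (ν + 2) (z * s) * s * s))

section skewIntegral

variable {ν : ℝ}

theorem hasDerivAt_besselE_mul (hν : -1 < ν) (s z : ℂ) :
    HasDerivAt (fun z => besselE ν (z * s)) (besselE (ν + 1) (z * s) * s) z := by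
  have h : HasDerivAt (fun z : ℂ => z * s) s z := by simpa using (hasDerivAt_id z).mul_const s
  exact HasDerivAt.comp (h₂ := besselE ν) z (hasDerivAt_besselE hν (z * s)) h

theorem hasDerivAt_skewIntegrand (hν : -1 < ν) (u z c s : ℂ) :
    HasDerivAt (fun z => Complex.sinh ((z - u) * c) * besselE ν (z * s))
      (skewIntegrandDeriv ν u z c s) z := by
  have h : HasDerivAt (fun z => (z - u) * c) c z := by
    simpa using ((hasDerivAt_id z).sub_const u).mul_const c
  exact h.csinh.mul (hasDerivAt_besselE_mul hν s z)

theorem hasDerivAt_skewIntegrandDeriv (hν : -1 < ν) (u z c s : ℂ) :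
    HasDerivAt (fun z => skewIntegrandDeriv ν u z c s) (skewIntegrandDerivTwo ν u z c s) z := by
  have h : HasDerivAt (fun z => (z - u) * c) c z := by
    simpa using ((hasDerivAt_id z).sub_const u).mul_const c
  have h1 := hasDerivAt_besselE_mul (by linarith : -1 < ν + 1) s z
  rw [show ν + 1 + 1 = ν + 2 by ring] at h1
  exact ((h.ccosh.mul_const c).mul (hasDerivAt_besselE_mul hν s z)).add
    (h.csinh.mul (h1.mul_const s))

theorem intervalIntegrable_sin_rpow_mul (hν : -1 < ν) {g : ℝ → ℂ} (hg : Continuous g) :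
    IntervalIntegrable (fun α => ((Real.sin α ^ ν : ℝ) : ℂ) * g α) volume 0 (Real.pi / 2) :=
  have h := intervalIntegrable_sin_rpow hν
  IntervalIntegrable.mul_continuousOn ⟨h.1.ofReal, h.2.ofReal⟩ hg.continuousOn

theorem continuous_skewIntegrand (hν : -1 < ν) (u : ℂ) : Continuous fun p : ℂ × ℝ =>
    Complex.sinh ((p.1 - u) * (Real.cos p.2 : ℂ)) *
      besselE ν (p.1 * (u * (Real.sin p.2 : ℂ) ^ 2)) := by
  have := continuous_besselE hν
  fun_prop

theorem continuous_skewIntegrandDeriv (hν : -1 < ν) (u : ℂ) : Continuous fun p : ℂ × ℝ =>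
    skewIntegrandDeriv ν u p.1 (Real.cos p.2) (u * (Real.sin p.2 : ℂ) ^ 2) := by
  have := continuous_besselE hν
  have := continuous_besselE (by linarith : -1 < ν + 1)
  unfold skewIntegrandDeriv
  fun_prop

theorem continuous_skewIntegrandDerivTwo (hν : -1 < ν) (u : ℂ) : Continuous fun p : ℂ × ℝ =>
    skewIntegrandDerivTwo ν u p.1 (Real.cos p.2) (u * (Real.sin p.2 : ℂ) ^ 2) := by
  have := continuous_besselE hν
  have := continuous_besselE (by linarith : -1 < ν + 1)
  have := continuous_besselE (by linarith : -1 < ν + 2)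
  unfold skewIntegrandDerivTwo
  fun_prop

theorem hasDerivAt_skewIntegral (hν : -1 < ν) (u z : ℂ) :
    HasDerivAt (fun z => skewIntegral ν z u)
      (∫ α in (0 : ℝ)..(Real.pi / 2), ((Real.sin α ^ ν : ℝ) : ℂ) *
        skewIntegrandDeriv ν u z (Real.cos α) (u * (Real.sin α : ℂ) ^ 2)) z :=
  have h := intervalIntegrable_sin_rpow hν
  hasDerivAt_integral_mul ⟨h.1.ofReal, h.2.ofReal⟩ (continuous_skewIntegrand hν u)
    (continuous_skewIntegrandDeriv hν u) (fun z _ => hasDerivAt_skewIntegrand hν u z _ _) z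

theorem deriv_deriv_skewIntegral (hν : -1 < ν) (u z : ℂ) :
    deriv (deriv fun z => skewIntegral ν z u) z =
      ∫ α in (0 : ℝ)..(Real.pi / 2), ((Real.sin α ^ ν : ℝ) : ℂ) *
        skewIntegrandDerivTwo ν u z (Real.cos α) (u * (Real.sin α : ℂ) ^ 2) := by
  have h := intervalIntegrable_sin_rpow hν
  rw [funext fun z => (hasDerivAt_skewIntegral hν u z).deriv]
  exact (hasDerivAt_integral_mul ⟨h.1.ofReal, h.2.ofReal⟩ (continuous_skewIntegrandDeriv hν u)
    (continuous_skewIntegrandDerivTwo hν u)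
    (fun z _ => hasDerivAt_skewIntegrandDeriv hν u z _ _) z).deriv

/-- The primitive whose boundary values give the differential equation of `skewIntegral`. -/
noncomputable def skewPrimitive (ν : ℝ) (z u : ℂ) (α : ℝ) : ℂ :=
  ((Real.sin α ^ (ν + 1) : ℝ) : ℂ) *
    (besselE ν (z * (u * (Real.sin α : ℂ) ^ 2)) * Complex.cosh ((z - u) * (Real.cos α : ℂ)))

/-- The integrand of z∂² + (ν+1)∂ − z applied to `skewIntegral` is an exact derivative in α. This
needs only the Bessel equation `besselE_rec` and cos² = 1 − sin². -/
theorem hasDerivAt_skewPrimitive (hν : -1 < ν) (z u : ℂ) {α : ℝ} (hsin : 0 < Real.sin α) :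
    HasDerivAt (skewPrimitive ν z u)
      (z * (((Real.sin α ^ ν : ℝ) : ℂ) *
        skewIntegrandDerivTwo ν u z (Real.cos α) (u * (Real.sin α : ℂ) ^ 2)) +
      (ν + 1) * (((Real.sin α ^ ν : ℝ) : ℂ) *
        skewIntegrandDeriv ν u z (Real.cos α) (u * (Real.sin α : ℂ) ^ 2)) -
      z * (((Real.sin α ^ ν : ℝ) : ℂ) * (Complex.sinh ((z - u) * (Real.cos α : ℂ)) *
        besselE ν (z * (u * (Real.sin α : ℂ) ^ 2))))) α := by
  have d1 : HasDerivAt (fun α => ((Real.sin α ^ (ν + 1) : ℝ) : ℂ))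
      (((Real.cos α * (ν + 1) * Real.sin α ^ ν : ℝ)) : ℂ) α := by
    have := (Real.hasDerivAt_sin α).rpow_const (p := ν + 1) (Or.inl hsin.ne')
    rw [add_sub_cancel_right] at this
    exact this.ofReal_comp
  have d2 : HasDerivAt (fun α : ℝ => (Real.sin α : ℂ)) (Real.cos α : ℂ) α :=
    (Real.hasDerivAt_sin α).ofReal_comp
  have d3 : HasDerivAt (fun α : ℝ => (Real.cos α : ℂ)) ((-Real.sin α : ℝ) : ℂ) α :=
    (Real.hasDerivAt_cos α).ofReal_comp
  have d4 : HasDerivAt (fun α : ℝ => z * (u * (Real.sin α : ℂ) ^ 2))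
      (z * (u * (2 * (Real.sin α : ℂ) * Real.cos α))) α := by
    convert! ((d2.pow 2).const_mul u).const_mul z using 1
    norm_num
  have d5 : HasDerivAt (fun α : ℝ => besselE ν (z * (u * (Real.sin α : ℂ) ^ 2)))
      (besselE (ν + 1) (z * (u * (Real.sin α : ℂ) ^ 2)) *
        (z * (u * (2 * (Real.sin α : ℂ) * Real.cos α)))) α :=
    HasDerivAt.comp (h₂ := besselE ν) α (hasDerivAt_besselE hν _) d4
  have d6 : HasDerivAt (fun α : ℝ => Complex.cosh ((z - u) * (Real.cos α : ℂ)))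
      (Complex.sinh ((z - u) * (Real.cos α : ℂ)) * ((z - u) * ((-Real.sin α : ℝ) : ℂ))) α :=
    HasDerivAt.comp (h₂ := Complex.cosh) α (Complex.hasDerivAt_cosh _) (d3.const_mul (z - u))
  have hrec := besselE_rec hν (z * (u * (Real.sin α : ℂ) ^ 2))
  have hpow : ((Real.sin α ^ (ν + 1) : ℝ) : ℂ) =
      ((Real.sin α ^ ν : ℝ) : ℂ) * (Real.sin α : ℂ) := by
    rw [Real.rpow_add_one hsin.ne']; push_cast; rfl
  have hcs : (Real.cos α : ℂ) ^ 2 = 1 - (Real.sin α : ℂ) ^ 2 := by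
    have := Real.cos_sq' α
    exact_mod_cast this
  convert! d1.mul (d5.mul d6) using 1
  simp only [skewIntegrandDeriv, skewIntegrandDerivTwo, hpow, Pi.mul_apply]
  rw [← hrec]
  generalize besselE (ν + 2) (z * (u * (Real.sin α : ℂ) ^ 2)) = E2
  generalize besselE (ν + 1) (z * (u * (Real.sin α : ℂ) ^ 2)) = E1
  generalize Complex.sinh ((z - u) * (Real.cos α : ℂ)) = sh
  generalize Complex.cosh ((z - u) * (Real.cos α : ℂ)) = ch
  simp only [Complex.ofReal_mul, Complex.ofReal_add, Complex.ofReal_neg, Complex.ofReal_one]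
  generalize ((Real.sin α ^ ν : ℝ) : ℂ) = w
  generalize (Real.cos α : ℂ) = C at *
  generalize (Real.sin α : ℂ) = S at *
  linear_combination (w * z * sh * (z * (u * S ^ 2) * E2 + (ν + 1) * E1)) * hcs

theorem skewIntegral_ode (hν : -1 < ν) (u z : ℂ) :
    z * deriv (deriv fun z => skewIntegral ν z u) z +
      (ν + 1) * deriv (fun z => skewIntegral ν z u) z - z * skewIntegral ν z u =
      besselE ν (z * u) := by
  have i0 := intervalIntegrable_sin_rpow_mul hν
    ((continuous_skewIntegrand hν u).comp (Continuous.prodMk_right z))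
  have i1 := intervalIntegrable_sin_rpow_mul hν
    ((continuous_skewIntegrandDeriv hν u).comp (Continuous.prodMk_right z))
  have i2 := intervalIntegrable_sin_rpow_mul hν
    ((continuous_skewIntegrandDerivTwo hν u).comp (Continuous.prodMk_right z))
  simp only [Function.comp_def] at i0 i1 i2
  have ii := ((i2.const_mul z).add (i1.const_mul ((ν : ℂ) + 1))).sub (i0.const_mul z)
  rw [deriv_deriv_skewIntegral hν, (hasDerivAt_skewIntegral hν u z).deriv, skewIntegral,
    ← intervalIntegral.integral_const_mul, ← intervalIntegral.integral_const_mul,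
    ← intervalIntegral.integral_const_mul, ← intervalIntegral.integral_add (i2.const_mul _)
    (i1.const_mul _), ← intervalIntegral.integral_sub ((i2.const_mul _).add (i1.const_mul _))
    (i0.const_mul _)]
  have hΦc : ContinuousOn (skewPrimitive ν z u) (Set.Icc 0 (Real.pi / 2)) := by
    have h1 : Continuous fun α => Real.sin α ^ (ν + 1) :=
      Real.continuous_sin.rpow_const fun _ => Or.inr (by linarith)
    have h2 := continuous_besselE hν
    exact Continuous.continuousOn (by unfold skewPrimitive; fun_prop)
  -- At α = 0 the factor sin^{ν+1} vanishes because ν + 1 > 0; at π/2 the cosine vanishes and only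
  -- E(zu) remains.
  have hΦ0 : skewPrimitive ν z u 0 = 0 := by
    simp [skewPrimitive, Real.zero_rpow (by linarith : ν + 1 ≠ 0)]
  have hΦ1 : skewPrimitive ν z u (Real.pi / 2) = besselE ν (z * u) := by
    simp [skewPrimitive]
  rw [← hΦ1, ← sub_zero (skewPrimitive ν z u (Real.pi / 2)), ← hΦ0]
  exact intervalIntegral.integral_eq_sub_of_hasDerivAt_of_le (by positivity) hΦc
    (fun α hα => hasDerivAt_skewPrimitive hν z u
      (Real.sin_pos_of_pos_of_lt_pi hα.1 (by linarith [hα.2, Real.pi_pos]))) ii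

theorem differentiable_skewIntegral (hν : -1 < ν) (u : ℂ) :
    Differentiable ℂ fun z => skewIntegral ν z u :=
  fun z => (hasDerivAt_skewIntegral hν u z).differentiableAt

end skewIntegral

/-! ### Closed forms -/

theorem eq_of_ode {ν : ℝ} (hν : -1 < ν) {f g r : ℂ → ℂ} (hf : Differentiable ℂ f)
    (hg : Differentiable ℂ g) {a b : ℂ}
    (hodef : ∀ z, z * deriv (deriv f) z + (ν + 1) * deriv f z = (a * z + b) * f z + r z)
    (hodeg : ∀ z, z * deriv (deriv g) z + (ν + 1) * deriv g z = (a * z + b) * g z + r z)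
    (h0 : f 0 = g 0) (z : ℂ) : f z = g z := by
  have hd : deriv (fun z => f z - g z) = fun z => deriv f z - deriv g z :=
    funext fun z => deriv_fun_sub (hf z) (hg z)
  have hd2 : deriv (fun z => deriv f z - deriv g z) = fun z => deriv (deriv f) z - deriv (deriv g) z :=
    funext fun z => deriv_fun_sub (hf.deriv z) (hg.deriv z)
  refine sub_eq_zero.1 (eq_zero_of_ode (a := a) (b := b) hν (f := fun z => f z - g z)
    (hf.sub hg) (fun z => ?_) (by simp [h0]) z)
  rw [hd, hd2]
  linear_combination hodef z - hodeg z

theorem hasDerivAt_exp_mul_comp {F : ℂ → ℂ} (hF : Differentiable ℂ F) (t c ζ : ℂ) :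
    HasDerivAt (fun ζ => Complex.exp (t * ζ) * F (c * ζ))
      (Complex.exp (t * ζ) * (t * F (c * ζ) + c * deriv F (c * ζ))) ζ := by
  have h1 : HasDerivAt (fun ζ => Complex.exp (t * ζ)) (Complex.exp (t * ζ) * t) ζ := by
    simpa using ((hasDerivAt_id ζ).const_mul t).cexp
  have h2 : HasDerivAt (fun ζ => F (c * ζ)) (deriv F (c * ζ) * c) ζ :=
    HasDerivAt.comp (h₂ := F) ζ (hF _).hasDerivAt (by simpa using (hasDerivAt_id ζ).const_mul c)
  convert! h1.mul h2 using 1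
  ring

/-- Conjugation of the second order operator by `exp(τ ζ)`. -/
theorem exp_mul_comp_ode {F : ℂ → ℂ} (hF : Differentiable ℂ F) (ν τ ζ : ℂ) :
    ζ * deriv (deriv fun ζ => Complex.exp (τ * ζ) * F ((1 - τ ^ 2) * ζ)) ζ +
      (ν + 1) * deriv (fun ζ => Complex.exp (τ * ζ) * F ((1 - τ ^ 2) * ζ)) ζ =
    ζ * (Complex.exp (τ * ζ) * F ((1 - τ ^ 2) * ζ)) + Complex.exp (τ * ζ) *
      ((1 - τ ^ 2) * (((1 - τ ^ 2) * ζ) * deriv (deriv F) ((1 - τ ^ 2) * ζ) +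
        (ν + 1) * deriv F ((1 - τ ^ 2) * ζ)) +
        2 * τ * (((1 - τ ^ 2) * ζ) * deriv F ((1 - τ ^ 2) * ζ)) +
        (τ * (ν + 1) - (1 - τ ^ 2) * ζ) * F ((1 - τ ^ 2) * ζ)) := by
  have h0 : (deriv fun ζ => Complex.exp (τ * ζ) * F ((1 - τ ^ 2) * ζ)) = fun ζ =>
      Complex.exp (τ * ζ) * (τ * F ((1 - τ ^ 2) * ζ) + (1 - τ ^ 2) * deriv F ((1 - τ ^ 2) * ζ)) :=
    funext fun ζ => (hasDerivAt_exp_mul_comp hF τ (1 - τ ^ 2) ζ).deriv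
  rw [h0]
  have h1 := hasDerivAt_exp_mul_comp hF τ (1 - τ ^ 2) ζ
  have h2 := hasDerivAt_exp_mul_comp hF.deriv τ (1 - τ ^ 2) ζ
  have h3 : HasDerivAt (fun ζ => Complex.exp (τ * ζ) * (τ * F ((1 - τ ^ 2) * ζ) +
      (1 - τ ^ 2) * deriv F ((1 - τ ^ 2) * ζ))) _ ζ :=
    ((h1.const_mul τ).add (h2.const_mul (1 - τ ^ 2))).congr_of_eventuallyEq
      (Eventually.of_forall fun ζ => by simp only [Pi.add_apply]; ring)
  rw [h3.deriv]
  ring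

section closedForms

variable {ν τ : ℝ}

theorem differentiable_hilleSum (hν : -1 < ν) (hτ0 : 0 < τ) (hτ1 : τ < 1) (u : ℂ) :
    Differentiable ℂ fun z => hilleSum ν τ z u :=
  (tendsto_derivative_eval (tendsto_hillePoly hν hτ0 hτ1 u)).1

theorem differentiable_skewSum (hν : -1 < ν) (hτ0 : 0 < τ) (hτ1 : τ < 1) (u : ℂ) :
    Differentiable ℂ fun z => skewSum ν τ z u :=
  (tendsto_derivative_eval (tendsto_skewPoly hν hτ0 hτ1 u)).1

theorem besselE_mul_ode (hν : -1 < ν) (s z : ℂ) :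
    z * deriv (deriv fun z => besselE ν (z * s)) z +
      (ν + 1) * deriv (fun z => besselE ν (z * s)) z = s * besselE ν (z * s) := by
  have hν1 : -1 < ν + 1 := by linarith
  rw [funext fun z => (hasDerivAt_besselE_mul hν s z).deriv,
    ((hasDerivAt_besselE_mul hν1 s z).mul_const s).deriv, show ν + 1 + 1 = ν + 2 by ring,
    ← besselE_rec hν]
  ring

theorem one_sub_sq_ne_zero (hτ0 : 0 < τ) (hτ1 : τ < 1) : (1 - (τ : ℂ) ^ 2) ≠ 0 := by
  have : 1 - τ ^ 2 ≠ 0 := by nlinarith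
  exact_mod_cast this

theorem gamma_mul_besselE_zero (hν : -1 < ν) :
    ((Real.Gamma (ν + 1) : ℝ) : ℂ) * besselE ν 0 = 1 := by
  have h : Real.Gamma (ν + 1) ≠ 0 := (Real.Gamma_pos_of_pos (by linarith)).ne'
  rw [besselE_zero, ← Complex.ofReal_mul, mul_one_div_cancel h, Complex.ofReal_one]

/-- As functions of η, the left side and E(ηζ) both solve z f'' + (ν+1) f' = ζ f, so they are
proportional; the factor is read off at η = 0. -/
theorem hilleSum_eq_mul_besselE (hν : -1 < ν) (hτ0 : 0 < τ) (hτ1 : τ < 1) (ζ η : ℂ) :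
    Complex.exp (τ * η) * hilleSum ν τ ((1 - τ ^ 2) * η) ((1 - τ ^ 2) * ζ) =
      ((Real.Gamma (ν + 1) : ℝ) : ℂ) * hilleSum ν τ 0 ((1 - τ ^ 2) * ζ) * besselE ν (η * ζ) := by
  have hc := one_sub_sq_ne_zero hτ0 hτ1
  have hF := differentiable_hilleSum hν hτ0 hτ1 ((1 - τ ^ 2) * ζ)
  have hE : Differentiable ℂ fun z => besselE ν (z * ζ) :=
    fun z => (hasDerivAt_besselE_mul hν ζ z).differentiableAt
  refine eq_of_ode hν (a := 0) (b := ζ) (r := fun _ => 0)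
    (f := fun η => Complex.exp (τ * η) * hilleSum ν τ ((1 - τ ^ 2) * η) ((1 - τ ^ 2) * ζ))
    (g := fun η => ((Real.Gamma (ν + 1) : ℝ) : ℂ) * hilleSum ν τ 0 ((1 - τ ^ 2) * ζ) *
      besselE ν (η * ζ))
    (fun z => (hasDerivAt_exp_mul_comp hF τ (1 - τ ^ 2) z).differentiableAt)
    (hE.const_mul _) (fun z => ?_) (fun z => ?_) ?_ η
  · rw [exp_mul_comp_ode hF]
    have h := hilleSum_ode hν hτ0 hτ1 ((1 - τ ^ 2) * ζ) ((1 - τ ^ 2) * z)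
    apply mul_left_cancel₀ hc
    linear_combination Complex.exp (τ * z) * h
  · have h1 : (deriv fun z => ((Real.Gamma (ν + 1) : ℝ) : ℂ) *
        hilleSum ν τ 0 ((1 - τ ^ 2) * ζ) * besselE ν (z * ζ)) = fun z =>
        ((Real.Gamma (ν + 1) : ℝ) : ℂ) * hilleSum ν τ 0 ((1 - τ ^ 2) * ζ) *
          deriv (fun z => besselE ν (z * ζ)) z := funext fun z => deriv_const_mul _ (hE z)
    rw [h1, deriv_const_mul _ (hE.deriv z)]
    linear_combination ((Real.Gamma (ν + 1) : ℝ) : ℂ) * hilleSum ν τ 0 ((1 - τ ^ 2) * ζ) *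
      besselE_mul_ode hν ζ z
  · simp only [mul_zero, Complex.exp_zero, one_mul, zero_mul]
    linear_combination -hilleSum ν τ 0 ((1 - τ ^ 2) * ζ) * gamma_mul_besselE_zero hν

/-- Translates the generalised binomial coefficients of the binomial series into Gamma quotients. -/
theorem ringChoose_add_nat (hν : -1 < ν) (n : ℕ) :
    Ring.choose (ν + 1 + n - 1) n = Real.Gamma (n + ν + 1) / (n ! * Real.Gamma (ν + 1)) := by
  have h1 : ∀ n : ℕ, (ascPochhammer ℝ n).eval (ν + 1) * Real.Gamma (ν + 1) =
      Real.Gamma (n + ν + 1) := by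
    intro n
    induction n with
    | zero => simp
    | succ n ih =>
      rw [ascPochhammer_succ_eval, gamma_nat_succ hν, ← ih]; ring
  have h2 := Ring.descPochhammer_eq_factorial_smul_choose (ν + 1 + n - 1) n
  rw [Polynomial.descPochhammer_smeval_eq_ascPochhammer, Polynomial.ascPochhammer_smeval_eq_eval,
    show ν + 1 + n - 1 - n + 1 = ν + 1 by ring, nsmul_eq_mul] at h2
  have h3 : Real.Gamma (ν + 1) ≠ 0 := (Real.Gamma_pos_of_pos (by linarith)).ne'
  rw [← h1, h2]
  field_simp

/-- At the origin the series is the binomial series of (1 − x)^{−ν−1} at x = τ². -/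
theorem hilleSum_zero_zero (hν : -1 < ν) (hτ0 : 0 < τ) (hτ1 : τ < 1) :
    ((Real.Gamma (ν + 1) : ℝ) : ℂ) * hilleSum ν τ 0 0 = (((1 - τ ^ 2) ^ (-ν - 1) : ℝ) : ℂ) := by
  have h3 : Real.Gamma (ν + 1) ≠ 0 := (Real.Gamma_pos_of_pos (by linarith)).ne'
  have hx : τ ^ 2 ∈ Metric.eball (0 : ℝ) 1 := by
    rw [← ENNReal.ofReal_one, Metric.eball_ofReal, mem_ball_zero_iff,
      Real.norm_of_nonneg (by positivity)]
    nlinarith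
  have h := (Real.one_div_one_sub_rpow_hasFPowerSeriesOnBall_zero (ν + 1)).hasSum hx
  have h' := h.tsum_eq
  simp only [FormalMultilinearSeries.ofScalars_apply_eq, zero_add, smul_eq_mul,
    ringChoose_add_nat hν] at h'
  rw [show -ν - 1 = -(ν + 1) by ring, Real.rpow_neg (by nlinarith), ← one_div, ← h',
    hilleSum, ← tsum_mul_left, Complex.ofReal_tsum]
  refine tsum_congr fun n => ?_
  rw [eval_zero_lag, ← Complex.ofReal_mul, ← Complex.ofReal_mul, ← Complex.ofReal_mul, hilleCoeff]
  congr 1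
  have h4 := (gamma_nat_pos hν n).ne'
  rw [← pow_mul, mul_comm 2 n, pow_mul]
  field_simp

/-- The Hardy–Hille formula. -/
theorem hilleSum_eq (hν : -1 < ν) (hτ0 : 0 < τ) (hτ1 : τ < 1) (ζ η : ℂ) :
    Complex.exp (τ * ζ) * (Complex.exp (τ * η) *
      hilleSum ν τ ((1 - τ ^ 2) * ζ) ((1 - τ ^ 2) * η)) =
      (((1 - τ ^ 2) ^ (-ν - 1) : ℝ) : ℂ) * besselE ν (ζ * η) := by
  -- Proportionality in one variable and then, by symmetry of the series, in the other reduces the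
  -- unknown factor to the value at the origin.
  have h1 := hilleSum_eq_mul_besselE hν hτ0 hτ1 η ζ
  have h2 := hilleSum_eq_mul_besselE hν hτ0 hτ1 0 η
  rw [mul_zero, mul_zero, hilleSum_comm, hilleSum_zero_zero hν hτ0 hτ1] at h2
  linear_combination Complex.exp (τ * η) * h1 +
    ((Real.Gamma (ν + 1) : ℝ) : ℂ) * besselE ν (ζ * η) * h2 +
    (((1 - τ ^ 2) ^ (-ν - 1) : ℝ) : ℂ) * besselE ν (ζ * η) * gamma_mul_besselE_zero hν

/-- Both sides solve z f'' + (ν+1) f' = z f + K E(zη) in the first variable: the left by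
`skewSum_ode` and the Hardy–Hille formula, the right by `skewIntegral_ode`. Only the initial value
has to be matched. -/
theorem skewSum_eq (hν : -1 < ν) (hτ0 : 0 < τ) (hτ1 : τ < 1) (ζ η : ℂ) :
    Complex.exp (τ * ζ) * (Complex.exp (τ * η) *
      skewSum ν τ ((1 - τ ^ 2) * ζ) ((1 - τ ^ 2) * η)) =
      -((((2 : ℝ) ^ (ν + 1) * (1 - τ ^ 2) ^ (-ν - 1) : ℝ) : ℂ)) * skewIntegral ν ζ η := by
  set K : ℂ := -((((2 : ℝ) ^ (ν + 1) * (1 - τ ^ 2) ^ (-ν - 1) : ℝ) : ℂ)) with hK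
  let f : ℂ → ℂ → ℂ := fun η ζ => Complex.exp (τ * η) * (Complex.exp (τ * ζ) *
      skewSum ν τ ((1 - τ ^ 2) * ζ) ((1 - τ ^ 2) * η))
  let g : ℂ → ℂ → ℂ := fun η ζ => K * skewIntegral ν ζ η
  have hF := fun η => differentiable_skewSum hν hτ0 hτ1 ((1 - τ ^ 2) * η)
  have hf' : ∀ η, Differentiable ℂ fun ζ => Complex.exp (τ * ζ) *
      skewSum ν τ ((1 - τ ^ 2) * ζ) ((1 - τ ^ 2) * η) := fun η ζ =>
    (hasDerivAt_exp_mul_comp (hF η) τ (1 - τ ^ 2) ζ).differentiableAt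
  have hf : ∀ η, Differentiable ℂ (f η) := fun η => (hf' η).const_mul _
  have hg' := differentiable_skewIntegral hν
  have hg : ∀ η, Differentiable ℂ (g η) := fun η => (hg' η).const_mul _
  have hodef : ∀ η ζ, ζ * deriv (deriv (f η)) ζ + (ν + 1) * deriv (f η) ζ =
      (1 * ζ + 0) * f η ζ + K * besselE ν (ζ * η) := by
    intro η ζ
    have h1 : deriv (f η) = fun ζ => Complex.exp (τ * η) * deriv (fun ζ => Complex.exp (τ * ζ) *
      skewSum ν τ ((1 - τ ^ 2) * ζ) ((1 - τ ^ 2) * η)) ζ := funext fun z =>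
      deriv_const_mul _ (hf' η z)
    rw [h1, deriv_const_mul _ ((hf' η).deriv ζ)]
    have h2 := exp_mul_comp_ode (hF η) ν τ ζ
    have h3 := skewSum_ode hν hτ0 hτ1 ((1 - τ ^ 2) * η) ((1 - τ ^ 2) * ζ)
    have h4 := hilleSum_eq hν hτ0 hτ1 ζ η
    simp only [f, hK, Complex.ofReal_mul]
    linear_combination Complex.exp (τ * η) * h2 +
      Complex.exp (τ * η) * Complex.exp (τ * ζ) * h3 - (((2 : ℝ) ^ (ν + 1) : ℝ) : ℂ) * h4
  have hodeg : ∀ η ζ, ζ * deriv (deriv (g η)) ζ + (ν + 1) * deriv (g η) ζ =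
      (1 * ζ + 0) * g η ζ + K * besselE ν (ζ * η) := by
    intro η ζ
    have h1 : deriv (g η) = fun ζ => K * deriv (fun ζ => skewIntegral ν ζ η) ζ :=
      funext fun z => deriv_const_mul _ (hg' η z)
    rw [h1, deriv_const_mul _ ((hg' η).deriv ζ)]
    simp only [g]
    linear_combination K * skewIntegral_ode hν η ζ
  have hfa : ∀ η ζ, f η ζ = -f ζ η := fun η ζ => by
    simp only [f]
    rw [skewSum_antisymm]
    ring
  have hga : ∀ η ζ, g η ζ = -g ζ η := fun η ζ => by
    simp only [g]
    rw [skewIntegral_antisymm]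
    ring
  -- Antisymmetry forces the value 0 at the origin, hence agreement on the slice η = 0; antisymmetry
  -- again converts this into equal initial values at ζ = 0 for every η.
  have hf00 : f 0 0 = 0 := by have := hfa 0 0; exact self_eq_neg.1 this
  have hg00 : g 0 0 = 0 := by have := hga 0 0; exact self_eq_neg.1 this
  have h0 : ∀ ζ, f 0 ζ = g 0 ζ :=
    eq_of_ode hν (hf 0) (hg 0) (hodef 0) (hodeg 0) (hf00.trans hg00.symm)
  have h1 := eq_of_ode hν (hf η) (hg η) (hodef η) (hodeg η) (by rw [hfa, hga, h0]) ζ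
  simp only [f, g] at h1
  rw [← h1]
  ring

end closedForms

/-! ### The limiting kernels -/

/-- A positive factor r does not change the argument of s, so the principal power of s r splits and
the multivalued part s^ν separates from the entire function E. -/
theorem besselI_two_mul (ν : ℝ) {s : ℂ} (hs : s ≠ 0) {r : ℝ} (hr : 0 < r) :
    besselI ν (2 * s * r) = s ^ (ν : ℂ) * (((r ^ ν : ℝ) : ℂ) * besselE ν (s ^ 2 * (r : ℂ) ^ 2)) := by
  have h1 : 2 * s * r / 2 = s * r := by ring
  have hr' : (r : ℂ) ≠ 0 := by exact_mod_cast hr.ne'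
  rw [besselI, h1, Complex.cpow_def_of_ne_zero (mul_ne_zero hs hr'), Complex.log_mul_ofReal r hr s hs,
    add_mul, Complex.exp_add, Complex.ofReal_cpow hr.le, Complex.cpow_def_of_ne_zero hs,
    Complex.cpow_def_of_ne_zero hr', Complex.ofReal_log hr.le, besselE]
  simp only [pow_mul, mul_pow]
  ring

theorem ginibreIntegral_eq (ν : ℝ) {s z u : ℂ} (hs : s ≠ 0) (hzu : s ^ 2 = z * u) :
    ginibreIntegral ν s z u =
      ((1 / Real.pi * √(besselK ν (2 * ‖z‖) * besselK ν (2 * ‖u‖)) : ℝ) : ℂ) *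
        (s ^ (ν : ℂ) * skewIntegral ν z u) := by
  rw [ginibreIntegral, skewIntegral]
  congr 1
  rw [← intervalIntegral.integral_const_mul]
  have hpi : 0 ≤ Real.pi / 2 := by positivity
  rw [intervalIntegral.integral_of_le hpi, intervalIntegral.integral_of_le hpi]
  refine setIntegral_congr_fun measurableSet_Ioc fun α hα => ?_
  obtain ⟨hα0, hα1⟩ : 0 < α ∧ α ≤ Real.pi / 2 := hα
  have hsin : 0 < Real.sin α := Real.sin_pos_of_pos_of_lt_pi hα0 (by linarith [Real.pi_pos])
  rw [besselI_two_mul ν hs hsin, hzu, mul_assoc z u]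
  ring

theorem csqrt_ne_zero {z : ℂ} (hz : z ≠ 0) : csqrt z ≠ 0 := by
  rw [csqrt, Complex.cpow_def_of_ne_zero hz]
  exact Complex.exp_ne_zero _

theorem csqrt_sq (z : ℂ) : csqrt z ^ 2 = z := by
  have := Complex.cpow_nat_inv_pow z two_ne_zero
  rw [csqrt, one_div]
  exact_mod_cast this

theorem csqrt_cpow (ν : ℝ) (z : ℂ) : csqrt z ^ (ν : ℂ) = z ^ ((ν / 2 : ℝ) : ℂ) := by
  have him : (Complex.log z * (1 / 2)).im = z.arg / 2 := by
    rw [show (1 / 2 : ℂ) = ((1 / 2 : ℝ) : ℂ) by push_cast; rfl, Complex.im_mul_ofReal,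
      Complex.log_im]
    ring
  have hpi := Real.pi_pos
  have h1 := Complex.neg_pi_lt_arg z
  have h2 := Complex.arg_le_pi z
  rw [csqrt, ← Complex.cpow_mul _ (by rw [him]; linarith) (by rw [him]; linarith)]
  congr 1
  push_cast
  ring

/-- (arg z + arg u)/2 lies in (−π, π], so the principal logarithm of √z √u is half the sum of the
two logarithms. The phases remove the arguments and leave the moduli. -/
theorem csqrt_mul_csqrt_cpow (ν : ℝ) {z u : ℂ} (hz : z ≠ 0) (hu : u ≠ 0) :
    phaseCocycle ν z * phaseCocycle ν u * (csqrt z * csqrt u) ^ (ν : ℂ) =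
      ((‖z * u‖ ^ (ν / 2) : ℝ) : ℂ) := by
  have hpi := Real.pi_pos
  have h1 := Complex.neg_pi_lt_arg z
  have h2 := Complex.arg_le_pi z
  have h3 := Complex.neg_pi_lt_arg u
  have h4 := Complex.arg_le_pi u
  have him : (Complex.log z * (1 / 2) + Complex.log u * (1 / 2)).im = (z.arg + u.arg) / 2 := by
    rw [show (1 / 2 : ℂ) = ((1 / 2 : ℝ) : ℂ) by push_cast; rfl, Complex.add_im,
      Complex.im_mul_ofReal, Complex.im_mul_ofReal, Complex.log_im, Complex.log_im]
    ring
  have hne : csqrt z * csqrt u ≠ 0 := mul_ne_zero (csqrt_ne_zero hz) (csqrt_ne_zero hu)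
  rw [Complex.cpow_def_of_ne_zero hne, csqrt, csqrt, Complex.cpow_def_of_ne_zero hz,
    Complex.cpow_def_of_ne_zero hu, ← Complex.exp_add,
    Complex.log_exp (by rw [him]; linarith) (by rw [him]; linarith), phaseCocycle, phaseCocycle,
    ← Complex.exp_add, ← Complex.exp_add, norm_mul, Real.mul_rpow (norm_nonneg _) (norm_nonneg _),
    Real.rpow_def_of_pos (norm_pos_iff.2 hz), Real.rpow_def_of_pos (norm_pos_iff.2 hu),
    ← Real.exp_add, Complex.ofReal_exp]
  congr 1
  rw [Complex.log, Complex.log]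
  push_cast
  ring

/-- The power of zu in the phase cancels the multivalued factor of the Bessel function, which leaves
an expression without any choice of branch. -/
theorem ginibreLimit_eq (ν : ℝ) {z u : ℂ} (hz : z ≠ 0) (hu : u ≠ 0) :
    ginibreLimit ν z u = ((1 / Real.pi * √(besselK ν (2 * ‖z‖) * besselK ν (2 * ‖u‖)) : ℝ) : ℂ) *
      (((‖z * u‖ ^ (ν / 2) : ℝ) : ℂ) * skewIntegral ν z u) := by
  have h0 := mul_ne_zero hz hu
  have hne : (z * u) ^ ((ν / 2 : ℝ) : ℂ) ≠ 0 := by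
    rw [Complex.cpow_def_of_ne_zero h0]; exact Complex.exp_ne_zero _
  rw [ginibreLimit, ginibreIntegral_eq ν (csqrt_ne_zero h0) (csqrt_sq _), csqrt_cpow]
  field_simp

theorem phaseCocycle_mul_ginibreKernel (ν : ℝ) {z u : ℂ} (hz : z ≠ 0) (hu : u ≠ 0) :
    phaseCocycle ν z * phaseCocycle ν u * ginibreKernel ν z u = ginibreLimit ν z u := by
  rw [ginibreLimit_eq ν hz hu, ginibreKernel,
    ginibreIntegral_eq ν (mul_ne_zero (csqrt_ne_zero hz) (csqrt_ne_zero hu))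
      (by rw [mul_pow, csqrt_sq, csqrt_sq]), ← csqrt_mul_csqrt_cpow ν hz hu]
  ring

theorem tauCocycle_isCocycleOn (τ : ℝ) : IsCocycleOn Set.univ (tauCocycle τ) := by
  refine ⟨Continuous.continuousOn ?_, fun z _ => ?_, fun z _ => ?_⟩
  · unfold tauCocycle
    fun_prop
  · rw [tauCocycle, Complex.norm_exp]
    simp
  · rw [tauCocycle, tauCocycle, ← Complex.exp_neg]
    congr 1
    simp

/-- On the negative axis arg z̄ = arg z = π instead of arg z̄ = −arg z, hence the restriction to the
slit plane. -/
theorem phaseCocycle_isCocycleOn (ν : ℝ) : IsCocycleOn Complex.slitPlane (phaseCocycle ν) := by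
  refine ⟨fun z hz => ContinuousAt.continuousWithinAt ?_, fun z _ => ?_, fun z hz => ?_⟩
  · unfold phaseCocycle
    have h := Complex.continuousAt_arg hz
    have h' : ContinuousAt (fun z : ℂ => (z.arg : ℂ)) z :=
      Complex.continuous_ofReal.continuousAt.comp h
    exact (continuousAt_const.mul h').cexp
  · rw [phaseCocycle, show -Complex.I * (ν / 2) * z.arg = ((-(ν / 2) * z.arg : ℝ) : ℂ) * Complex.I by
      push_cast; ring]
    exact Complex.norm_exp_ofReal_mul_I _
  · rw [phaseCocycle, phaseCocycle, ← Complex.exp_neg, Complex.arg_conj,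
      if_neg (Complex.mem_slitPlane_iff_arg.1 hz).1]
    congr 1
    push_cast
    ring

theorem exp_mul_ginibreLimit (ν τ : ℝ) {z u : ℂ} (hz : z ≠ 0) (hu : u ≠ 0) :
    Complex.exp (-Complex.I * τ * (z + u).im) * ginibreLimit ν z u =
      (tauCocycle τ z * tauCocycle τ u) * (phaseCocycle ν z * phaseCocycle ν u) *
        ginibreKernel ν z u := by
  rw [mul_assoc (tauCocycle τ z * tauCocycle τ u), phaseCocycle_mul_ginibreKernel ν hz hu, tauCocycle, tauCocycle, ← Complex.exp_add]
  congr 2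
  rw [Complex.add_im]
  push_cast
  ring

/-! ### Convergence of the rescaled kernel -/

theorem besselK_nonneg (ν x : ℝ) : 0 ≤ besselK ν x :=
  integral_nonneg fun t => by
    have := Real.cosh_pos (ν * t)
    positivity

theorem weight_nonneg (ν τ : ℝ) (z : ℂ) : 0 ≤ weight ν τ z := by
  have := besselK_nonneg ν (2 / (1 - τ ^ 2) * ‖z‖)
  rw [weight]
  positivity

theorem weight_conj (ν τ : ℝ) (z : ℂ) : weight ν τ (conj z) = weight ν τ z := by
  simp [weight]

section scaling

variable {ν τ : ℝ}

theorem weight_scale (hτ0 : 0 < τ) (hτ1 : τ < 1) (z : ℂ) :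
    weight ν τ ((1 - τ ^ 2 : ℝ) * z) =
      (1 - τ ^ 2) ^ ν * ‖z‖ ^ ν * besselK ν (2 * ‖z‖) * Real.exp (τ * z.re) ^ 2 := by
  have hc : 0 < 1 - τ ^ 2 := by nlinarith
  have h1 : ‖((1 - τ ^ 2 : ℝ) : ℂ) * z‖ = (1 - τ ^ 2) * ‖z‖ := by
    rw [norm_mul, Complex.norm_real, Real.norm_of_nonneg hc.le]
  rw [weight, h1, Real.mul_rpow hc.le (norm_nonneg _), Complex.re_ofReal_mul, ← Real.exp_nat_mul,
    show 2 / (1 - τ ^ 2) * ((1 - τ ^ 2) * ‖z‖) = 2 * ‖z‖ by field_simp]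
  congr 2
  push_cast
  field_simp

theorem sqrt_weight_mul_weight (hτ0 : 0 < τ) (hτ1 : τ < 1) (z u : ℂ) :
    √(weight ν τ ((1 - τ ^ 2 : ℝ) * z) * weight ν τ ((1 - τ ^ 2 : ℝ) * u)) =
      (1 - τ ^ 2) ^ ν * ‖z * u‖ ^ (ν / 2) * √(besselK ν (2 * ‖z‖) * besselK ν (2 * ‖u‖)) *
        (Real.exp (τ * z.re) * Real.exp (τ * u.re)) := by
  have hc : 0 < 1 - τ ^ 2 := by nlinarith
  have hK := mul_nonneg (besselK_nonneg ν (2 * ‖z‖)) (besselK_nonneg ν (2 * ‖u‖))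
  have h1 : (‖z * u‖ ^ (ν / 2)) ^ 2 = ‖z‖ ^ ν * ‖u‖ ^ ν := by
    rw [← Real.rpow_natCast, ← Real.rpow_mul (norm_nonneg _), norm_mul,
      Real.mul_rpow (norm_nonneg _) (norm_nonneg _)]
    norm_num
  have h2 : weight ν τ ((1 - τ ^ 2 : ℝ) * z) * weight ν τ ((1 - τ ^ 2 : ℝ) * u) =
      ((1 - τ ^ 2) ^ ν * ‖z * u‖ ^ (ν / 2) * √(besselK ν (2 * ‖z‖) * besselK ν (2 * ‖u‖)) *
        (Real.exp (τ * z.re) * Real.exp (τ * u.re))) ^ 2 := by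
    rw [weight_scale hτ0 hτ1, weight_scale hτ0 hτ1, mul_pow, mul_pow, mul_pow, h1, Real.sq_sqrt hK]
    ring
  rw [h2, Real.sqrt_sq (by positivity)]

theorem tendsto_preKernel (hν : -1 < ν) (hτ0 : 0 < τ) (hτ1 : τ < 1) (z u : ℂ) :
    Tendsto (fun N => preKernel ν τ N z u) atTop
      (𝓝 (-((Real.Gamma (ν + 2) / 2 ^ (ν + 1) : ℝ) : ℂ) * skewSum ν τ z u)) := by
  simp only [preKernel_eq hτ0.ne']
  refine Tendsto.const_mul _ ?_
  refine ((tendsto_skewPoly hν hτ0 hτ1 u).tendsto_at (Set.mem_univ z)).congr fun N => ?_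
  simp only [skewPoly, Polynomial.eval_finsetSum, Polynomial.eval_sub,
    Polynomial.eval_mul, Polynomial.eval_C]
  exact Finset.sum_congr rfl fun k _ => by ring

/-- The weight sees a point only through its modulus and real part, so conjugation does not change
the prefactor and one statement covers all four matrix entries. -/
theorem tendsto_scaled_kernel_entry (hν : -1 < ν) (hτ0 : 0 < τ) (hτ1 : τ < 1) {z u : ℂ}
    (hz : z ≠ 0) (hu : u ≠ 0) {a b : ℂ} (ha : a = z ∨ a = conj z) (hb : b = u ∨ b = conj u) :
    Tendsto (fun N => (((1 - τ ^ 2) ^ 3 /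
        (Real.pi * Real.Gamma (ν + 2) * (1 - τ ^ 2) ^ 2) : ℝ) : ℂ) *
      (((√(weight ν τ ((1 - τ ^ 2 : ℝ) * z) * weight ν τ ((1 - τ ^ 2 : ℝ) * u)) : ℝ) : ℂ) *
        preKernel ν τ N ((1 - τ ^ 2 : ℝ) * a) ((1 - τ ^ 2 : ℝ) * b))) atTop
      (𝓝 (Complex.exp (-Complex.I * τ * (a + b).im) * ginibreLimit ν a b)) := by
  have hc : 0 < 1 - τ ^ 2 := by nlinarith
  have hre : a.re = z.re ∧ ‖a‖ = ‖z‖ ∧ a ≠ 0 := by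
    rcases ha with rfl | rfl <;> simp [hz]
  have hre' : b.re = u.re ∧ ‖b‖ = ‖u‖ ∧ b ≠ 0 := by
    rcases hb with rfl | rfl <;> simp [hu]
  convert ((tendsto_preKernel hν hτ0 hτ1 ((1 - τ ^ 2 : ℝ) * a) ((1 - τ ^ 2 : ℝ) * b)).const_mul
    ((√(weight ν τ ((1 - τ ^ 2 : ℝ) * z) * weight ν τ ((1 - τ ^ 2 : ℝ) * u)) : ℝ) : ℂ)).const_mul
    (((1 - τ ^ 2) ^ 3 / (Real.pi * Real.Gamma (ν + 2) * (1 - τ ^ 2) ^ 2) : ℝ) : ℂ) using 2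
  have hS := skewSum_eq hν hτ0 hτ1 a b
  have hcast : ((1 - τ ^ 2 : ℝ) : ℂ) = 1 - (τ : ℂ) ^ 2 := by push_cast; rfl
  rw [sqrt_weight_mul_weight hτ0 hτ1, ginibreLimit_eq ν hre.2.2 hre'.2.2, norm_mul a b, hre.2.1,
    hre'.2.1, ← norm_mul z u, hcast]
  -- The weight supplies the real exponential e^{τ Re w}, the closed form needs the holomorphic
  -- e^{τw}; their quotient is the phase in the limit.
  have hexp : ∀ w : ℂ, ((Real.exp (τ * w.re) : ℝ) : ℂ) =
      Complex.exp (-Complex.I * τ * w.im) * Complex.exp (τ * w) := by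
    intro w
    rw [← Complex.exp_add, Complex.ofReal_exp]
    congr 1
    nth_rewrite 3 [← Complex.re_add_im w]
    push_cast
    ring
  have hsplit : Complex.exp (-Complex.I * τ * (a + b).im) =
      Complex.exp (-Complex.I * τ * a.im) * Complex.exp (-Complex.I * τ * b.im) := by
    rw [← Complex.exp_add]
    congr 1
    rw [Complex.add_im]; push_cast; ring
  have hΓ : Real.Gamma (ν + 2) ≠ 0 := (Real.Gamma_pos_of_pos (by linarith)).ne'
  -- The exponents of 1 − τ² add up to 3 − 2 + ν + (−ν − 1) = 0, so only 1/π survives.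
  have hconst : (1 - τ ^ 2) ^ 3 / (Real.pi * Real.Gamma (ν + 2) * (1 - τ ^ 2) ^ 2) *
      (1 - τ ^ 2) ^ ν * (Real.Gamma (ν + 2) / 2 ^ (ν + 1)) *
        ((2 : ℝ) ^ (ν + 1) * (1 - τ ^ 2) ^ (-ν - 1)) = 1 / Real.pi := by
    have h1 : (1 - τ ^ 2) ^ ν * (1 - τ ^ 2) ^ (-ν - 1) = (1 - τ ^ 2)⁻¹ := by
      rw [← Real.rpow_add hc, ← Real.rpow_neg_one]; congr 1; ring
    have h2 : (2 : ℝ) ^ (ν + 1) ≠ 0 := by positivity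
    calc _ = ((1 - τ ^ 2) ^ ν * (1 - τ ^ 2) ^ (-ν - 1)) * ((1 - τ ^ 2) ^ 3 /
        (Real.pi * Real.Gamma (ν + 2) * (1 - τ ^ 2) ^ 2) *
        (Real.Gamma (ν + 2) / 2 ^ (ν + 1)) * ((2 : ℝ) ^ (ν + 1))) := by ring
      _ = _ := by rw [h1]; field_simp
  rw [← hre.1, ← hre'.1]
  simp only [Complex.ofReal_mul, hexp, hsplit, ← hconst]
  simp only [Complex.ofReal_mul] at hS ⊢
  linear_combination (-((((1 - τ ^ 2) ^ 3 /
    (Real.pi * Real.Gamma (ν + 2) * (1 - τ ^ 2) ^ 2) : ℝ) : ℂ) * (((1 - τ ^ 2) ^ ν : ℝ) : ℂ) *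
    ((‖z * u‖ ^ (ν / 2) : ℝ) : ℂ) * ((√(besselK ν (2 * ‖z‖) * besselK ν (2 * ‖u‖)) : ℝ) : ℂ) *
    Complex.exp (-Complex.I * τ * a.im) * Complex.exp (-Complex.I * τ * b.im) *
    ((Real.Gamma (ν + 2) / 2 ^ (ν + 1) : ℝ) : ℂ))) * (-hS)

theorem tendsto_scaled_kernel (hν : -1 < ν) (hτ0 : 0 < τ) (hτ1 : τ < 1) {z u : ℂ}
    (hz : z ≠ 0) (hu : u ≠ 0) :
    Tendsto
      (fun N : ℕ => (((1 - τ ^ 2) ^ 3 / (Real.pi * Real.Gamma (ν + 2) * (1 - τ ^ 2) ^ 2) : ℝ) : ℂ) •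
        kernel ν τ N ((1 - τ ^ 2 : ℝ) * z) ((1 - τ ^ 2 : ℝ) * u)) atTop
      (𝓝 (block (fun a b => Complex.exp (-Complex.I * τ * (a + b).im) *
        ginibreLimit ν a b) z u)) := by
  refine tendsto_pi_nhds.2 fun i => tendsto_pi_nhds.2 fun j => ?_
  have hcz : conj (((1 - τ ^ 2 : ℝ) : ℂ) * z) = ((1 - τ ^ 2 : ℝ) : ℂ) * conj z := by
    rw [map_mul, Complex.conj_ofReal]
  have hcu : conj (((1 - τ ^ 2 : ℝ) : ℂ) * u) = ((1 - τ ^ 2 : ℝ) : ℂ) * conj u := by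
    rw [map_mul, Complex.conj_ofReal]
  have key := fun a b ha hb => tendsto_scaled_kernel_entry hν hτ0 hτ1 hz hu (a := a) (b := b) ha hb
  fin_cases i <;> fin_cases j <;>
    simp only [kernel, block, hcz, hcu, Matrix.smul_apply, smul_eq_mul]
  · exact key z u (Or.inl rfl) (Or.inl rfl)
  · exact key z (conj u) (Or.inl rfl) (Or.inr rfl)
  · exact key (conj z) u (Or.inr rfl) (Or.inl rfl)
  · exact key (conj z) (conj u) (Or.inr rfl) (Or.inr rfl)

end scaling

/-! ### Alternating sums and Pfaffians -/

section alternating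

variable {κ : Type*} [Fintype κ] [DecidableEq κ]

/-- Expanding the differences means choosing the identity or the swap in every pair {i} × Fin 2.
Precomposing σ with the choice absorbs its sign, so all choices contribute equally. -/
theorem sum_perm_antisymmetrize (W : κ → κ × Fin 2 → κ × Fin 2 → ℂ) :
    ∑ σ : Equiv.Perm (κ × Fin 2), ((Equiv.Perm.sign σ : ℤ) : ℂ) *
        ∏ i, (W i (σ (i, 0)) (σ (i, 1)) - W i (σ (i, 1)) (σ (i, 0))) =
      2 ^ Fintype.card κ * ∑ σ : Equiv.Perm (κ × Fin 2), ((Equiv.Perm.sign σ : ℤ) : ℂ) *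
        ∏ i, W i (σ (i, 0)) (σ (i, 1)) := by
  have h1 : ∀ σ : Equiv.Perm (κ × Fin 2),
      ∏ i, (W i (σ (i, 0)) (σ (i, 1)) - W i (σ (i, 1)) (σ (i, 0))) =
      ∑ ε : κ → Equiv.Perm (Fin 2), ∏ i, ((Equiv.Perm.sign (ε i) : ℤ) : ℂ) *
        W i (σ (i, ε i 0)) (σ (i, ε i 1)) := by
    intro σ
    have h := Finset.prod_univ_sum (fun _ : κ => (Finset.univ : Finset (Equiv.Perm (Fin 2))))
      fun i ε => ((Equiv.Perm.sign ε : ℤ) : ℂ) * W i (σ (i, ε 0)) (σ (i, ε 1))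
    rw [Fintype.piFinset_univ] at h
    rw [← h]
    refine Finset.prod_congr rfl fun i _ => ?_
    rw [show (Finset.univ : Finset (Equiv.Perm (Fin 2))) = {1, Equiv.swap 0 1} by decide,
      Finset.sum_pair (by decide)]
    simp [sub_eq_add_neg]
  have h2 : ∀ ε : κ → Equiv.Perm (Fin 2),
      ∑ σ : Equiv.Perm (κ × Fin 2), ((Equiv.Perm.sign σ : ℤ) : ℂ) *
        ∏ i, ((Equiv.Perm.sign (ε i) : ℤ) : ℂ) * W i (σ (i, ε i 0)) (σ (i, ε i 1)) =
      ∑ σ : Equiv.Perm (κ × Fin 2), ((Equiv.Perm.sign σ : ℤ) : ℂ) *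
        ∏ i, W i (σ (i, 0)) (σ (i, 1)) := by
    intro ε
    refine Eq.trans ?_ (Equiv.sum_comp
      (Equiv.mulRight (Equiv.prodCongrRight ε : Equiv.Perm (κ × Fin 2)))
      fun σ => ((Equiv.Perm.sign σ : ℤ) : ℂ) * ∏ i, W i (σ (i, 0)) (σ (i, 1)))
    refine Finset.sum_congr rfl fun σ _ => ?_
    simp only [Equiv.coe_mulRight, Equiv.Perm.sign_mul, Equiv.Perm.sign_prodCongrRight,
      Equiv.Perm.coe_mul, Function.comp_apply, Equiv.prodCongrRight_apply, Finset.prod_mul_distrib]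
    push_cast
    ring
  simp_rw [h1, Finset.mul_sum]
  rw [Finset.sum_comm]
  simp_rw [h2]
  rw [Finset.sum_const, Finset.card_univ, Fintype.card_fun, Fintype.card_perm, Fintype.card_fin]
  simp [nsmul_eq_mul, Finset.mul_sum]

/-- An alternating sum sees only the antisymmetric part of each factor. -/
theorem sum_perm_congr {W W' : κ → κ × Fin 2 → κ × Fin 2 → ℂ}
    (h : ∀ i p q, W i p q - W i q p = W' i p q - W' i q p) :
    ∑ σ : Equiv.Perm (κ × Fin 2), ((Equiv.Perm.sign σ : ℤ) : ℂ) *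
        ∏ i, W i (σ (i, 0)) (σ (i, 1)) =
      ∑ σ : Equiv.Perm (κ × Fin 2), ((Equiv.Perm.sign σ : ℤ) : ℂ) *
        ∏ i, W' i (σ (i, 0)) (σ (i, 1)) := by
  have h2 : (2 : ℂ) ^ Fintype.card κ ≠ 0 := pow_ne_zero _ two_ne_zero
  apply mul_left_cancel₀ h2
  rw [← sum_perm_antisymmetrize, ← sum_perm_antisymmetrize]
  simp only [h]

theorem det_prod_fin_two (A : Matrix (κ × Fin 2) (κ × Fin 2) ℂ) :
    A.det = ∑ σ : Equiv.Perm (κ × Fin 2), ((Equiv.Perm.sign σ : ℤ) : ℂ) *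
      ∏ i, (A (σ (i, 0)) (i, 0) * A (σ (i, 1)) (i, 1)) := by
  rw [Matrix.det_apply']
  refine Finset.sum_congr rfl fun σ _ => ?_
  rw [Fintype.prod_prod_type]
  simp only [Fin.prod_univ_two]

end alternating

/-- The Pfaffian minor summation formula. -/
theorem pfaffian_eq_sum_det {ι : Type*} [Fintype ι] {k : ℕ}
    (X : Matrix (ι × Fin 2) (Fin k × Fin 2) ℂ) :
    pfaffian (fun p q => ∑ c, (X (c, 0) p * X (c, 1) q - X (c, 1) p * X (c, 0) q)) =
      (k ! : ℂ)⁻¹ * ∑ c : Fin k → ι,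
        (X.submatrix (fun p : Fin k × Fin 2 => (c p.1, p.2)) id).det := by
  have h1 : ∀ σ : Equiv.Perm (Fin k × Fin 2), ∏ i : Fin k,
      ∑ c, (X (c, 0) (σ (i, 0)) * X (c, 1) (σ (i, 1)) -
        X (c, 1) (σ (i, 0)) * X (c, 0) (σ (i, 1))) =
      ∏ i : Fin k, ((fun p q => ∑ c, X (c, 0) p * X (c, 1) q) (σ (i, 0)) (σ (i, 1)) -
        (fun p q => ∑ c, X (c, 0) p * X (c, 1) q) (σ (i, 1)) (σ (i, 0))) := by
    intro σ
    refine Finset.prod_congr rfl fun i _ => ?_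
    simp only [← Finset.sum_sub_distrib]
    exact Finset.sum_congr rfl fun c _ => by ring
  simp only [pfaffian]
  simp_rw [h1]
  rw [sum_perm_antisymmetrize fun _ p q => ∑ c, X (c, 0) p * X (c, 1) q, Fintype.card_fin,
    mul_inv, mul_assoc, mul_left_comm, inv_mul_cancel_left₀ (pow_ne_zero _ two_ne_zero)]
  congr 1
  simp_rw [Finset.prod_univ_sum, Fintype.piFinset_univ, Finset.mul_sum]
  rw [Finset.sum_comm]
  refine Finset.sum_congr rfl fun c _ => ?_
  rw [← Matrix.det_transpose, det_prod_fin_two]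
  rfl

/-! ### Sums of paired minors over injections and permutations. -/

section embeddings

variable {α β γ : Type*} [Fintype α] [Fintype β] [Fintype γ] [DecidableEq α] [DecidableEq β]
  [DecidableEq γ]

/-- An injection of α into α ⊕ β extends to a permutation in |β|! ways, one for each bijection from
β to the complement of its image. -/
theorem sum_perm_comp_inl (G : (α → α ⊕ β) → ℂ) (hG : ∀ c, ¬Function.Injective c → G c = 0) :
    ∑ π : Equiv.Perm (α ⊕ β), G (π ∘ Sum.inl) = (Fintype.card β)! * ∑ c, G c := by
  classical
  have h1 : ∑ c, G c = ∑ c : α ↪ α ⊕ β, G c := by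
    rw [← Finset.sum_filter_of_ne (p := Function.Injective) fun c _ hc =>
      not_imp_comm.1 (hG c) hc]
    refine (Finset.sum_bij (fun (c : α ↪ α ⊕ β) _ => (c : α → α ⊕ β)) ?_ ?_ ?_ ?_).symm
    · intro c _; simpa using c.injective
    · intro c _ d _ h; exact DFunLike.coe_injective h
    · intro c hc; exact ⟨⟨c, by simpa using hc⟩, Finset.mem_univ _, rfl⟩
    · intro c _; rfl
  have h2 : ∑ π : Equiv.Perm (α ⊕ β), G (π ∘ Sum.inl) =
      ∑ e : α ⊕ β ↪ α ⊕ β, G (e ∘ Sum.inl) := by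
    rw [← Equiv.sum_comp (Equiv.embeddingEquivOfFinite (α ⊕ β))]
    refine Finset.sum_congr rfl fun e _ => ?_
    congr 1
  rw [h2, h1, ← Equiv.sum_comp (Equiv.sumEmbeddingEquivSigmaEmbeddingRestricted
    (α := α) (β := β) (γ := α ⊕ β)).symm, Fintype.sum_sigma, Finset.mul_sum]
  refine Finset.sum_congr rfl fun c _ => ?_
  have h3 : ∀ g : β ↪ ↥(Set.range c)ᶜ, (Equiv.sumEmbeddingEquivSigmaEmbeddingRestricted
      (α := α) (β := β) (γ := α ⊕ β)).symm ⟨c, g⟩ ∘ Sum.inl = c := fun g => rfl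
  simp only [h3, Finset.sum_const, Finset.card_univ, nsmul_eq_mul]
  congr 2
  have h4 : Fintype.card ↥(Set.range c)ᶜ = Fintype.card β := by
    rw [Fintype.card_compl_set, Fintype.card_sum, Set.card_range_of_injective c.injective,
      Nat.add_sub_cancel_left]
  rw [Fintype.card_embedding_eq, h4, Nat.descFactorial_self]

theorem sum_perm_comp_inr (G : (β → α ⊕ β) → ℂ) (hG : ∀ c, ¬Function.Injective c → G c = 0) :
    ∑ π : Equiv.Perm (α ⊕ β), G (π ∘ Sum.inr) = (Fintype.card α)! * ∑ c, G c := by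
  have h := sum_perm_comp_inl (α := β) (β := α) (fun c => G (Sum.swap ∘ c)) fun c hc =>
    hG _ fun h => hc fun x y hxy => h (by simp [hxy])
  rw [← Equiv.sum_comp ((Equiv.refl β).arrowCongr (Equiv.sumComm β α)) G]
  refine Eq.trans ?_ h
  exact (Equiv.sum_comp (Equiv.permCongr (Equiv.sumComm β α)) fun π => G (π ∘ Sum.inr)).symm

/-- The matrix whose first columns are those of `X` and whose last ones are unit vectors. -/
noncomputable def padMatrix (X : Matrix ((α ⊕ β) × Fin 2) (α × Fin 2) ℂ) (d : β → α ⊕ β) :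
    Matrix ((α ⊕ β) × Fin 2) ((α ⊕ β) × Fin 2) ℂ :=
  fun p q => Sum.elim (fun a => X p (a, q.2)) (fun b => if p = (d b, q.2) then 1 else 0) q.1

/-- Permuting rows in whole pairs costs the square of a sign, which is 1; the result is block
triangular with an identity corner. -/
theorem det_padMatrix_perm (X : Matrix ((α ⊕ β) × Fin 2) (α × Fin 2) ℂ)
    (π : Equiv.Perm (α ⊕ β)) : (padMatrix X (π ∘ Sum.inr)).det =
      (X.submatrix (fun p : α × Fin 2 => ((π ∘ Sum.inl) p.1, p.2)) id).det := by
  have h1 := Matrix.det_permute (Equiv.prodCongrLeft fun _ : Fin 2 => π)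
    (padMatrix X (π ∘ Sum.inr))
  rw [Equiv.Perm.sign_prodCongrLeft, Fin.prod_univ_two, Int.units_mul_self] at h1
  rw [← one_mul (padMatrix X (π ∘ Sum.inr)).det]
  refine Eq.trans (by simp) (h1.symm.trans ?_)
  rw [← Matrix.det_submatrix_equiv_self (Equiv.sumProdDistrib α β (Fin 2)).symm]
  have h2 : (((padMatrix X (π ∘ Sum.inr)).submatrix
      (Equiv.prodCongrLeft fun _ : Fin 2 => π) id).submatrix
        (Equiv.sumProdDistrib α β (Fin 2)).symm (Equiv.sumProdDistrib α β (Fin 2)).symm) =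
      Matrix.fromBlocks (X.submatrix (fun p : α × Fin 2 => ((π ∘ Sum.inl) p.1, p.2)) id) 0
        (X.submatrix (fun p : β × Fin 2 => ((π ∘ Sum.inr) p.1, p.2)) id) 1 := by
    ext p q
    rcases p with ⟨a, i⟩ | ⟨b, i⟩ <;> rcases q with ⟨a', j⟩ | ⟨b', j⟩ <;>
      simp [padMatrix, Matrix.one_apply]
  rw [h2, Matrix.det_fromBlocks_zero₁₂, Matrix.det_one, mul_one]

theorem det_padMatrix_of_not_injective (X : Matrix ((α ⊕ β) × Fin 2) (α × Fin 2) ℂ)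
    {d : β → α ⊕ β} (hd : ¬Function.Injective d) : (padMatrix X d).det = 0 := by
  simp only [Function.Injective, not_forall] at hd
  obtain ⟨b, b', h, hne⟩ := hd
  refine Matrix.det_zero_of_column_eq (i := (Sum.inr b, 0)) (j := (Sum.inr b', 0))
    (by simpa using hne) fun p => ?_
  simp [padMatrix, h]

theorem det_submatrix_of_not_injective {δ : Type*} (X : Matrix (δ × Fin 2) (α × Fin 2) ℂ)
    {c : α → δ} (hc : ¬Function.Injective c) :
    (X.submatrix (fun p : α × Fin 2 => (c p.1, p.2)) id).det = 0 := by
  simp only [Function.Injective, not_forall] at hc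
  obtain ⟨a, a', h, hne⟩ := hc
  refine Matrix.det_zero_of_row_eq (i := (a, 0)) (j := (a', 0)) (by simpa using hne) ?_
  ext q
  simp [h]

/-- Non-injective choices give repeated rows or columns, so both sides are sums over permutations of
the same minors. -/
theorem sum_det_padMatrix (X : Matrix ((α ⊕ β) × Fin 2) (α × Fin 2) ℂ) :
    ((Fintype.card α)! : ℂ) * ∑ d, (padMatrix X d).det = (Fintype.card β)! *
      ∑ c : α → α ⊕ β, (X.submatrix (fun p : α × Fin 2 => (c p.1, p.2)) id).det := by
  rw [← sum_perm_comp_inr _ fun d hd => det_padMatrix_of_not_injective X hd,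
    ← sum_perm_comp_inl _ fun c hc => det_submatrix_of_not_injective X hc]
  exact Finset.sum_congr rfl fun π _ => det_padMatrix_perm X π

/-- Integrating out pairs of columns of a determinant in a skew-orthonormal basis. -/
theorem sum_perm_pairing (X : Matrix ((α ⊕ β) × Fin 2) (α × Fin 2) ℂ)
    (M : (α ⊕ β) × Fin 2 → (α ⊕ β) × Fin 2 → ℂ) (ρ : ℂ)
    (hM : ∀ p q, M p q - M q p = ρ * ∑ d, ((if p = (d, 0) then 1 else 0) *
      (if q = (d, 1) then 1 else 0) - (if q = (d, 0) then 1 else 0) *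
        (if p = (d, 1) then 1 else 0))) :
    ((Fintype.card α)! : ℂ) * ∑ σ : Equiv.Perm ((α ⊕ β) × Fin 2), ((Equiv.Perm.sign σ : ℤ) : ℂ) *
      ((∏ a, (X (σ (Sum.inl a, 0)) (a, 0) * X (σ (Sum.inl a, 1)) (a, 1))) *
        ∏ b, M (σ (Sum.inr b, 0)) (σ (Sum.inr b, 1))) =
    ρ ^ Fintype.card β * (Fintype.card β)! *
      ∑ c : α → α ⊕ β, (X.submatrix (fun p : α × Fin 2 => (c p.1, p.2)) id).det := by
  -- Only the antisymmetric part of M counts, so M may be replaced by ρ Σ_d e_{(d,0)} ⊗ e_{(d,1)}.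
  -- Expanding the product over the choices of d produces the unit columns of `padMatrix`.
  have h1 := sum_perm_congr (κ := α ⊕ β)
    (W := fun i p q => Sum.elim (fun a => X p (a, 0) * X q (a, 1)) (fun _ => M p q) i)
    (W' := fun i p q => Sum.elim (fun a => X p (a, 0) * X q (a, 1)) (fun _ => ρ * ∑ d : α ⊕ β,
      (if p = (d, 0) then 1 else 0) * (if q = (d, 1) then 1 else 0)) i) (by
    rintro (a | b) p q
    · rfl
    · simp only [Sum.elim_inr, hM, Finset.sum_sub_distrib, mul_sub])
  simp only [Fintype.prod_sum_type, Sum.elim_inl, Sum.elim_inr] at h1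
  rw [h1, mul_assoc (ρ ^ _), ← sum_det_padMatrix, mul_left_comm]
  congr 1
  rw [Finset.mul_sum]
  simp_rw [Finset.prod_mul_distrib (f := fun _ => ρ), Finset.prod_const, Finset.card_univ,
    Finset.prod_univ_sum, Fintype.piFinset_univ, Finset.mul_sum]
  rw [Finset.sum_comm]
  refine Finset.sum_congr rfl fun d _ => ?_
  rw [det_prod_fin_two, Finset.mul_sum]
  refine Finset.sum_congr rfl fun σ _ => ?_
  rw [Fintype.prod_sum_type]
  simp only [padMatrix, Sum.elim_inl, Sum.elim_inr]
  ring

end embeddings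

/-! ### Orthogonality of the Laguerre polynomials on the half-line -/

open Polynomial in
/-- The functional `p ↦ ∫₀^∞ s ^ α e ^ (-s) p(s) ds` on polynomials. -/
noncomputable def gammaFunctional (α : ℝ) : ℂ[X] →ₗ[ℂ] ℂ :=
  Polynomial.lsum fun i => ((Real.Gamma (i + α + 1) : ℝ) : ℂ) • LinearMap.id

section functional

open Polynomial

variable {α : ℝ}

theorem gammaFunctional_monomial (i : ℕ) (a : ℂ) :
    gammaFunctional α (monomial i a) = a * Real.Gamma (i + α + 1) := by
  simp [gammaFunctional, mul_comm]

theorem gammaFunctional_X_mul (p : ℂ[X]) :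
    gammaFunctional α (X * p) = gammaFunctional (α + 1) p := by
  induction p using Polynomial.induction_on' with
  | add p q hp hq => rw [mul_add, map_add, map_add, hp, hq]
  | monomial i a =>
    rw [X_mul_monomial, gammaFunctional_monomial, gammaFunctional_monomial]
    congr 4
    push_cast; ring

/-- The algebraic form of ∫ d(s^{α+1} e^{−s} p) = 0; on monomials it is the functional equation of
Γ. -/
theorem gammaFunctional_derivative (hα : -1 < α) (p : ℂ[X]) :
    gammaFunctional α (X * derivative p + C ((α + 1 : ℝ) : ℂ) * p - X * p) = 0 := by
  induction p using Polynomial.induction_on' with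
  | add p q hp hq =>
    rw [derivative_add, show ∀ a b c d e f : ℂ[X], a * (b + c) + d * (e + f) - a * (e + f) =
      (a * b + d * e - a * e) + (a * c + d * f - a * f) by intros; ring, map_add, hp, hq, add_zero]
  | monomial i a =>
    have h1 : X * derivative (monomial i a) = monomial i (a * i) := by
      cases i with
      | zero => simp
      | succ i => rw [derivative_monomial, X_mul_monomial, Nat.succ_sub_one]
    have h2 := gamma_nat_succ hα i
    rw [h1, X_mul_monomial, C_mul_monomial, map_sub, map_add, gammaFunctional_monomial,
      gammaFunctional_monomial, gammaFunctional_monomial, h2]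
    push_cast
    ring

/-- The Laguerre equation in divergence form and one integration by parts: the degree drops, α rises
by one and the other factor is differentiated. Iteration gives orthogonality. -/
theorem gammaFunctional_lag_mul_lag_succ (hα : -1 < α) (n : ℕ) (p : ℂ[X]) :
    ((n : ℂ) + 1) * gammaFunctional α (lag α 1 (n + 1) * p) =
      -gammaFunctional (α + 1) (lag (α + 1) 1 n * derivative p) := by
  have h1 := gammaFunctional_derivative hα (derivative (lag α 1 (n + 1)) * p)
  have h2 := lag_ode (α := α) 1 hα (n + 1)
  have h3 : X * derivative (derivative (lag α 1 (n + 1)) * p) +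
      C ((α + 1 : ℝ) : ℂ) * (derivative (lag α 1 (n + 1)) * p) -
        X * (derivative (lag α 1 (n + 1)) * p) =
      X * (derivative (lag α 1 (n + 1)) * derivative p) -
        C ((n : ℂ) + 1) * (lag α 1 (n + 1) * p) := by
    rw [derivative_mul]
    simp only [lagD, Nat.cast_add, Nat.cast_one, Complex.ofReal_one, C_1] at h2
    linear_combination p * h2
  rw [h3, map_sub, gammaFunctional_X_mul, derivative_lag_succ, neg_mul, map_neg, C_mul',
    map_smul, smul_eq_mul] at h1
  linear_combination -h1

/-- The Laguerre polynomials are orthogonal. -/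
theorem gammaFunctional_lag_mul_lag (hα : -1 < α) (m n : ℕ) :
    gammaFunctional α (lag α 1 m * lag α 1 n) =
      if m = n then ((Real.Gamma (m + α + 1) / m ! : ℝ) : ℂ) else 0 := by
  induction m generalizing α n with
  | zero =>
    cases n with
    | zero =>
      rw [lag_zero 1 hα, one_mul, if_pos rfl, ← Polynomial.monomial_zero_one,
        gammaFunctional_monomial]
      simp
    | succ n =>
      have h := gammaFunctional_lag_mul_lag_succ hα n (lag α 1 0)
      rw [lag_zero 1 hα, derivative_one, mul_zero, map_zero, neg_zero] at h
      rw [lag_zero 1 hα, one_mul, if_neg (by simp)]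
      simpa [Nat.cast_add_one_ne_zero] using h
  | succ m ih =>
    have h := gammaFunctional_lag_mul_lag_succ hα m (lag α 1 n)
    have hm : (m : ℂ) + 1 ≠ 0 := Nat.cast_add_one_ne_zero m
    cases n with
    | zero =>
      rw [lag_zero 1 hα, derivative_one, mul_zero, map_zero, neg_zero] at h
      rw [lag_zero 1 hα, if_neg (by simp)]
      simpa [hm] using h
    | succ n =>
      rw [derivative_lag_succ, mul_neg, map_neg, neg_neg, ih (by linarith)] at h
      apply mul_left_cancel₀ hm
      rw [h]
      simp only [Nat.add_right_cancel_iff, mul_ite, mul_zero]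
      split_ifs with hmn
      · rw [Nat.factorial_succ]
        have h4 : (m ! : ℂ) ≠ 0 := by exact_mod_cast m.factorial_ne_zero
        rw [show (m : ℝ) + (α + 1) + 1 = (m + 1 : ℕ) + α + 1 by push_cast; ring]
        push_cast
        field_simp
      · rfl

/-- Each derivative raises α and lowers the degree by one, so the Gaussian Taylor expansion below
stays inside the Laguerre family. -/
theorem hasseDeriv_lag (k m : ℕ) (τ : ℝ) :
    hasseDeriv k (lag α τ (m + k)) = C ((-1) ^ k / (k ! : ℂ)) * lag (α + k) τ m := by
  induction k generalizing α with
  | zero => simp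
  | succ k ih =>
    have h1 : hasseDeriv (k + 1) (lag α τ (m + (k + 1))) =
        C ((k + 1 : ℂ)⁻¹) * hasseDeriv k (derivative (lag α τ (m + (k + 1)))) := by
      have h2 : (k + 1).choose k • hasseDeriv (k + 1) (lag α τ (m + (k + 1))) =
          hasseDeriv k (derivative (lag α τ (m + (k + 1)))) := by
        have h3 := LinearMap.congr_fun (hasseDeriv_comp (R := ℂ) k 1) (lag α τ (m + (k + 1)))
        simpa [add_mul] using h3.symm
      rw [← h2, Nat.choose_succ_self_right, nsmul_eq_mul, ← mul_assoc]
      have : C ((k + 1 : ℂ)⁻¹) * ((k + 1 : ℕ) : ℂ[X]) = 1 := by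
        rw [← C_eq_natCast, ← C_mul]
        push_cast
        rw [inv_mul_cancel₀ (Nat.cast_add_one_ne_zero k), C_1]
      rw [this, one_mul]
    rw [h1, ← add_assoc, derivative_lag_succ, map_neg, ih, Nat.factorial_succ,
      show α + 1 + (k : ℝ) = α + (k + 1 : ℕ) by push_cast; ring, mul_neg,
      ← mul_assoc, ← C_mul, ← neg_mul, ← C_neg]
    congr 2
    push_cast
    rw [pow_succ]
    field_simp

theorem hasseDeriv_lag_of_lt {k m : ℕ} (h : m < k) (τ : ℝ) : hasseDeriv k (lag α τ m) = 0 :=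
  hasseDeriv_eq_zero_of_lt_natDegree _ _ ((natDegree_lag_le τ m).trans_lt h)

theorem lag_comp_smul (τ : ℝ) (n : ℕ) :
    (lag α τ n).comp (C (τ : ℂ) * X) = C ((τ : ℂ) ^ n) * lag α 1 n := by
  refine Polynomial.funext fun s => ?_
  rw [eval_comp, eval_mul, eval_C, eval_X, eval_lag_smul, eval_mul, eval_C]

/-- The bilinear form `∑ₖ (1 - τ²)ᵏ k! ∫₀^∞ s^(α + k) e^(-s) (∂ᵏp / k!)(τ s) (∂ᵏq / k!)(τ s) ds`
diagonalised by the rescaled Laguerre polynomials. -/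
theorem sum_gammaFunctional_lag (hα : -1 < α) (τ : ℝ) {m n M : ℕ} (hm : m < M) :
    ∑ k ∈ Finset.range M, ((1 - τ ^ 2 : ℝ) : ℂ) ^ k * k ! * gammaFunctional (α + k)
      ((hasseDeriv k (lag α τ m)).comp (C (τ : ℂ) * X) *
        (hasseDeriv k (lag α τ n)).comp (C (τ : ℂ) * X)) =
      if m = n then ((Real.Gamma (m + α + 1) / m ! : ℝ) : ℂ) else 0 := by
  have h1 : ∀ k ≤ m, ((1 - τ ^ 2 : ℝ) : ℂ) ^ k * k ! * gammaFunctional (α + k)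
      ((hasseDeriv k (lag α τ m)).comp (C (τ : ℂ) * X) *
        (hasseDeriv k (lag α τ n)).comp (C (τ : ℂ) * X)) =
      if m = n then ((Real.Gamma (m + α + 1) / m ! : ℝ) : ℂ) *
        (((1 - τ ^ 2 : ℝ) : ℂ) ^ k * ((τ ^ 2 : ℝ) : ℂ) ^ (m - k) * m.choose k) else 0 := by
    intro k hk
    obtain ⟨j, rfl⟩ := Nat.exists_eq_add_of_le' hk
    by_cases hn : k ≤ n
    · obtain ⟨l, rfl⟩ := Nat.exists_eq_add_of_le' hn
      rw [hasseDeriv_lag, hasseDeriv_lag, mul_comp, mul_comp, C_comp, lag_comp_smul,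
        lag_comp_smul, show ∀ a b c d e f : ℂ[X], a * (b * c) * (d * (e * f)) =
          (a * b * d * e) * (c * f) by intros; ring, ← C_mul, ← C_mul, ← C_mul, C_mul', map_smul, gammaFunctional_lag_mul_lag (by
          have : (0 : ℝ) ≤ k := k.cast_nonneg
          linarith)]
      simp only [Nat.add_right_cancel_iff, smul_eq_mul, mul_ite, mul_zero]
      split_ifs with h
      · subst h
        have hk' : (k ! : ℂ) ≠ 0 := by exact_mod_cast k.factorial_ne_zero
        have hj' : (j ! : ℂ) ≠ 0 := by exact_mod_cast j.factorial_ne_zero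
        have hjk' : ((j + k)! : ℂ) ≠ 0 := by exact_mod_cast (j + k).factorial_ne_zero
        have hs : ((-1 : ℂ) ^ k) * (-1) ^ k = 1 := by rw [← mul_pow]; simp
        rw [Nat.add_sub_cancel, Nat.cast_choose ℂ (Nat.le_add_left k j), Nat.add_sub_cancel,
          show (j : ℝ) + (α + k) + 1 = (j + k : ℕ) + α + 1 by push_cast; ring]
        push_cast
        rw [← pow_mul]
        field_simp
        linear_combination ((τ : ℂ) ^ (2 * j) * Real.Gamma (j + k + α + 1) * (1 - (τ : ℂ) ^ 2) ^ k) * hs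
      · rfl
    · rw [hasseDeriv_lag_of_lt (not_le.1 hn), zero_comp, mul_zero, map_zero, mul_zero, if_neg]
      omega
  rw [← Finset.sum_subset (Finset.range_subset_range.2 (Nat.succ_le_of_lt hm)) (fun k _ hk => by
    rw [hasseDeriv_lag_of_lt (by simpa using hk), zero_comp, zero_mul, map_zero, mul_zero]),
    Finset.sum_congr rfl fun k hk => h1 k (Nat.lt_succ_iff.1 (Finset.mem_range.1 hk))]
  split_ifs with h
  -- On the diagonal the binomial theorem for ((1 − τ²) + τ²)^m removes every dependence on τ.
  · rw [← Finset.mul_sum, ← add_pow, ← Complex.ofReal_add, sub_add_cancel]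
    simp
  · simp

end functional

/-! ### The weight as a mixture of Gaussian densities -/

section gaussian

variable {v : ℝ}

theorem integral_norm_pow_mul_gaussian (hv : 0 < v) (k : ℕ) :
    ∫ h : ℂ, ‖h‖ ^ (2 * k) * Real.exp (-(‖h‖ ^ 2 / v)) = Real.pi * v ^ (k + 1) * k ! := by
  have h := Complex.integral_rpow_mul_exp_neg_mul_rpow (p := 2) (q := (2 * k : ℕ)) (b := v⁻¹)
    (by norm_num) (by have : (0 : ℝ) ≤ (2 * k : ℕ) := Nat.cast_nonneg _; linarith) (inv_pos.2 hv)
  simp only [Real.rpow_natCast, Real.rpow_two] at h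
  have h1 : (((2 * k : ℕ) : ℝ) + 2) / 2 = k + 1 := by push_cast; ring
  rw [neg_div, h1, Real.Gamma_nat_eq_factorial, Real.inv_rpow hv.le, Real.rpow_neg hv.le,
    inv_inv, show (k : ℝ) + 1 = (k + 1 : ℕ) by push_cast; ring, Real.rpow_natCast] at h
  rw [mul_div_cancel_left₀ _ (two_ne_zero : (2 : ℝ) ≠ 0)] at h
  rw [← h]
  congr 1; ext x
  rw [neg_mul, div_eq_inv_mul]

theorem integrable_norm_pow_mul_gaussian (hv : 0 < v) (k : ℕ) :
    Integrable fun h : ℂ => ‖h‖ ^ (2 * k) * Real.exp (-(‖h‖ ^ 2 / v)) := by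
  -- A non-integrable function has integral 0 by convention, whereas the value found above is
  -- positive.
  refine not_imp_comm.1 integral_undef ?_
  rw [integral_norm_pow_mul_gaussian hv]
  have := k.factorial_pos
  positivity

theorem integrable_gaussian_moment (hv : 0 < v) (k l : ℕ) :
    Integrable fun h : ℂ => h ^ k * conj h ^ l * (Real.exp (-(‖h‖ ^ 2 / v)) : ℂ) := by
  refine ((integrable_norm_pow_mul_gaussian hv k).add
    (integrable_norm_pow_mul_gaussian hv l)).mono' (by fun_prop) (ae_of_all _ fun h => ?_)
  rw [norm_mul, norm_mul, norm_pow, norm_pow, RCLike.norm_conj, Complex.norm_real,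
    Real.norm_of_nonneg (Real.exp_nonneg _)]
  simp only [Pi.add_apply, ← add_mul]
  refine mul_le_mul_of_nonneg_right ?_ (Real.exp_nonneg _)
  rw [mul_comm 2 k, mul_comm 2 l, pow_mul, pow_mul]
  nlinarith [sq_nonneg (‖h‖ ^ k - ‖h‖ ^ l), sq_nonneg (‖h‖ ^ k), sq_nonneg (‖h‖ ^ l)]

theorem integral_gaussian_moment (hv : 0 < v) (k l : ℕ) :
    ∫ h : ℂ, h ^ k * conj h ^ l * (Real.exp (-(‖h‖ ^ 2 / v)) : ℂ) =
      if k = l then (Real.pi * v ^ (k + 1) * k ! : ℂ) else 0 := by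
  split_ifs with hkl
  · subst hkl
    have h := congrArg (fun x : ℝ => (x : ℂ)) (integral_norm_pow_mul_gaussian hv k)
    simp only [← integral_complex_ofReal] at h
    rw [show (Real.pi * v ^ (k + 1) * k ! : ℂ) = ((Real.pi * v ^ (k + 1) * k ! : ℝ) : ℂ) by
      push_cast; rfl, ← h]
    congr 1; ext x
    rw [← mul_pow, Complex.mul_conj, Complex.normSq_eq_norm_sq, ← Complex.ofReal_pow, ← pow_mul,
      Complex.ofReal_mul]
  · have hd : ((k : ℂ) - l) ≠ 0 := by
      rw [sub_ne_zero]; exact_mod_cast hkl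
    -- A rotation chosen so that c^k c̄^l = −1; by invariance the integral equals its own negative.
    set c : Circle := Circle.exp (Real.pi / (k - l)) with hc
    have h1 : (c : ℂ) ^ k * conj (c : ℂ) ^ l = -1 := by
      rw [← Circle.coe_inv_eq_conj, Circle.coe_inv, hc, Circle.coe_exp, ← Complex.exp_neg,
        ← Complex.exp_nat_mul, ← Complex.exp_nat_mul, ← Complex.exp_add, ← Complex.exp_pi_mul_I]
      congr 1
      push_cast
      field_simp
      ring
    have h2 := (rotation c).measurePreserving.integral_comp
      (rotation c).toHomeomorph.measurableEmbedding
      fun h : ℂ => h ^ k * conj h ^ l * (Real.exp (-(‖h‖ ^ 2 / v)) : ℂ)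
    have h3 : ∀ h : ℂ, (rotation c h) ^ k * conj (rotation c h) ^ l *
        (Real.exp (-(‖rotation c h‖ ^ 2 / v)) : ℂ) =
        -(h ^ k * conj h ^ l * (Real.exp (-(‖h‖ ^ 2 / v)) : ℂ)) := by
      intro h
      rw [LinearIsometryEquiv.norm_map, rotation_apply, map_mul, mul_pow, mul_pow]
      linear_combination (h ^ k * conj h ^ l * (Real.exp (-(‖h‖ ^ 2 / v)) : ℂ)) * h1
    simp_rw [h3] at h2
    rw [integral_neg] at h2
    exact self_eq_neg.1 h2.symm

open Polynomial

theorem eval_mul_eval_conj_gaussian (p q : ℂ[X]) (a : ℝ) {M : ℕ} (hp : p.natDegree < M)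
    (hq : q.natDegree < M) (v : ℝ) (h : ℂ) :
    p.eval (h + a) * q.eval (conj (h + a)) * (Real.exp (-(‖h‖ ^ 2 / v)) : ℂ) =
      ∑ k ∈ Finset.range M, ∑ l ∈ Finset.range M,
        (hasseDeriv k p).eval (a : ℂ) * (hasseDeriv l q).eval (a : ℂ) *
          (h ^ k * conj h ^ l * (Real.exp (-(‖h‖ ^ 2 / v)) : ℂ)) := by
  rw [map_add, Complex.conj_ofReal, ← taylor_eval, ← taylor_eval,
    eval_eq_sum_range' (by rwa [natDegree_taylor] : (taylor (a : ℂ) p).natDegree < M),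
    eval_eq_sum_range' (by rwa [natDegree_taylor] : (taylor (a : ℂ) q).natDegree < M),
    Finset.sum_mul_sum, Finset.sum_mul]
  refine Finset.sum_congr rfl fun k _ => ?_
  rw [Finset.sum_mul]
  refine Finset.sum_congr rfl fun l _ => ?_
  rw [taylor_coeff, taylor_coeff]
  ring

theorem integrable_polynomial_gaussian (hv : 0 < v) (p q : ℂ[X]) (a : ℝ) :
    Integrable fun z : ℂ =>
      p.eval z * q.eval (conj z) * (Real.exp (-(‖z - a‖ ^ 2 / v)) : ℂ) := by
  have h : Integrable fun h : ℂ =>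
      p.eval (h + a) * q.eval (conj (h + a)) * (Real.exp (-(‖h‖ ^ 2 / v)) : ℂ) := by
    simp_rw [eval_mul_eval_conj_gaussian p q a (Nat.lt_succ_of_le (le_max_left _ _))
      (Nat.lt_succ_of_le (le_max_right p.natDegree q.natDegree)) v]
    exact integrable_finsetSum _ fun k _ => integrable_finsetSum _ fun l _ =>
      (integrable_gaussian_moment hv k l).const_mul _
  simpa using h.comp_sub_right (a : ℂ)

/-- Taylor expansion of both factors about the real centre a; mixed moments with k ≠ l vanish by
rotation invariance. -/
theorem integral_polynomial_gaussian (hv : 0 < v) (p q : ℂ[X]) (a : ℝ) {M : ℕ}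
    (hp : p.natDegree < M) (hq : q.natDegree < M) :
    ∫ z : ℂ, p.eval z * q.eval (conj z) * (Real.exp (-(‖z - a‖ ^ 2 / v)) : ℂ) =
      ∑ k ∈ Finset.range M, (hasseDeriv k p).eval (a : ℂ) * (hasseDeriv k q).eval (a : ℂ) *
        (Real.pi * v ^ (k + 1) * k !) := by
  rw [← integral_add_right_eq_self _ (a : ℂ)]
  simp_rw [add_sub_cancel_right, eval_mul_eval_conj_gaussian p q a hp hq v]
  rw [integral_finsetSum _ fun k _ => integrable_finsetSum _ fun l _ =>
      (integrable_gaussian_moment hv k l).const_mul _]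
  refine Finset.sum_congr rfl fun k hk => ?_
  rw [integral_finsetSum _ fun l _ => (integrable_gaussian_moment hv k l).const_mul _]
  simp_rw [integral_const_mul, integral_gaussian_moment hv, mul_ite, mul_zero]
  rw [Finset.sum_ite_eq, if_pos hk]

end gaussian

/-! ### The Gamma functional as an integral over the half-line. -/

section halfline

open Polynomial

variable {α : ℝ}

theorem integrableOn_gammaFunctional (hα : -1 < α) (p : ℂ[X]) :
    IntegrableOn (fun s : ℝ => ((s ^ α * Real.exp (-s) : ℝ) : ℂ) * p.eval (s : ℂ)) (Set.Ioi 0) ∧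
    ∫ s in Set.Ioi (0 : ℝ), ((s ^ α * Real.exp (-s) : ℝ) : ℂ) * p.eval (s : ℂ) =
      gammaFunctional α p := by
  induction p using Polynomial.induction_on' with
  | add p q hp hq =>
    simp_rw [eval_add, mul_add, map_add]
    exact ⟨hp.1.add hq.1, by rw [integral_add hp.1 hq.1, hp.2, hq.2]⟩
  | monomial i a =>
    have hi : 0 < (i : ℝ) + α + 1 := by
      have : (0 : ℝ) ≤ i := i.cast_nonneg
      linarith
    have h1 : Set.EqOn (fun s : ℝ => a * ((Real.exp (-s) * s ^ ((i : ℝ) + α + 1 - 1) : ℝ) : ℂ))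
        (fun s : ℝ => ((s ^ α * Real.exp (-s) : ℝ) : ℂ) * (monomial i a).eval (s : ℂ))
        (Set.Ioi 0) := by
      intro s hs
      simp only
      rw [add_sub_cancel_right, Real.rpow_add hs, Real.rpow_natCast, eval_monomial]
      push_cast
      ring
    have h2 := ((Real.GammaIntegral_convergent hi).ofReal (𝕜 := ℂ)).const_mul a
    refine ⟨IntegrableOn.congr_fun h2 h1 measurableSet_Ioi, ?_⟩
    rw [← setIntegral_congr_fun measurableSet_Ioi h1, integral_const_mul,
      gammaFunctional_monomial, Real.Gamma_eq_integral hi]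
    congr 1
    exact integral_ofReal

end halfline

section mixture

variable {ν τ : ℝ}

/-- The substitution s = x e^t turns s + x²/s into 2x cosh t. -/
theorem integral_mixture_eq_integral_exp {c x : ℝ} (hx : 0 < x) (ν : ℝ) :
    (IntegrableOn (fun s : ℝ => s ^ (ν - 1) * Real.exp (-(c * (s + x ^ 2 / s)))) (Set.Ioi 0) ↔
      Integrable fun t : ℝ => Real.exp (ν * t) * Real.exp (-(2 * c * x) * Real.cosh t)) ∧
    ∫ s in Set.Ioi (0 : ℝ), s ^ (ν - 1) * Real.exp (-(c * (s + x ^ 2 / s))) =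
      x ^ ν * ∫ t : ℝ, Real.exp (ν * t) * Real.exp (-(2 * c * x) * Real.cosh t) := by
  have himg : (fun t : ℝ => x * Real.exp t) '' Set.univ = Set.Ioi 0 := by
    ext s
    simp only [Set.image_univ, Set.mem_range, Set.mem_Ioi]
    constructor
    · rintro ⟨t, rfl⟩; positivity
    · intro hs
      exact ⟨Real.log (s / x), by rw [Real.exp_log (by positivity)]; field_simp⟩
  have hder : ∀ t ∈ (Set.univ : Set ℝ), HasDerivWithinAt (fun t : ℝ => x * Real.exp t)
      (x * Real.exp t) Set.univ t := fun t _ => ((Real.hasDerivAt_exp t).const_mul x).hasDerivWithinAt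
  have hinj : Set.InjOn (fun t : ℝ => x * Real.exp t) Set.univ := by
    intro a _ b _ h
    exact Real.exp_injective (mul_left_cancel₀ hx.ne' h)
  have hfun : (fun t : ℝ => |x * Real.exp t| • ((x * Real.exp t) ^ (ν - 1) *
      Real.exp (-(c * (x * Real.exp t + x ^ 2 / (x * Real.exp t)))))) =
      fun t => x ^ ν * (Real.exp (ν * t) * Real.exp (-(2 * c * x) * Real.cosh t)) := by
    ext t
    have h0 : 0 < x * Real.exp t := by positivity
    rw [abs_of_pos h0, smul_eq_mul, ← mul_assoc, Real.rpow_sub_one h0.ne',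
      mul_div_cancel₀ _ h0.ne', Real.mul_rpow hx.le (Real.exp_nonneg _), ← Real.exp_mul,
      mul_comm t ν, mul_assoc]
    congr 3
    rw [Real.cosh_eq, Real.exp_neg]
    field_simp
  constructor
  · rw [← himg, integrableOn_image_iff_integrableOn_abs_deriv_smul MeasurableSet.univ hder hinj,
      hfun, integrableOn_univ, integrable_const_mul_iff (Ne.isUnit (by positivity))]
  · rw [← himg, integral_image_eq_integral_abs_deriv_smul MeasurableSet.univ hder hinj, hfun,
      setIntegral_univ, integral_const_mul]

theorem integrableOn_mixture (hν : -1 < ν) {c x : ℝ} (hc : 0 < c) (hx : 0 < x) :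
    IntegrableOn (fun s : ℝ => s ^ (ν - 1) * Real.exp (-(c * (s + x ^ 2 / s)))) (Set.Ioi 0) := by
  have h := (integrableOn_rpow_mul_exp_neg_mul_rpow hν one_pos hc).const_mul (c * x ^ 2)⁻¹
  refine Integrable.mono' h (by fun_prop) ?_
  refine (ae_restrict_iff' measurableSet_Ioi).2 (ae_of_all _ fun s hs => ?_)
  have hs' : (0 : ℝ) < s := hs
  rw [Real.norm_of_nonneg (by positivity), Real.rpow_one, mul_add, neg_add, Real.exp_add,
    Real.rpow_sub_one hs'.ne']
  -- The bound e^{−y} ≤ 1/y cancels the factor s^{−1} and leaves s^ν, which is integrable at 0 since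
  -- ν > −1.
  have h1 : Real.exp (-(c * (x ^ 2 / s))) ≤ s / (c * x ^ 2) := by
    rw [Real.exp_neg]
    refine inv_le_of_inv_le₀ (by positivity) ?_
    rw [inv_div]
    calc c * x ^ 2 / s = c * (x ^ 2 / s) := by ring
      _ ≤ c * (x ^ 2 / s) + 1 := by linarith
      _ ≤ _ := Real.add_one_le_exp _
  calc s ^ ν / s * (Real.exp (-(c * s)) * Real.exp (-(c * (x ^ 2 / s))))
      ≤ s ^ ν / s * (Real.exp (-(c * s)) * (s / (c * x ^ 2))) := by gcongr
    _ = _ := by rw [neg_mul]; field_simp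

theorem integral_exp_mul_cosh (hν : -1 < ν) {x : ℝ} (hx : 0 < x) :
    ∫ t : ℝ, Real.exp (ν * t) * Real.exp (-x * Real.cosh t) = 2 * besselK ν x := by
  have hint : Integrable fun t : ℝ => Real.exp (ν * t) * Real.exp (-x * Real.cosh t) := by
    have h := (integral_mixture_eq_integral_exp (c := 1 / 2) hx ν).1.1
      (integrableOn_mixture hν (by norm_num) hx)
    simpa using h
  have h1 : ∫ t : ℝ, Real.exp (ν * t) * Real.exp (-x * Real.cosh t) =
      ∫ t : ℝ, Real.exp (-x * Real.cosh |t|) * Real.cosh (ν * |t|) := by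
    have h2 := integral_neg_eq_self
      (fun t : ℝ => Real.exp (ν * t) * Real.exp (-x * Real.cosh t)) volume
    have h3 := integral_add hint hint.comp_neg
    rw [h2] at h3
    have h4 : ∀ t : ℝ, Real.exp (ν * t) * Real.exp (-x * Real.cosh t) +
        Real.exp (ν * -t) * Real.exp (-x * Real.cosh (-t)) =
        2 * (Real.exp (-x * Real.cosh |t|) * Real.cosh (ν * |t|)) := by
      intro t
      rw [Real.cosh_abs, ← Real.cosh_abs (ν * |t|), abs_mul, abs_abs, ← abs_mul, Real.cosh_abs,
        Real.cosh_neg, Real.cosh_eq (ν * t), mul_neg]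
      ring
    simp_rw [h4] at h3
    rw [integral_const_mul] at h3
    linarith
  rw [h1, integral_comp_abs (f := fun t => Real.exp (-x * Real.cosh t) * Real.cosh (ν * t))]
  rfl

/-- Completing the square: s + |z − τs|²/(s(1−τ²)) = (s + |z|²/s)/(1−τ²) − 2τ Re z/(1−τ²). For fixed
s the density in z is Gaussian about the real point τs, so polynomial integrals become explicit. -/
theorem weight_eq_integral (hν : -1 < ν) (hτ0 : 0 < τ) (hτ1 : τ < 1) {z : ℂ} (hz : z ≠ 0) :
    weight ν τ z = 1 / 2 * ∫ s in Set.Ioi (0 : ℝ), s ^ (ν - 1) * Real.exp (-s) *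
      Real.exp (-(‖z - (τ * s : ℝ)‖ ^ 2 / (s * (1 - τ ^ 2)))) := by
  have hv : 0 < 1 - τ ^ 2 := by nlinarith
  have hx : 0 < ‖z‖ := norm_pos_iff.2 hz
  have h1 := (integral_mixture_eq_integral_exp (c := (1 - τ ^ 2)⁻¹) hx ν).2
  have h2 : Set.EqOn (fun s : ℝ => s ^ (ν - 1) * Real.exp (-s) *
      Real.exp (-(‖z - (τ * s : ℝ)‖ ^ 2 / (s * (1 - τ ^ 2)))))
      (fun s => s ^ (ν - 1) * Real.exp (-((1 - τ ^ 2)⁻¹ * (s + ‖z‖ ^ 2 / s))) *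
        Real.exp (2 * τ / (1 - τ ^ 2) * z.re)) (Set.Ioi 0) := by
    intro s hs
    have hs' : (0 : ℝ) < s := hs
    simp only
    rw [mul_assoc, mul_assoc, ← Real.exp_add, ← Real.exp_add]
    congr 2
    rw [← Complex.normSq_eq_norm_sq, ← Complex.normSq_eq_norm_sq, Complex.normSq_apply,
      Complex.normSq_apply]
    simp only [Complex.sub_re, Complex.sub_im, Complex.ofReal_re, Complex.ofReal_im]
    field_simp
    ring
  rw [setIntegral_congr_fun measurableSet_Ioi h2, integral_mul_const, h1,
    integral_exp_mul_cosh hν (by positivity), weight,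
    show 2 * (1 - τ ^ 2)⁻¹ * ‖z‖ = 2 / (1 - τ ^ 2) * ‖z‖ by ring]
  ring

end mixture

/-! ### Inner products of polynomials with respect to the weight -/

/-- The density of the Gaussian mixture on `ℝ × ℂ` whose second marginal is twice the weight. -/
noncomputable def mixtureDensity (ν τ s : ℝ) (z : ℂ) : ℝ :=
  s ^ (ν - 1) * Real.exp (-s) * Real.exp (-(‖z - (τ * s : ℝ)‖ ^ 2 / (s * (1 - τ ^ 2))))

section bilinear

open Polynomial

variable {ν τ : ℝ}

theorem mixtureDensity_nonneg {s : ℝ} (hs : 0 < s) (z : ℂ) : 0 ≤ mixtureDensity ν τ s z := by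
  unfold mixtureDensity; positivity

theorem integral_mixtureDensity_mul (hv : 0 < 1 - τ ^ 2) {s : ℝ} (hs : 0 < s) (p q : ℂ[X]) {M : ℕ}
    (hp : p.natDegree < M) (hq : q.natDegree < M) :
    ∫ z : ℂ, (mixtureDensity ν τ s z : ℂ) * (p.eval z * q.eval (conj z)) =
      ∑ k ∈ Finset.range M, (Real.pi * (1 - τ ^ 2 : ℝ) * ((1 - τ ^ 2 : ℝ) ^ k * k !) : ℂ) *
        (((s ^ (ν + k) * Real.exp (-s) : ℝ) : ℂ) * ((hasseDeriv k p).comp (C (τ : ℂ) * X) *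
          (hasseDeriv k q).comp (C (τ : ℂ) * X)).eval (s : ℂ)) := by
  have h1 : ∀ z : ℂ, (mixtureDensity ν τ s z : ℂ) * (p.eval z * q.eval (conj z)) =
      ((s ^ (ν - 1) * Real.exp (-s) : ℝ) : ℂ) * (p.eval z * q.eval (conj z) *
        (Real.exp (-(‖z - (τ * s : ℝ)‖ ^ 2 / (s * (1 - τ ^ 2)))) : ℂ)) := by
    intro z
    rw [mixtureDensity]; push_cast; ring
  simp_rw [h1]
  rw [integral_const_mul, integral_polynomial_gaussian (mul_pos hs hv) p q _ hp hq,
    Finset.mul_sum]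
  refine Finset.sum_congr rfl fun k _ => ?_
  -- The Gaussian moment contributes s^{k+1}, which lifts the exponent ν − 1 to ν + k > −1.
  have h2 : s ^ (ν + k) = s ^ (ν - 1) * s ^ (k + 1) := by
    rw [← Real.rpow_natCast, ← Real.rpow_add hs]
    congr 1
    push_cast; ring
  rw [h2, eval_mul, eval_comp, eval_comp, eval_mul, eval_C, eval_X]
  push_cast
  rw [mul_pow]
  ring

theorem measurable_mixtureDensity :
    Measurable fun x : ℝ × ℂ => mixtureDensity ν τ x.1 x.2 := by
  unfold mixtureDensity
  have h : Measurable fun x : ℝ × ℂ => x.2 - ((τ * x.1 : ℝ) : ℂ) := by fun_prop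
  exact ((measurable_fst.pow_const _).mul (by fun_prop)).mul (by fun_prop)

/-- Taking for q the polynomial with conjugated coefficients makes the integrand nonnegative, so
joint integrability follows from the explicit inner integrals; the general case is then dominated by
two such terms. -/
theorem integrable_mixture_self (hν : -1 < ν) (hv : 0 < 1 - τ ^ 2) (p : ℂ[X]) :
    Integrable (fun x : ℝ × ℂ => mixtureDensity ν τ x.1 x.2 * ‖p.eval x.2‖ ^ 2)
      ((volume.restrict (Set.Ioi 0)).prod volume) := by
  have hmeas : Measurable fun x : ℝ × ℂ => mixtureDensity ν τ x.1 x.2 * ‖p.eval x.2‖ ^ 2 :=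
    measurable_mixtureDensity.mul
      (((p.continuous.measurable.comp measurable_snd).norm).pow_const 2)
  have hconj : ∀ z : ℂ, (‖p.eval z‖ ^ 2 : ℂ) =
      p.eval z * (p.map (starRingEnd ℂ)).eval (conj z) := by
    intro z
    rw [eval_map, eval₂_hom, Complex.mul_conj, Complex.normSq_eq_norm_sq]
    push_cast; rfl
  have hsec : ∀ s : ℝ, 0 < s →
      Integrable fun z : ℂ => mixtureDensity ν τ s z * ‖p.eval z‖ ^ 2 := by
    intro s hs
    have h := ((integrable_polynomial_gaussian (mul_pos hs hv) p (p.map (starRingEnd ℂ))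
      (τ * s)).const_mul ((s ^ (ν - 1) * Real.exp (-s) : ℝ) : ℂ)).re
    refine h.congr (ae_of_all _ fun z => ?_)
    simp only
    rw [← hconj, ← Complex.ofReal_pow, ← Complex.ofReal_mul, ← Complex.ofReal_mul]
    rw [RCLike.re_eq_complex_re, Complex.ofReal_re, mixtureDensity]
    ring
  refine (integrable_prod_iff hmeas.aestronglyMeasurable).2
    ⟨(ae_restrict_iff' measurableSet_Ioi).2 (ae_of_all _ hsec), ?_⟩
  set M := max p.natDegree (p.map (starRingEnd ℂ)).natDegree + 1 with hM
  have h2 : Integrable (fun s : ℝ => ∑ k ∈ Finset.range M,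
      (Real.pi * (1 - τ ^ 2 : ℝ) * ((1 - τ ^ 2 : ℝ) ^ k * k !) : ℂ) *
        (((s ^ (ν + k) * Real.exp (-s) : ℝ) : ℂ) * ((hasseDeriv k p).comp (C (τ : ℂ) * X) *
          (hasseDeriv k (p.map (starRingEnd ℂ))).comp (C (τ : ℂ) * X)).eval (s : ℂ)))
      (volume.restrict (Set.Ioi 0)) :=
    integrable_finsetSum _ fun k _ => ((integrableOn_gammaFunctional (by
      have : (0 : ℝ) ≤ k := k.cast_nonneg
      linarith) _).1).const_mul _
  refine h2.re.congr ((ae_restrict_iff' measurableSet_Ioi).2 (ae_of_all _ fun s hs => ?_))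
  have hs' : (0 : ℝ) < s := hs
  simp only
  rw [← integral_mixtureDensity_mul hv hs' p _ (Nat.lt_succ_of_le (le_max_left _ _))
    (Nat.lt_succ_of_le (le_max_right _ _))]
  simp_rw [← hconj, ← Complex.ofReal_pow, ← Complex.ofReal_mul]
  rw [integral_complex_ofReal]
  refine (Complex.ofReal_re _).trans (integral_congr_ae (ae_of_all _ fun z => ?_))
  exact (Real.norm_of_nonneg (mul_nonneg (mixtureDensity_nonneg hs' z) (sq_nonneg _))).symm

theorem integrable_mixture (hν : -1 < ν) (hv : 0 < 1 - τ ^ 2) (p q : ℂ[X]) :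
    Integrable (fun x : ℝ × ℂ => (mixtureDensity ν τ x.1 x.2 : ℂ) *
      (p.eval x.2 * q.eval (conj x.2))) ((volume.restrict (Set.Ioi 0)).prod volume) := by
  have hmeas : Measurable fun x : ℝ × ℂ => (mixtureDensity ν τ x.1 x.2 : ℂ) *
      (p.eval x.2 * q.eval (conj x.2)) := by
    refine (Complex.measurable_ofReal.comp measurable_mixtureDensity).mul
      ((p.continuous.measurable.comp measurable_snd).mul
        ((q.continuous.comp Complex.continuous_conj).measurable.comp measurable_snd))
  refine ((integrable_mixture_self hν hv p).add (integrable_mixture_self hν hv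
    (q.map (starRingEnd ℂ)))).mono' hmeas.aestronglyMeasurable ?_
  have h0 : ∀ᵐ x : ℝ × ℂ ∂(volume.restrict (Set.Ioi 0)).prod volume, 0 < x.1 :=
    Measure.quasiMeasurePreserving_fst.ae ((ae_restrict_iff' measurableSet_Ioi).2
      (ae_of_all _ fun s hs => hs))
  filter_upwards [h0] with x hx
  have h1 : ‖q.eval (conj x.2)‖ = ‖(q.map (starRingEnd ℂ)).eval x.2‖ := by
    rw [← RCLike.norm_conj, ← eval₂_hom, ← eval_map, Complex.conj_conj]
  rw [norm_mul, norm_mul, Complex.norm_real, Real.norm_of_nonneg (mixtureDensity_nonneg hx _), h1]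
  simp only [Pi.add_apply, ← mul_add]
  refine mul_le_mul_of_nonneg_left ?_ (mixtureDensity_nonneg hx _)
  nlinarith [sq_nonneg (‖p.eval x.2‖ - ‖(q.map (starRingEnd ℂ)).eval x.2‖),
    sq_nonneg ‖p.eval x.2‖, sq_nonneg ‖(q.map (starRingEnd ℂ)).eval x.2‖]

theorem polynomial_mul_weight_ae (hν : -1 < ν) (hτ0 : 0 < τ) (hτ1 : τ < 1) (p q : ℂ[X]) :
    (fun z : ℂ => 1 / 2 * ∫ s in Set.Ioi (0 : ℝ), (mixtureDensity ν τ s z : ℂ) *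
      (p.eval z * q.eval (conj z))) =ᵐ[volume]
    fun z => p.eval z * q.eval (conj z) * (weight ν τ z : ℂ) := by
  have h0 : ∀ᵐ z : ℂ, z ≠ 0 := by simp [ae_iff, measure_singleton]
  filter_upwards [h0] with z hz
  rw [integral_mul_const, weight_eq_integral hν hτ0 hτ1 hz, integral_complex_ofReal]
  simp only [mixtureDensity]
  push_cast
  ring

theorem integrable_polynomial_mul_weight (hν : -1 < ν) (hτ0 : 0 < τ) (hτ1 : τ < 1)
    (p q : ℂ[X]) :
    Integrable fun z : ℂ => p.eval z * q.eval (conj z) * (weight ν τ z : ℂ) :=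
  ((integrable_mixture hν (by nlinarith) p q).integral_prod_right.const_mul (1 / 2)).congr
    (polynomial_mul_weight_ae hν hτ0 hτ1 p q)

theorem integral_polynomial_mul_weight (hν : -1 < ν) (hτ0 : 0 < τ) (hτ1 : τ < 1)
    (p q : ℂ[X]) {M : ℕ} (hp : p.natDegree < M) (hq : q.natDegree < M) :
    ∫ z : ℂ, p.eval z * q.eval (conj z) * (weight ν τ z : ℂ) =
      (Real.pi * (1 - τ ^ 2 : ℝ) / 2 : ℂ) * ∑ k ∈ Finset.range M,
        ((1 - τ ^ 2 : ℝ) : ℂ) ^ k * k ! * gammaFunctional (ν + k)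
          ((hasseDeriv k p).comp (C (τ : ℂ) * X) * (hasseDeriv k q).comp (C (τ : ℂ) * X)) := by
  have hv : 0 < 1 - τ ^ 2 := by nlinarith
  have hk : ∀ k : ℕ, -1 < ν + k := fun k => by
    have : (0 : ℝ) ≤ k := k.cast_nonneg
    linarith
  rw [← integral_congr_ae (polynomial_mul_weight_ae hν hτ0 hτ1 p q), integral_const_mul,
    ← integral_integral_swap (integrable_mixture hν hv p q),
    setIntegral_congr_fun measurableSet_Ioi fun s hs =>
      integral_mixtureDensity_mul hv hs p q hp hq,
    integral_finsetSum _ fun k _ => ((integrableOn_gammaFunctional (hk k) _).1).const_mul _,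
    Finset.mul_sum, Finset.mul_sum]
  refine Finset.sum_congr rfl fun k _ => ?_
  rw [integral_const_mul, (integrableOn_gammaFunctional (hk k) _).2]
  ring

/-- The rescaled Laguerre polynomials are orthogonal with respect to the weight. -/
theorem integral_lag_mul_lag_mul_weight (hν : -1 < ν) (hτ0 : 0 < τ) (hτ1 : τ < 1) (m n : ℕ) :
    ∫ z : ℂ, (lag ν τ m).eval z * (lag ν τ n).eval (conj z) * (weight ν τ z : ℂ) =
      (Real.pi * (1 - τ ^ 2 : ℝ) / 2 : ℂ) *
        if m = n then ((Real.Gamma (m + ν + 1) / m ! : ℝ) : ℂ) else 0 := by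
  rw [integral_polynomial_mul_weight hν hτ0 hτ1 _ _ (M := max m n + 1)
    (Nat.lt_succ_of_le ((natDegree_lag_le τ m).trans (le_max_left _ _)))
    (Nat.lt_succ_of_le ((natDegree_lag_le τ n).trans (le_max_right _ _))),
    sum_gammaFunctional_lag hν τ (Nat.lt_succ_of_le (le_max_left _ _))]

end bilinear

/-! ### Skew-orthogonality -/

open Polynomial in
/-- The form `∫ p(z) q(z̄) w(z) d²z` on polynomials. -/
noncomputable def weightForm (ν τ : ℝ) (p q : ℂ[X]) : ℂ :=
  ∫ z : ℂ, p.eval z * q.eval (conj z) * (weight ν τ z : ℂ)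

open Polynomial in
/-- The skew-symmetric form `2 (⟨p, X q⟩ - ⟨X p, q⟩)`. -/
noncomputable def skewForm (ν τ : ℝ) (p q : ℂ[X]) : ℂ :=
  2 * (weightForm ν τ p (X * q) - weightForm ν τ (X * p) q)

section forms

open Polynomial

variable {ν τ : ℝ}

/-- The reflection z ↦ z̄ preserves both Lebesgue measure and the weight. -/
theorem weightForm_symm (p q : ℂ[X]) : weightForm ν τ p q = weightForm ν τ q p := by
  rw [weightForm, weightForm, ← Complex.conjLIE.measurePreserving.integral_comp
    Complex.conjLIE.toHomeomorph.measurableEmbedding]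
  refine integral_congr_ae (ae_of_all _ fun z => ?_)
  simp only [Complex.conjLIE_apply, Complex.conj_conj, weight_conj]
  ring

theorem weightForm_add_right (hν : -1 < ν) (hτ0 : 0 < τ) (hτ1 : τ < 1) (p q r : ℂ[X]) :
    weightForm ν τ p (q + r) = weightForm ν τ p q + weightForm ν τ p r := by
  rw [weightForm, weightForm, weightForm, ← integral_add
    (integrable_polynomial_mul_weight hν hτ0 hτ1 p q)
    (integrable_polynomial_mul_weight hν hτ0 hτ1 p r)]
  simp only [eval_add, mul_add, add_mul]

theorem weightForm_C_mul_right (p q : ℂ[X]) (a : ℂ) :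
    weightForm ν τ p (C a * q) = a * weightForm ν τ p q := by
  rw [weightForm, weightForm, ← integral_const_mul]
  refine integral_congr_ae (ae_of_all _ fun z => ?_)
  simp only [eval_mul, eval_C]
  ring

theorem weightForm_sub_right (hν : -1 < ν) (hτ0 : 0 < τ) (hτ1 : τ < 1) (p q r : ℂ[X]) :
    weightForm ν τ p (q - r) = weightForm ν τ p q - weightForm ν τ p r := by
  rw [weightForm, weightForm, weightForm, ← integral_sub
    (integrable_polynomial_mul_weight hν hτ0 hτ1 p q)
    (integrable_polynomial_mul_weight hν hτ0 hτ1 p r)]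
  simp only [eval_sub, mul_sub, sub_mul]

theorem skewForm_antisymm (p q : ℂ[X]) : skewForm ν τ q p = -skewForm ν τ p q := by
  rw [skewForm, skewForm, weightForm_symm q, weightForm_symm (X * q)]
  ring

theorem skewForm_add_right (hν : -1 < ν) (hτ0 : 0 < τ) (hτ1 : τ < 1) (p q r : ℂ[X]) :
    skewForm ν τ p (q + r) = skewForm ν τ p q + skewForm ν τ p r := by
  rw [skewForm, mul_add, weightForm_add_right hν hτ0 hτ1, weightForm_add_right hν hτ0 hτ1,
    skewForm, skewForm]
  ring

theorem skewForm_C_mul_right (p q : ℂ[X]) (a : ℂ) :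
    skewForm ν τ p (C a * q) = a * skewForm ν τ p q := by
  rw [skewForm, mul_left_comm, weightForm_C_mul_right, weightForm_C_mul_right, skewForm]
  ring

theorem skewForm_C_mul_left (p q : ℂ[X]) (a : ℂ) :
    skewForm ν τ (C a * p) q = a * skewForm ν τ p q := by
  rw [skewForm_antisymm, skewForm_C_mul_right, skewForm_antisymm p]
  ring

theorem skewForm_sum_left (hν : -1 < ν) (hτ0 : 0 < τ) (hτ1 : τ < 1) {ι : Type*} (s : Finset ι)
    (f : ι → ℂ[X]) (q : ℂ[X]) :
    skewForm ν τ (∑ i ∈ s, f i) q = ∑ i ∈ s, skewForm ν τ (f i) q := by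
  classical
  induction s using Finset.induction_on with
  | empty => simp [skewForm, weightForm]
  | insert i s hi ih =>
    rw [Finset.sum_insert hi, Finset.sum_insert hi, skewForm_antisymm,
      skewForm_add_right hν hτ0 hτ1, neg_add, ← skewForm_antisymm, ← skewForm_antisymm, ih]

/-- The pairings of neighbouring Laguerre polynomials, up to a factor. -/
noncomputable def skewNorm (ν τ : ℝ) (n : ℕ) : ℝ :=
  Real.pi * (1 - τ ^ 2) / 2 * (Real.Gamma ((n + 1 : ℕ) + ν + 1) / n !)

theorem weightForm_lag (hν : -1 < ν) (hτ0 : 0 < τ) (hτ1 : τ < 1) (m n : ℕ) :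
    weightForm ν τ (lag ν τ m) (lag ν τ n) =
      if m = n then ((Real.pi * (1 - τ ^ 2) / 2 * (Real.Gamma (n + ν + 1) / n !) : ℝ) : ℂ)
      else 0 := by
  rw [weightForm, integral_lag_mul_lag_mul_weight hν hτ0 hτ1]
  split_ifs with h
  · subst h; push_cast; ring
  · simp

/-- The diagonal m = n is left out because it drops out of the skew form. -/
theorem weightForm_lag_X_mul (hν : -1 < ν) (hτ0 : 0 < τ) (hτ1 : τ < 1) (m n : ℕ) (h : m ≠ n) :
    weightForm ν τ (lag ν τ m) (X * lag ν τ n) =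
      (if m = n + 1 then -(skewNorm ν τ n : ℂ) else 0) +
        if n = m + 1 then -(τ ^ 2 * skewNorm ν τ m : ℂ) else 0 := by
  have h1 : ∀ n : ℕ, (n + 1 : ℂ) * ((Real.pi * (1 - τ ^ 2) / 2 *
      (Real.Gamma ((n + 1 : ℕ) + ν + 1) / (n + 1)!) : ℝ) : ℂ) = skewNorm ν τ n := by
    intro n
    have hn : (n : ℂ) + 1 ≠ 0 := Nat.cast_add_one_ne_zero n
    have hn' : (n ! : ℂ) ≠ 0 := by exact_mod_cast n.factorial_ne_zero
    rw [skewNorm, Nat.factorial_succ]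
    push_cast
    field_simp
  have h2 : ∀ n : ℕ, ((n + 1 + ν : ℝ) : ℂ) * ((Real.pi * (1 - τ ^ 2) / 2 *
      (Real.Gamma (n + ν + 1) / n !) : ℝ) : ℂ) = skewNorm ν τ n := by
    intro n
    rw [skewNorm, gamma_nat_succ hν]
    push_cast
    ring
  cases n with
  | zero =>
    rw [lag_three_term_zero hν, weightForm_sub_right hν hτ0 hτ1, weightForm_C_mul_right,
      weightForm_lag hν hτ0 hτ1, weightForm_lag hν hτ0 hτ1, if_neg h, if_neg (by omega : ¬0 = m + 1),
      zero_add]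
    have := h1 0
    simp only [CharP.cast_eq_zero, zero_add, one_mul] at this
    split_ifs
    · rw [← this]; simp
    · simp
  | succ n =>
    rw [lag_three_term hν, weightForm_sub_right hν hτ0 hτ1, weightForm_sub_right hν hτ0 hτ1,
      weightForm_C_mul_right, weightForm_C_mul_right, weightForm_C_mul_right,
      weightForm_lag hν hτ0 hτ1, weightForm_lag hν hτ0 hτ1, weightForm_lag hν hτ0 hτ1, if_neg h]
    have e1 := h1 (n + 1)
    have e2 := h2 n
    by_cases hm : m = n
    · subst hm
      rw [if_neg (by omega : ¬m = m + 2), if_neg (by omega : ¬m = m + 1 + 1), if_pos rfl,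
        if_pos rfl, ← e2]
      push_cast
      ring
    · rw [if_neg hm, if_neg (by omega : ¬n + 1 = m + 1)]
      by_cases hm' : m = n + 2
      · rw [if_pos hm', if_pos hm', ← e1]
        push_cast
        ring_nf
      · rw [if_neg hm', if_neg hm']
        ring

theorem skewForm_lag (hν : -1 < ν) (hτ0 : 0 < τ) (hτ1 : τ < 1) (m n : ℕ) :
    skewForm ν τ (lag ν τ m) (lag ν τ n) = 2 * (1 - τ ^ 2 : ℝ) *
      ((if n = m + 1 then (skewNorm ν τ m : ℂ) else 0) -
        if m = n + 1 then (skewNorm ν τ n : ℂ) else 0) := by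
  by_cases h : m = n
  · subst h
    have := skewForm_antisymm (ν := ν) (τ := τ) (lag ν τ m) (lag ν τ m)
    simp [self_eq_neg.1 this]
  · rw [skewForm, weightForm_symm (X * _), weightForm_lag_X_mul hν hτ0 hτ1 m n h,
      weightForm_lag_X_mul hν hτ0 hτ1 n m (Ne.symm h)]
    push_cast
    split_ifs <;> ring_nf

/-- The balance that makes the two pairings of an odd polynomial, with its lower and its upper even
neighbour, cancel inside V_k. -/
theorem gammaRatio_mul_skewNorm (hν : -1 < ν) (l : ℕ) :
    gammaRatio ν (2 * l + 2) * skewNorm ν τ (2 * l + 1) =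
      gammaRatio ν (2 * l) * skewNorm ν τ (2 * l) := by
  have h := gammaRatio_add_two hν (2 * l)
  have hl : ((2 * l : ℕ) : ℝ) + 1 ≠ 0 := by positivity
  rw [skewNorm, skewNorm, gamma_nat_succ hν (2 * l + 1), Nat.factorial_succ]
  push_cast at h hl ⊢
  have h' := ((2 * l)).factorial_ne_zero
  field_simp
  linear_combination (1 - τ ^ 2) * Real.Gamma (2 * l + 1 + ν + 1) * h

/-- Only the summands j = l and j = l + 1 of V_k pair with P_{2l+1}. For k > l both occur and
cancel, for k = l only the first occurs, for k < l neither. -/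
theorem skewForm_evenPoly_lag (hν : -1 < ν) (hτ0 : 0 < τ) (hτ1 : τ < 1) (k l : ℕ) :
    skewForm ν τ (evenPoly ν τ k) (lag ν τ (2 * l + 1)) =
      if k = l then ((2 * (1 - τ ^ 2) * (gammaRatio ν (2 * l) * skewNorm ν τ (2 * l)) : ℝ) : ℂ)
      else 0 := by
  have h1 : ∀ j : ℕ, skewForm ν τ (C ((gammaRatio ν (2 * j) : ℝ) : ℂ) * lag ν τ (2 * j))
      (lag ν τ (2 * l + 1)) =
      (2 * (1 - τ ^ 2) * (gammaRatio ν (2 * l) * skewNorm ν τ (2 * l)) : ℝ) *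
        ((if j = l then 1 else 0) - if j = l + 1 then 1 else 0) := by
    intro j
    rw [skewForm_C_mul_left, skewForm_lag hν hτ0 hτ1]
    by_cases hj : j = l
    · subst hj
      rw [if_pos rfl, if_neg (by omega), if_pos rfl, if_neg (by omega)]
      push_cast; ring
    · rw [if_neg (by omega), if_neg hj]
      by_cases hj' : j = l + 1
      · subst hj'
        have := gammaRatio_mul_skewNorm (τ := τ) hν l
        rw [if_pos (by omega), if_pos rfl, ← this, mul_add]
        push_cast; ring
      · rw [if_neg (by omega), if_neg hj']
        simp
  rw [evenPoly, skewForm_sum_left hν hτ0 hτ1]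
  simp_rw [h1]
  rw [← Finset.mul_sum, Finset.sum_sub_distrib, Finset.sum_ite_eq', Finset.sum_ite_eq']
  simp only [Finset.mem_range]
  rcases lt_trichotomy k l with h | h | h
  · rw [if_neg (by omega), if_neg (by omega), if_neg (by omega)]; simp
  · rw [if_pos (by omega), if_neg (by omega), if_pos h]; simp
  · rw [if_pos (by omega), if_pos (by omega), if_neg (by omega)]; simp

theorem skewForm_evenPoly_evenPoly (hν : -1 < ν) (hτ0 : 0 < τ) (hτ1 : τ < 1) (k l : ℕ) :
    skewForm ν τ (evenPoly ν τ k) (evenPoly ν τ l) = 0 := by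
  rw [evenPoly, skewForm_sum_left hν hτ0 hτ1]
  refine Finset.sum_eq_zero fun i _ => ?_
  rw [skewForm_antisymm, evenPoly, skewForm_sum_left hν hτ0 hτ1, neg_eq_zero]
  refine Finset.sum_eq_zero fun j _ => ?_
  rw [skewForm_C_mul_left, skewForm_C_mul_right, skewForm_lag hν hτ0 hτ1, if_neg (by omega),
    if_neg (by omega)]
  simp

theorem skewForm_odd_odd (hν : -1 < ν) (hτ0 : 0 < τ) (hτ1 : τ < 1) (k l : ℕ) :
    skewForm ν τ (lag ν τ (2 * k + 1)) (lag ν τ (2 * l + 1)) = 0 := by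
  rw [skewForm_lag hν hτ0 hτ1, if_neg (by omega), if_neg (by omega)]
  simp

/-- The skew-orthonormal polynomials, in pairs of degrees `2 k` and `2 k + 1`. -/
noncomputable def skewBasis (ν τ : ℝ) (k : ℕ) : Fin 2 → ℂ[X] :=
  ![evenPoly ν τ k, C ((Real.Gamma (ν + 2) / 2 ^ (ν + 1) * gammaRatio ν (2 * k + 1) : ℝ) : ℂ) *
    lag ν τ (2 * k + 1)]

theorem preKernel_eq_sum_skewBasis (hτ : τ ≠ 0) (N : ℕ) (z u : ℂ) :
    preKernel ν τ N z u = ∑ c : Fin N,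
      ((skewBasis ν τ c 0).eval z * (skewBasis ν τ c 1).eval u -
        (skewBasis ν τ c 1).eval z * (skewBasis ν τ c 0).eval u) := by
  rw [preKernel_eq hτ, Finset.sum_range, Finset.mul_sum]
  refine Finset.sum_congr rfl fun k _ => ?_
  simp only [skewBasis, Matrix.cons_val_zero, Matrix.cons_val_one, eval_mul, eval_C]
  push_cast
  ring

/-- By the duplication formula the normalised odd polynomial has the same skew norm for every k. -/
theorem skewForm_skewBasis_zero_one (hν : -1 < ν) (hτ0 : 0 < τ) (hτ1 : τ < 1) (k l : ℕ) :
    skewForm ν τ (skewBasis ν τ k 0) (skewBasis ν τ l 1) =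
      if k = l then ((Real.pi * Real.Gamma (ν + 2) * (1 - τ ^ 2) ^ 2 : ℝ) : ℂ) else 0 := by
  simp only [skewBasis, Matrix.cons_val_zero, Matrix.cons_val_one]
  rw [skewForm_C_mul_right, skewForm_evenPoly_lag hν hτ0 hτ1, mul_ite, mul_zero,
    ← Complex.ofReal_mul]
  congr 2
  have h := gammaRatio_mul_succ hν (2 * l)
  have h2 := (gamma_nat_pos hν (2 * l)).ne'
  have h3 : (2 : ℝ) ^ (ν + 1) ≠ 0 := by positivity
  have h' := ((2 * l)).factorial_ne_zero
  rw [hilleCoeff] at h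
  rw [skewNorm, gamma_nat_succ hν]
  field_simp at h ⊢
  linear_combination (1 - τ ^ 2) ^ 2 * Real.Gamma (ν + 2) * h

theorem skewForm_skewBasis (hν : -1 < ν) (hτ0 : 0 < τ) (hτ1 : τ < 1) {ι : Type*} [Fintype ι]
    [DecidableEq ι] {e : ι → ℕ} (he : Function.Injective e) (p q : ι × Fin 2) :
    skewForm ν τ (skewBasis ν τ (e p.1) p.2) (skewBasis ν τ (e q.1) q.2) =
      ((Real.pi * Real.Gamma (ν + 2) * (1 - τ ^ 2) ^ 2 : ℝ) : ℂ) *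
        ∑ d, ((if p = (d, 0) then 1 else 0) * (if q = (d, 1) then 1 else 0) -
          (if q = (d, 0) then 1 else 0) * (if p = (d, 1) then 1 else 0)) := by
  obtain ⟨k, i⟩ := p
  obtain ⟨l, j⟩ := q
  fin_cases i <;> fin_cases j
  · simp [skewBasis, skewForm_evenPoly_evenPoly hν hτ0 hτ1]
  · have h := skewForm_skewBasis_zero_one hν hτ0 hτ1 (e k) (e l)
    simp only [Fin.zero_eta, Fin.mk_one, Prod.mk.injEq, he.eq_iff] at h ⊢
    rw [h]
    rcases eq_or_ne k l with rfl | hkl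
    · simp
    · rw [if_neg hkl, Finset.sum_eq_zero, mul_zero]
      rintro d -
      rcases eq_or_ne k d with rfl | hd
      · simp [Ne.symm hkl]
      · simp [hd]
  · have h := skewForm_skewBasis_zero_one hν hτ0 hτ1 (e l) (e k)
    simp only [Fin.zero_eta, Fin.mk_one, Prod.mk.injEq, he.eq_iff] at h ⊢
    rw [skewForm_antisymm, h]
    rcases eq_or_ne l k with rfl | hkl
    · simp
    · rw [if_neg hkl, Finset.sum_eq_zero, mul_zero, neg_zero]
      rintro d -
      rcases eq_or_ne l d with rfl | hd
      · simp [Ne.symm hkl]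
      · simp [hd]
  · change skewForm ν τ (C _ * lag _ _ _) (C _ * lag _ _ _) = _
    rw [skewForm_C_mul_left, skewForm_C_mul_right, skewForm_odd_odd hν hτ0 hτ1]
    simp

end forms

/-! ### The joint density as a determinant -/

/-- The points `z_i` and `z̄_i`. -/
def conjPair {ι : Type*} (z : ι → ℂ) (q : ι × Fin 2) : ℂ := ![z q.1, conj (z q.1)] q.2

section vandermonde

open Polynomial

variable {ν τ : ℝ}

theorem natDegree_skewBasis_le (k : ℕ) (i : Fin 2) :
    (skewBasis ν τ k i).natDegree ≤ (i : ℕ) + 2 * k := by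
  fin_cases i
  · change (∑ l ∈ Finset.range (k + 1), _ : ℂ[X]).natDegree ≤ 0 + 2 * k
    refine natDegree_sum_le_of_forall_le _ _ fun l hl => ?_
    refine (natDegree_C_mul_le _ _).trans ((natDegree_lag_le τ _).trans ?_)
    have := Finset.mem_range.1 hl
    omega
  · change (C _ * lag _ _ _ : ℂ[X]).natDegree ≤ 1 + 2 * k
    refine (natDegree_C_mul_le _ _).trans ((natDegree_lag_le τ _).trans ?_)
    omega

theorem coeff_skewBasis_ne_zero (hν : -1 < ν) (k : ℕ) (i : Fin 2) :
    (skewBasis ν τ k i).coeff ((i : ℕ) + 2 * k) ≠ 0 := by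
  have h : ∀ n, (gammaRatio ν n : ℂ) ≠ 0 := fun n => by exact_mod_cast (gammaRatio_pos hν n).ne'
  have h1 : ∀ n : ℕ, ((-1 : ℂ) ^ n / n !) ≠ 0 := fun n => by
    have := n.factorial_ne_zero
    exact div_ne_zero (pow_ne_zero _ (by norm_num)) (by exact_mod_cast this)
  fin_cases i
  · change (∑ l ∈ Finset.range (k + 1), C _ * lag _ _ _ : ℂ[X]).coeff (0 + 2 * k) ≠ 0
    rw [zero_add, Finset.sum_range_succ, coeff_add, finsetSum_coeff, Finset.sum_eq_zero, zero_add,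
      coeff_C_mul, coeff_lag_self τ hν]
    · exact mul_ne_zero (h _) (h1 _)
    · intro l hl
      have := Finset.mem_range.1 hl
      rw [coeff_C_mul, coeff_eq_zero_of_natDegree_lt, mul_zero]
      exact (natDegree_lag_le τ _).trans_lt (by omega)
  · change (C _ * lag _ _ _ : ℂ[X]).coeff (1 + 2 * k) ≠ 0
    rw [add_comm 1, coeff_C_mul, coeff_lag_self τ hν]
    refine mul_ne_zero ?_ (h1 _)
    have h2 : 0 < Real.Gamma (ν + 2) := Real.Gamma_pos_of_pos (by linarith)
    have h3 := gammaRatio_pos hν (2 * k + 1)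
    rw [Complex.ofReal_ne_zero]
    positivity

theorem prod_Ioi_eq_prod_ite {ι : Type*} [Fintype ι] [LinearOrder ι] [LocallyFiniteOrderTop ι]
    (f : ι → ι → ℂ) :
    ∏ i, ∏ j ∈ Finset.Ioi i, f i j = ∏ i, ∏ j, if i < j then f i j else 1 := by
  refine Finset.prod_congr rfl fun i _ => ?_
  rw [← Finset.prod_filter]
  congr 1
  ext j
  simp

/-- The index order i + 2k puts z_k and z̄_k next to each other. Each pair gives z̄_k − z_k, and the
four differences between two pairs multiply to the two squared moduli. -/
theorem det_vandermonde_conjPair {n : ℕ} (z : Fin n → ℂ) :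
    (Matrix.vandermonde fun j : Fin (n * 2) => conjPair z (finProdFinEquiv.symm j)).det =
      (∏ k, ∏ l ∈ Finset.Iio k, ((‖z k - z l‖ ^ 2 * ‖z k - conj (z l)‖ ^ 2 : ℝ) : ℂ)) *
        ∏ j, (conj (z j) - z j) := by
  have hlt : ∀ a b : Fin n, ∀ i j : Fin 2, finProdFinEquiv (a, i) < finProdFinEquiv (b, j) ↔
      a < b ∨ a = b ∧ i < j := by
    intro a b i j
    simp only [Fin.lt_def, finProdFinEquiv_apply_val, Fin.ext_iff]
    omega
  rw [Matrix.det_vandermonde, prod_Ioi_eq_prod_ite, ← finProdFinEquiv.prod_comp]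
  simp_rw [← (finProdFinEquiv (m := n) (n := 2)).prod_comp fun j => ite _ _ _,
    Equiv.symm_apply_apply, Fintype.prod_prod_type, hlt, Fin.prod_univ_two]
  have h1 : ∀ a : Fin n, (∏ b : Fin n, (
      (if a < b ∨ a = b ∧ (0 : Fin 2) < 0 then conjPair z (b, 0) - conjPair z (a, 0) else 1) *
      (if a < b ∨ a = b ∧ (0 : Fin 2) < 1 then conjPair z (b, 1) - conjPair z (a, 0) else 1))) *
      (∏ b : Fin n, (
      (if a < b ∨ a = b ∧ (1 : Fin 2) < 0 then conjPair z (b, 0) - conjPair z (a, 1) else 1) *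
      (if a < b ∨ a = b ∧ (1 : Fin 2) < 1 then conjPair z (b, 1) - conjPair z (a, 1) else 1))) =
      (∏ b : Fin n, if a < b then
        ((‖z b - z a‖ ^ 2 * ‖z b - conj (z a)‖ ^ 2 : ℝ) : ℂ) else 1) * (conj (z a) - z a) := by
    intro a
    rw [← Finset.prod_mul_distrib]
    have h2 : (conj (z a) - z a) = ∏ b : Fin n, if a = b then conj (z a) - z a else 1 := by
      rw [Finset.prod_ite_eq]; simp
    rw [h2, ← Finset.prod_mul_distrib]
    refine Finset.prod_congr rfl fun b _ => ?_
    rcases lt_trichotomy a b with hab | hab | hab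
    · have e1 := Complex.mul_conj (z b - z a)
      have e2 := Complex.mul_conj (z b - conj (z a))
      rw [Complex.normSq_eq_norm_sq] at e1 e2
      simp only [hab, hab.ne, true_or, if_true, if_false, conjPair, Matrix.cons_val_zero,
        Matrix.cons_val_one, mul_one]
      rw [Complex.ofReal_mul, ← e1, ← e2]
      simp only [map_sub, Complex.conj_conj]
      ring
    · subst hab
      simp [conjPair]
    · simp [hab.not_gt, hab.ne']
  rw [Finset.prod_congr rfl fun a _ => h1 a, Finset.prod_mul_distrib, Finset.prod_comm]
  congr 1
  refine Finset.prod_congr rfl fun k _ => ?_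
  rw [← Finset.prod_filter]
  congr 1
  ext j
  simp

/-- The determinant of the skew-orthonormal polynomials at the points and their conjugates. -/
noncomputable def skewDet (ν τ : ℝ) {n : ℕ} (z : Fin n → ℂ) : ℂ :=
  (Matrix.of fun p q : Fin n × Fin 2 => (skewBasis ν τ p.1 p.2).eval (conjPair z q)).det

/-- The basis polynomial with index (k, i) has exact degree i + 2k, so the change of basis from
monomials is triangular with nonzero diagonal. -/
theorem exists_skewDet_eq (hν : -1 < ν) (n : ℕ) : ∃ c : ℂ, c ≠ 0 ∧ ∀ z : Fin n → ℂ,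
    skewDet ν τ z = c *
      ((∏ k, ∏ l ∈ Finset.Iio k, ((‖z k - z l‖ ^ 2 * ‖z k - conj (z l)‖ ^ 2 : ℝ) : ℂ)) *
        ∏ j, (conj (z j) - z j)) := by
  set P : Fin (n * 2) → ℂ[X] := fun j =>
    skewBasis ν τ (finProdFinEquiv.symm j).1 (finProdFinEquiv.symm j).2 with hP
  have hval : ∀ j : Fin (n * 2), (j : ℕ) =
      ((finProdFinEquiv.symm j).2 : ℕ) + 2 * ((finProdFinEquiv.symm j).1 : ℕ) := by
    intro j
    conv_lhs => rw [← finProdFinEquiv.apply_symm_apply j]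
    rw [finProdFinEquiv_apply_val]
  have hdeg : ∀ j, (P j).natDegree ≤ j := fun j => by
    rw [hval j]; exact natDegree_skewBasis_le _ _
  refine ⟨∏ j, (P j).coeff j, Finset.prod_ne_zero_iff.2 fun j _ => ?_, fun z => ?_⟩
  · rw [hval j]; exact coeff_skewBasis_ne_zero hν _ _
  · rw [← det_vandermonde_conjPair, skewDet, ← Matrix.det_transpose (Matrix.of _),
      ← Matrix.det_submatrix_equiv_self finProdFinEquiv.symm]
    have h := congrArg Matrix.det
      (Matrix.eval_matrixOfPolynomials_eq_vandermonde_mul_matrixOfPolynomials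
        (fun j : Fin (n * 2) => conjPair z (finProdFinEquiv.symm j)) P hdeg)
    rw [Matrix.det_mul, Matrix.det_of_isUpperTriangular
      (Matrix.matrixOfPolynomials_blockTriangular P hdeg)] at h
    exact h.trans (mul_comm _ _)

/-- ∏ |z_j − z̄_j|² = (−1)^n ∏ (z̄_j − z_j)²: one factor completes the Vandermonde determinant, the
other stays with the weight. The constant need not be known, since normalisation removes it. -/
theorem exists_jointWeight_eq (ν τ : ℝ) (hν : -1 < ν) (n : ℕ) :
    ∃ c : ℂ, c ≠ 0 ∧ ∀ z : Fin n → ℂ, (jointWeight ν τ z : ℂ) =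
      c * (skewDet ν τ z * ∏ i, ((conj (z i) - z i) * weight ν τ (z i))) := by
  obtain ⟨c, hc, h⟩ := exists_skewDet_eq (τ := τ) hν n
  refine ⟨(-1) ^ n / c, div_ne_zero (by simp) hc, fun z => ?_⟩
  have h1 : ((∏ j, ‖z j - conj (z j)‖ ^ 2 : ℝ) : ℂ) =
      (-1) ^ n * ((∏ j, (conj (z j) - z j)) * ∏ j, (conj (z j) - z j)) := by
    rw [← Finset.prod_mul_distrib]
    have : (-1 : ℂ) ^ n = ∏ _j : Fin n, (-1 : ℂ) := by simp
    rw [this, ← Finset.prod_mul_distrib, Complex.ofReal_prod]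
    refine Finset.prod_congr rfl fun j _ => ?_
    rw [← Complex.normSq_eq_norm_sq, ← Complex.mul_conj, map_sub, Complex.conj_conj]
    ring
  rw [h, jointWeight, Complex.ofReal_mul, Complex.ofReal_mul, h1, Finset.prod_mul_distrib]
  push_cast
  field_simp

end vandermonde

/-! ### Correlation functions as Pfaffians -/

/-- The pre-kernel at the points `z_i` and `z̄_i`. -/
noncomputable def preKernelMatrix (ν τ : ℝ) (n : ℕ) {k : ℕ} (z : Fin k → ℂ) :
    Matrix (Fin k × Fin 2) (Fin k × Fin 2) ℂ :=
  Matrix.of fun p q => preKernel ν τ n (conjPair z p) (conjPair z q)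

section correlations

open Polynomial

variable {ν τ : ℝ}

/-- The normalisation `π Γ(ν + 2) (1 - τ²)²` of the skew-orthogonal polynomials. -/
noncomputable def skewConst (ν τ : ℝ) : ℝ := Real.pi * Real.Gamma (ν + 2) * (1 - τ ^ 2) ^ 2

theorem integrable_skew_pairing (hν : -1 < ν) (hτ0 : 0 < τ) (hτ1 : τ < 1) (p q : ℂ[X]) :
    Integrable fun y : ℂ => p.eval y * q.eval (conj y) * ((conj y - y) * (weight ν τ y : ℂ)) := by
  refine ((integrable_polynomial_mul_weight hν hτ0 hτ1 p (X * q)).sub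
    (integrable_polynomial_mul_weight hν hτ0 hτ1 (X * p) q)).congr (ae_of_all _ fun y => ?_)
  simp only [Pi.sub_apply, eval_mul, eval_X]
  ring

theorem integral_skew_pairing (hν : -1 < ν) (hτ0 : 0 < τ) (hτ1 : τ < 1) (p q : ℂ[X]) :
    ∫ y : ℂ, p.eval y * q.eval (conj y) * ((conj y - y) * (weight ν τ y : ℂ)) =
      weightForm ν τ p (X * q) - weightForm ν τ (X * p) q := by
  rw [weightForm, weightForm, ← integral_sub
    (integrable_polynomial_mul_weight hν hτ0 hτ1 p (X * q))
    (integrable_polynomial_mul_weight hν hτ0 hτ1 (X * p) q)]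
  refine integral_congr_ae (ae_of_all _ fun y => ?_)
  simp only [eval_mul, eval_X]
  ring

variable {α β : Type*} [Fintype α] [Fintype β] [DecidableEq α] [DecidableEq β]

theorem skewDet_eq_sum {n : ℕ} (e : α ⊕ β ≃ Fin n) (z : α → ℂ) (y : β → ℂ) :
    skewDet ν τ (fun i => Sum.elim z y (e.symm i)) =
      ∑ σ : Equiv.Perm ((α ⊕ β) × Fin 2), ((Equiv.Perm.sign σ : ℤ) : ℂ) *
        ((∏ a, ((skewBasis ν τ (e (σ (Sum.inl a, 0)).1) (σ (Sum.inl a, 0)).2).eval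
            (conjPair z (a, 0)) *
          (skewBasis ν τ (e (σ (Sum.inl a, 1)).1) (σ (Sum.inl a, 1)).2).eval
            (conjPair z (a, 1)))) *
        ∏ b, ((skewBasis ν τ (e (σ (Sum.inr b, 0)).1) (σ (Sum.inr b, 0)).2).eval (y b) *
          (skewBasis ν τ (e (σ (Sum.inr b, 1)).1) (σ (Sum.inr b, 1)).2).eval (conj (y b)))) := by
  rw [skewDet, ← Matrix.det_submatrix_equiv_self (e.prodCongr (Equiv.refl (Fin 2))),
    det_prod_fin_two]
  refine Finset.sum_congr rfl fun σ _ => ?_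
  rw [Fintype.prod_sum_type]
  simp [conjPair]

/-- Here α indexes the fixed points and β the integrated ones. Each permutation term factorises over
β into pairings of basis polynomials, and `sum_perm_pairing` evaluates the resulting sum. -/
theorem integral_jointWeight (hν : -1 < ν) (hτ0 : 0 < τ) (hτ1 : τ < 1) {n : ℕ} {C₀ : ℂ}
    (hC : ∀ z : Fin n → ℂ, (jointWeight ν τ z : ℂ) =
      C₀ * (skewDet ν τ z * ∏ i, ((conj (z i) - z i) * weight ν τ (z i))))
    (e : α ⊕ β ≃ Fin n) (z : α → ℂ) :
    ((Fintype.card α)! : ℂ) *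
      ((∫ y : β → ℂ, jointWeight ν τ (fun i => Sum.elim z y (e.symm i)) : ℝ) : ℂ) =
    C₀ * (∏ a, ((conj (z a) - z a) * weight ν τ (z a))) *
      ((skewConst ν τ : ℂ) ^ Fintype.card β * (Fintype.card β)! * ∑ c : α → α ⊕ β,
        (Matrix.of fun p q : α × Fin 2 =>
          (skewBasis ν τ (e (c p.1)) p.2).eval (conjPair z q)).det) := by
  set X₀ : Matrix ((α ⊕ β) × Fin 2) (α × Fin 2) ℂ :=
    fun p q => (skewBasis ν τ (e p.1) p.2).eval (conjPair z q) with hX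
  set g : (α ⊕ β) × Fin 2 → (α ⊕ β) × Fin 2 → ℂ → ℂ := fun p q y =>
    (skewBasis ν τ (e p.1) p.2).eval y * (skewBasis ν τ (e q.1) q.2).eval (conj y) *
      ((conj y - y) * (weight ν τ y : ℂ)) with hg
  have hpair := sum_perm_pairing X₀ (fun p q => ∫ y, g p q y) (skewConst ν τ : ℂ) (by
    intro p q
    rw [skewConst, ← skewForm_skewBasis hν hτ0 hτ1
      (e := fun i => (e i : ℕ)) (Fin.val_injective.comp e.injective)]
    simp only [hg, integral_skew_pairing hν hτ0 hτ1]
    rw [skewForm, weightForm_symm (skewBasis ν τ (e q.1) q.2),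
      weightForm_symm (X * skewBasis ν τ (e q.1) q.2)]
    ring)
  have hrhs : ∑ c : α → α ⊕ β, (Matrix.of fun p q : α × Fin 2 =>
      (skewBasis ν τ (e (c p.1)) p.2).eval (conjPair z q)).det =
      ∑ c : α → α ⊕ β, (X₀.submatrix (fun p : α × Fin 2 => (c p.1, p.2)) id).det := rfl
  rw [hrhs, ← hpair, mul_left_comm]
  congr 1
  have hint : ∀ y : β → ℂ, (jointWeight ν τ (fun i => Sum.elim z y (e.symm i)) : ℂ) =
      ∑ σ : Equiv.Perm ((α ⊕ β) × Fin 2),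
        (C₀ * (∏ a, ((conj (z a) - z a) * weight ν τ (z a))) * (((Equiv.Perm.sign σ : ℤ) : ℂ) *
          ∏ a, (X₀ (σ (Sum.inl a, 0)) (a, 0) * X₀ (σ (Sum.inl a, 1)) (a, 1)))) *
        ∏ b, g (σ (Sum.inr b, 0)) (σ (Sum.inr b, 1)) (y b) := by
    intro y
    rw [hC, skewDet_eq_sum, ← e.prod_comp, Fintype.prod_sum_type]
    simp only [Equiv.symm_apply_apply, Sum.elim_inl, Sum.elim_inr, hg,
      Finset.prod_mul_distrib (s := (Finset.univ : Finset β))]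
    rw [Finset.sum_mul, Finset.mul_sum]
    refine Finset.sum_congr rfl fun σ _ => ?_
    simp only [hX]
    ring
  rw [← integral_complex_ofReal]
  simp_rw [hint]
  have hgint : ∀ (c : ℂ) (σ : Equiv.Perm ((α ⊕ β) × Fin 2)), Integrable fun y : β → ℂ =>
      c * ∏ b, g (σ (Sum.inr b, 0)) (σ (Sum.inr b, 1)) (y b) := fun c σ =>
    (Integrable.fintype_prod fun b => integrable_skew_pairing hν hτ0 hτ1 _ _).const_mul c
  rw [integral_finsetSum _ fun σ _ => hgint _ σ, Finset.mul_sum]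
  refine Finset.sum_congr rfl fun σ _ => ?_
  rw [integral_const_mul, integral_fintype_prod_volume_eq_prod]
  ring

theorem skewConst_pos (hν : -1 < ν) (hτ0 : 0 < τ) (hτ1 : τ < 1) : 0 < skewConst ν τ := by
  have h1 : 0 < 1 - τ ^ 2 := by nlinarith
  have h2 : 0 < Real.Gamma (ν + 2) := Real.Gamma_pos_of_pos (by linarith)
  unfold skewConst
  positivity

theorem pfaffian_preKernel (hτ : τ ≠ 0) {ι : Type*} [Fintype ι] {k n : ℕ} (e : ι ≃ Fin n)
    (z : Fin k → ℂ) : (k ! : ℂ) *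
      pfaffian (preKernelMatrix ν τ n z) =
    ∑ c : Fin k → ι, (Matrix.of fun p q : Fin k × Fin 2 =>
      (skewBasis ν τ (e (c p.1)) p.2).eval (conjPair z q)).det := by
  have h := pfaffian_eq_sum_det (fun (p : ι × Fin 2) (q : Fin k × Fin 2) =>
    (skewBasis ν τ (e p.1) p.2).eval (conjPair z q))
  have hk : (k ! : ℂ) ≠ 0 := by exact_mod_cast k.factorial_ne_zero
  have h1 : preKernelMatrix ν τ n z =
      Matrix.of fun p q => ∑ c : ι, ((skewBasis ν τ (e c) 0).eval (conjPair z p) *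
        (skewBasis ν τ (e c) 1).eval (conjPair z q) - (skewBasis ν τ (e c) 1).eval (conjPair z p) *
          (skewBasis ν τ (e c) 0).eval (conjPair z q)) := by
    ext p q
    rw [preKernelMatrix, Matrix.of_apply, preKernel_eq_sum_skewBasis hτ, ← e.sum_comp]
    rfl
  rw [h1]
  refine (congrArg ((k ! : ℂ) * ·) h).trans ?_
  simp only [mul_inv_cancel_left₀ hk]
  rfl

theorem pfaffian_fin_zero (A : Matrix (Fin 0 × Fin 2) (Fin 0 × Fin 2) ℂ) : pfaffian A = 1 := by
  simp [pfaffian]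

/-- The case of no fixed points, with the empty Pfaffian equal to 1. -/
theorem partitionFunction_eq (hν : -1 < ν) (hτ0 : 0 < τ) (hτ1 : τ < 1) {n : ℕ} {C₀ : ℂ}
    (hC : ∀ z : Fin n → ℂ, (jointWeight ν τ z : ℂ) =
      C₀ * (skewDet ν τ z * ∏ i, ((conj (z i) - z i) * weight ν τ (z i)))) :
    (partitionFunction ν τ n : ℂ) = C₀ * ((skewConst ν τ : ℂ) ^ n * n !) := by
  have h := integral_jointWeight hν hτ0 hτ1 hC (Equiv.emptySum (Fin 0) (Fin n)) Fin.elim0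
  rw [← pfaffian_preKernel hτ0.ne' (Equiv.emptySum (Fin 0) (Fin n)), pfaffian_fin_zero] at h
  simpa [partitionFunction] using h

/-- The unknown constant cancels against the partition function, and N!/(N−k)! cancels the
factorials of the two integrations. -/
theorem corr_eq_pfaffian (hν : -1 < ν) (hτ0 : 0 < τ) (hτ1 : τ < 1) {N k : ℕ} (hk : k ≤ N)
    (z : Fin k → ℂ) : (corr ν τ N k z : ℂ) = ((skewConst ν τ : ℂ) ^ k)⁻¹ *
      (pfaffian (preKernelMatrix ν τ N z) *
        ∏ i, ((conj (z i) - z i) * weight ν τ (z i))) := by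
  obtain ⟨m, rfl⟩ := Nat.exists_eq_add_of_le hk
  obtain ⟨C₀, hC₀, hC⟩ := exists_jointWeight_eq ν τ hν (k + m)
  have h1 := integral_jointWeight hν hτ0 hτ1 hC finSumFinEquiv z
  have h2 : ∀ y : Fin m → ℂ, (fun i => Sum.elim z y (finSumFinEquiv.symm i)) =
      Fin.append z y := by
    intro y
    ext i
    refine Fin.addCases (fun i => ?_) (fun i => ?_) i <;> simp
  simp_rw [h2] at h1
  rw [← pfaffian_preKernel hτ0.ne', Fintype.card_fin, Fintype.card_fin] at h1
  have h3 : ∫ y : Fin (k + m - k) → ℂ, (jointWeight ν τ (Fin.append z y)) =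
      ∫ y : Fin m → ℂ, (jointWeight ν τ (Fin.append z y)) := by
    have : ∀ m', m' = m → ∫ y : Fin m' → ℂ, (jointWeight ν τ (Fin.append z y)) =
      ∫ y : Fin m → ℂ, (jointWeight ν τ (Fin.append z y)) := by
      rintro _ rfl; rfl
    exact this _ (Nat.add_sub_cancel_left k m)
  have hρ : (skewConst ν τ : ℂ) ≠ 0 := by exact_mod_cast (skewConst_pos hν hτ0 hτ1).ne'
  have hk' : (k ! : ℂ) ≠ 0 := by exact_mod_cast k.factorial_ne_zero
  have hm' : (m ! : ℂ) ≠ 0 := by exact_mod_cast m.factorial_ne_zero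
  have hkm' : ((k + m)! : ℂ) ≠ 0 := by exact_mod_cast (k + m).factorial_ne_zero
  have hd : (m ! : ℂ) * ((k + m).descFactorial k : ℂ) = ((k + m)! : ℂ) := by
    have := Nat.factorial_mul_descFactorial (Nat.le_add_right k m)
    rw [Nat.add_sub_cancel_left] at this
    exact_mod_cast this
  have h4 : ((∫ y : Fin m → ℂ, jointWeight ν τ (Fin.append z y) : ℝ) : ℂ) =
      C₀ * (∏ a, ((conj (z a) - z a) * weight ν τ (z a))) * ((skewConst ν τ : ℂ) ^ m * m ! *
        pfaffian (preKernelMatrix ν τ (k + m) z)) := by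
    apply mul_left_cancel₀ hk'
    rw [h1]; ring
  rw [corr, h3, Complex.ofReal_mul, Complex.ofReal_mul, h4, Complex.ofReal_inv,
    partitionFunction_eq hν hτ0 hτ1 hC, Complex.ofReal_natCast, pow_add, ← hd]
  have hd' : ((k + m).descFactorial k : ℂ) ≠ 0 := fun h => hkm' (by rw [← hd, h, mul_zero])
  field_simp

end correlations

/-! ### The limit of the correlation functions -/

section limit

variable {ν τ : ℝ}

theorem pfaffian_smul {k : ℕ} (c : ℂ) (A : Matrix (Fin k × Fin 2) (Fin k × Fin 2) ℂ) :
    pfaffian (c • A) = c ^ k * pfaffian A := by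
  simp only [pfaffian, Matrix.smul_apply, smul_eq_mul, Finset.prod_mul_distrib, Finset.prod_const,
    Finset.card_univ, Fintype.card_fin, Finset.mul_sum]
  exact Finset.sum_congr rfl fun σ _ => by ring

/-- Each index occurs exactly once in every product of the Pfaffian, so the factors come out as
their full product. -/
theorem pfaffian_mul_mul {k : ℕ} (g : Fin k × Fin 2 → ℂ)
    (A : Matrix (Fin k × Fin 2) (Fin k × Fin 2) ℂ) :
    pfaffian (Matrix.of fun p q => g p * g q * A p q) = (∏ p, g p) * pfaffian A := by
  have h : ∀ σ : Equiv.Perm (Fin k × Fin 2),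
      ∏ i, (g (σ (i, 0)) * g (σ (i, 1))) = ∏ p, g p := by
    intro σ
    rw [← Equiv.prod_comp σ, Fintype.prod_prod_type]
    simp only [Fin.prod_univ_two]
  simp only [pfaffian, Matrix.of_apply]
  simp_rw [Finset.prod_mul_distrib (f := fun i => g _ * g _), h, Finset.mul_sum]
  exact Finset.sum_congr rfl fun σ _ => by ring

theorem tendsto_pfaffian {k : ℕ} {A : ℕ → Matrix (Fin k × Fin 2) (Fin k × Fin 2) ℂ}
    {B : Matrix (Fin k × Fin 2) (Fin k × Fin 2) ℂ}
    (h : ∀ p q, Tendsto (fun n => A n p q) atTop (𝓝 (B p q))) :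
    Tendsto (fun n => pfaffian (A n)) atTop (𝓝 (pfaffian B)) :=
  (tendsto_finsetSum _ fun _ _ => (tendsto_finsetProd _ fun _ _ => h _ _).const_mul _).const_mul _

theorem block_apply (f : ℂ → ℂ → ℂ) (z u : ℂ) (i j : Fin 2) :
    block f z u i j = f (![z, conj z] i) (![u, conj u] j) := by
  fin_cases i <;> fin_cases j <;> rfl

theorem blockMatrix_block {k : ℕ} (f : ℂ → ℂ → ℂ) (z : Fin k → ℂ) :
    blockMatrix (block f) z = Matrix.of fun p q => f (conjPair z p) (conjPair z q) := by
  ext p q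
  exact block_apply f _ _ _ _

theorem pfaffian_blockMatrix_kernel {k : ℕ} (N : ℕ) (z : Fin k → ℂ) :
    pfaffian (blockMatrix (kernel ν τ N) z) =
      pfaffian (preKernelMatrix ν τ N z) * ∏ i, (weight ν τ (z i) : ℂ) := by
  have h1 : blockMatrix (kernel ν τ N) z = Matrix.of fun p q =>
      ((√(weight ν τ (z p.1)) : ℝ) : ℂ) * ((√(weight ν τ (z q.1)) : ℝ) : ℂ) *
        preKernelMatrix ν τ N z p q := by
    ext p q
    rw [blockMatrix, kernel, Matrix.smul_apply, block_apply, Real.sqrt_mul (weight_nonneg _ _ _),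
      Complex.ofReal_mul, smul_eq_mul]
    rfl
  rw [h1, pfaffian_mul_mul (fun p => ((√(weight ν τ (z p.1)) : ℝ) : ℂ)), mul_comm,
    Fintype.prod_prod_type]
  congr 1
  refine Finset.prod_congr rfl fun i _ => ?_
  rw [Fin.prod_univ_two, ← Complex.ofReal_mul, Real.mul_self_sqrt (weight_nonneg _ _ _)]

/-- Per point, (1−τ²)² from rescaled Lebesgue measure and 1−τ² from z̄ − z give the cube in the
prefactor; the denominator is `skewConst`. -/
theorem scaled_corr_eq (hν : -1 < ν) (hτ0 : 0 < τ) (hτ1 : τ < 1) {N k : ℕ} (hk : k ≤ N)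
    (z : Fin k → ℂ) :
    (((1 - τ ^ 2) ^ (2 * k) * corr ν τ N k (fun i => (1 - τ ^ 2 : ℝ) * z i) : ℝ) : ℂ) =
      pfaffian ((((1 - τ ^ 2) ^ 3 / (Real.pi * Real.Gamma (ν + 2) * (1 - τ ^ 2) ^ 2) : ℝ) : ℂ) •
        blockMatrix (kernel ν τ N) (fun i => (1 - τ ^ 2 : ℝ) * z i)) *
          ∏ i, (conj (z i) - z i) := by
  have h1 : ∏ i, ((conj ((1 - τ ^ 2 : ℝ) * z i) - (1 - τ ^ 2 : ℝ) * z i) *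
      (weight ν τ ((1 - τ ^ 2 : ℝ) * z i) : ℂ)) = ((1 - τ ^ 2 : ℝ) : ℂ) ^ k *
      ((∏ i, (conj (z i) - z i)) * ∏ i, (weight ν τ ((1 - τ ^ 2 : ℝ) * z i) : ℂ)) := by
    have : ((1 - τ ^ 2 : ℝ) : ℂ) ^ k = ∏ _i : Fin k, ((1 - τ ^ 2 : ℝ) : ℂ) := by simp
    rw [this, ← Finset.prod_mul_distrib, ← Finset.prod_mul_distrib]
    refine Finset.prod_congr rfl fun i _ => ?_
    rw [map_mul, Complex.conj_ofReal]
    ring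
  rw [pfaffian_smul, pfaffian_blockMatrix_kernel, Complex.ofReal_mul,
    corr_eq_pfaffian hν hτ0 hτ1 hk, h1, ← skewConst, Complex.ofReal_div, div_pow,
    Complex.ofReal_pow, Complex.ofReal_pow]
  ring

/-- On the slit plane the cocycles at z_i and z̄_i are mutually inverse and disappear from the
Pfaffian. A point off the slit plane is real, and then both sides vanish through z̄ − z = 0. -/
theorem pfaffian_limit_mul_prod {k : ℕ} (z : Fin k → ℂ) (hz : ∀ i, z i ≠ 0) :
    pfaffian (blockMatrix (block fun a b => Complex.exp (-Complex.I * τ * (a + b).im) *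
        ginibreLimit ν a b) z) * ∏ i, (conj (z i) - z i) =
      pfaffian (blockMatrix (block (ginibreKernel ν)) z) * ∏ i, (conj (z i) - z i) := by
  by_cases h : ∀ i, z i ∈ Complex.slitPlane
  · set g : ℂ → ℂ := fun a => tauCocycle τ a * phaseCocycle ν a with hg
    have hne : ∀ p, conjPair z p ≠ 0 := by
      rintro ⟨i, j⟩
      fin_cases j <;> simp [conjPair, hz i]
    have h1 : blockMatrix (block fun a b => Complex.exp (-Complex.I * τ * (a + b).im) *
        ginibreLimit ν a b) z = Matrix.of fun p q => g (conjPair z p) * g (conjPair z q) *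
          blockMatrix (block (ginibreKernel ν)) z p q := by
      rw [blockMatrix_block, blockMatrix_block]
      ext p q
      simp only [Matrix.of_apply, hg]
      rw [exp_mul_ginibreLimit ν τ (hne p) (hne q)]
      ring
    have h2 : ∏ p, g (conjPair z p) = 1 := by
      rw [Fintype.prod_prod_type]
      refine Finset.prod_eq_one fun i _ => ?_
      have e1 := (tauCocycle_isCocycleOn τ).2.2 (z i) (Set.mem_univ _)
      have e2 := (phaseCocycle_isCocycleOn ν).2.2 (z i) (h i)
      have n1 : tauCocycle τ (z i) ≠ 0 := Complex.exp_ne_zero _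
      have n2 : phaseCocycle ν (z i) ≠ 0 := Complex.exp_ne_zero _
      simp only [Fin.prod_univ_two, conjPair, Matrix.cons_val_zero, Matrix.cons_val_one, hg, e1, e2]
      field_simp
    rw [h1, pfaffian_mul_mul (fun p => g (conjPair z p)), h2, one_mul]
  · push Not at h
    obtain ⟨i, hi⟩ := h
    have h0 : conj (z i) - z i = 0 := by
      rw [sub_eq_zero, Complex.conj_eq_iff_im]
      by_contra him
      exact hi (Complex.mem_slitPlane_iff.2 (Or.inr him))
    rw [Finset.prod_eq_zero (Finset.mem_univ i) h0, mul_zero, mul_zero]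

theorem tendsto_scaled_corr (hν : -1 < ν) (hτ0 : 0 < τ) (hτ1 : τ < 1) {k : ℕ} (z : Fin k → ℂ)
    (hz : ∀ i, z i ≠ 0) :
    Tendsto (fun N : ℕ => (((1 - τ ^ 2) ^ (2 * k) *
      corr ν τ N k (fun i => (1 - τ ^ 2 : ℝ) * z i) : ℝ) : ℂ)) atTop
      (𝓝 (pfaffian (blockMatrix (block (ginibreKernel ν)) z) * ∏ i, (conj (z i) - z i))) := by
  rw [← pfaffian_limit_mul_prod (τ := τ) z hz]
  refine Tendsto.congr' ((eventually_ge_atTop k).mono fun N hN =>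
    (scaled_corr_eq hν hτ0 hτ1 hN z).symm) ((tendsto_pfaffian fun p q => ?_).mul_const _)
  have h := tendsto_scaled_kernel hν hτ0 hτ1 (hz p.1) (hz q.1)
  exact ((continuous_id.matrix_elem p.2 q.2).tendsto _).comp h

end limit

end ChiralGinibre

theorem mainTheorem5 (ν τ : ℝ) (hν : -1 < ν) (hτ0 : 0 < τ) (hτ1 : τ < 1) :
    -- the limit of all matrix elements of the rescaled kernel
    (∀ z u : ℂ, z ≠ 0 → u ≠ 0 →
      Tendsto
        (fun N : ℕ =>
          (((1 - τ ^ 2) ^ 3 / (Real.pi * Real.Gamma (ν + 2) * (1 - τ ^ 2) ^ 2) : ℝ) : ℂ) •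
            ChiralGinibre.kernel ν τ N ((1 - τ ^ 2 : ℝ) * z) ((1 - τ ^ 2 : ℝ) * u))
        atTop
        (𝓝 (ChiralGinibre.block
          (fun a b => Complex.exp (-Complex.I * τ * (a + b).im) *
            ChiralGinibre.ginibreLimit ν a b) z u))) ∧
    -- the limit differs from the chiral symplectic Ginibre kernel only by cocycle factors
    (ChiralGinibre.IsCocycleOn Set.univ (ChiralGinibre.tauCocycle τ) ∧
      ChiralGinibre.IsCocycleOn Complex.slitPlane (ChiralGinibre.phaseCocycle ν) ∧
      ∀ z u : ℂ, z ≠ 0 → u ≠ 0 →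
        Complex.exp (-Complex.I * τ * (z + u).im) * ChiralGinibre.ginibreLimit ν z u =
          (ChiralGinibre.tauCocycle τ z * ChiralGinibre.tauCocycle τ u) *
            (ChiralGinibre.phaseCocycle ν z * ChiralGinibre.phaseCocycle ν u) *
            ChiralGinibre.ginibreKernel ν z u) ∧
    -- the rescaled correlation functions at the origin have a limit that does not depend on `τ`
    (∀ (k : ℕ) (z : Fin k → ℂ), (∀ i, z i ≠ 0) →
      Tendsto
        (fun N : ℕ => (((1 - τ ^ 2) ^ (2 * k) *
          ChiralGinibre.corr ν τ N k (fun i => (1 - τ ^ 2 : ℝ) * z i) : ℝ) : ℂ))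
        atTop
        (𝓝 (ChiralGinibre.pfaffian
            (ChiralGinibre.blockMatrix
              (ChiralGinibre.block (ChiralGinibre.ginibreKernel ν)) z) *
          ∏ i, (conj (z i) - z i)))) := by
  exact ⟨fun z u hz hu => ChiralGinibre.tendsto_scaled_kernel hν hτ0 hτ1 hz hu,
    ⟨ChiralGinibre.tauCocycle_isCocycleOn τ, ChiralGinibre.phaseCocycle_isCocycleOn ν,
      fun z u hz hu => ChiralGinibre.exp_mul_ginibreLimit ν τ hz hu⟩,
    fun k z hz => ChiralGinibre.tendsto_scaled_corr hν hτ0 hτ1 z hz⟩
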